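/- An isosceles piece is a planar isosceles triangle with a marked base, or an isosceles trapezoid (rectangles included) with a marked pair of parallel base sides having a common perpendicular bisector; its two other sides are its $Q$-sides. The vertex of a triangle opposite the base is regarded as a second base side of length $0$. A $Q$-segment of a piece joins a point of one base side to the point of the other base side in the same relative position. A $P$-segment is a segment parallel to the base sides, with one endpoint on each $Q$-side, whose interior lies in the interior of the piece (so base sides are not $P$-segments). A $P$-path is a simple polygonal arc formed by adjoining $P$-segments end-to-end. An isosceles dissection of a plane domain $\Omega$ (a connected open set) is a finite collection of disjoint open isosceles pieces contained in $\Omega$, whose closures cover $\Omega$, such that whenever sides of two distinct pieces meet in more than one point, both sides are $Q$-sides. A chain is a maximal collection of distinct pieces $T_1,\dots,T_k$ such that $T_j$ and $T_{j+1}$ have an identical $Q$-side for $1\le j<k$; its $Q$-ends are the $Q$-side of $T_1$ not shared with $T_2$ and the $Q$-side of $T_k$ not shared with $T_{k-1}$ (both $Q$-sides if $k=1$). A tube (of positive width) is the closed region swept out by the parallel paths $\gamma_s$, $0\le s\le 1$, that cross a fixed sequence of pieces in a fixed order, where in each piece the height of $\gamma_s$ is affine and non-constant in $s$; the $P$-sides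 $\gamma_0,\gamma_1$ are allowed to contain base sides of pieces. The starting points of the $\gamma_s$ form one $Q$-end of the tube, and their final points the other. A return path is a $P$-path that begins and ends on the same $Q$-side $S$ of some piece and meets every $Q$-segment of every piece in at most three points. It is a C-curve if it starts and ends on the same side of $S$ and $\gamma\cup S$ separates both endpoints of $S$ from $\infty$ (they are not in the closure of the unbounded component of the complement of $\gamma\cup S$); an S-curve (respectively a G1-curve) if it starts and ends on different sides of $S$, crosses $S$ exactly once in between, and the crossing point separates (respectively does not separate) its endpoints on $S$; and a G2-curve if it starts and ends on different sides of $S$ and does not cross $S$ in between. A standard return region is a tube whose paths $\gamma_s$, $0<s<1$, are all return paths of one and the same of these four types with respect to one $Q$-side $S$, and whose two $Q$-ends are each contained in a $Q$-end of some chain (possibly the same chain or two different chains). **Lemma.** There is an absolute constant $K$ such that the following holds. If a plane domain $\Omega$ has an isosceles dissection into $n$ pieces with $M$ chains, then there are at most $KM$ standard return regions with pairwise disjoint interiors such that every $P$-path with more than $5n+1$ segments intersects at least one of them. -/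

import Mathlib

open Set

namespace Iso

/-- An isosceles piece (isosceles triangle or isosceles trapezoid) in the plane `ℂ`, with marked base
sides.  `m₀` and `m₁` are the midpoints of the two base sides and `r₀`, `r₁` are the half lengths of the
base sides, which are both orthogonal to the axis from `m₀` to `m₁`.  If `r₀ = 0` or `r₁ = 0`, the piece is
an isosceles triangle, the corresponding base side being the vertex opposite to the base. -/
structure Piece where
  m₀ : ℂ
  m₁ : ℂ
  r₀ : ℝ
  r₁ : ℝ
  ne : m₀ ≠ m₁
  r₀_nonneg : 0 ≤ r₀
  r₁_nonneg : 0 ≤ r₁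
  r_pos : 0 < r₀ + r₁

namespace Piece

/-- The unit vector in the direction of the base sides. -/
noncomputable def dir (T : Piece) : ℂ := Complex.I * ((T.m₁ - T.m₀) / (‖T.m₁ - T.m₀‖ : ℂ))

/-- Coordinates on a piece: `t ∈ [0,1]` is the height between the two base sides (`t = 0`, `t = 1`), and
`s ∈ [-1,1]` is the relative position between the two non-base sides (`s = -1`, `s = 1`). -/
noncomputable def pt (T : Piece) (s t : ℝ) : ℂ :=
  ((1 - t : ℝ) : ℂ) * T.m₀ + (t : ℂ) * T.m₁ + ((s * ((1 - t) * T.r₀ + t * T.r₁) : ℝ) : ℂ) * T.dir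

/-- The open triangle or trapezoid. -/
def openSet (T : Piece) : Set ℂ := image2 T.pt (Ioo (-1) 1) (Ioo 0 1)

/-- The `Q`-segments, `s ∈ [-1,1]`: they join the points of one base side to their affine images on the
other base side (to the vertex, for a triangle). -/
noncomputable def qSeg (T : Piece) (s : ℝ) : Set ℂ := segment ℝ (T.pt s 0) (T.pt s 1)

/-- The segment at height `t` parallel to the base sides: a `P`-segment for `0 < t < 1`, a base side for
`t = 0` and `t = 1`. -/
noncomputable def pSeg (T : Piece) (t : ℝ) : Set ℂ := segment ℝ (T.pt (-1) t) (T.pt 1 t)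

/-- The value of the coordinate `s` on the two `Q`-sides. -/
def sgn (b : Bool) : ℝ := if b then 1 else -1

/-- The two `Q`-sides (non-base sides). -/
noncomputable def qSide (T : Piece) (b : Bool) : Set ℂ := T.qSeg (sgn b)

/-- `e` is one of the two `Q`-sides. -/
def IsQSide (T : Piece) (e : Set ℂ) : Prop := ∃ b, e = T.qSide b

/-- `e` is one of the two base sides (possibly the vertex of a triangle). -/
def IsBase (T : Piece) (e : Set ℂ) : Prop := e = T.pSeg 0 ∨ e = T.pSeg 1

/-- `e` is one of the sides. -/
def IsSide (T : Piece) (e : Set ℂ) : Prop := T.IsQSide e ∨ T.IsBase e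

/-- Which side of the line through the `Q`-side `b` the point `z` is on: the sign of this number. -/
noncomputable def sideOf (T : Piece) (b : Bool) (z : ℂ) : ℝ :=
  ((starRingEnd ℂ) (T.pt (sgn b) 1 - T.pt (sgn b) 0) * (z - T.pt (sgn b) 0)).im

end Piece

/-- The pieces `T 0, …, T (n-1)` form an isosceles dissection of the plane domain `Ω`. -/
structure IsDissection {n : ℕ} (Ω : Set ℂ) (T : Fin n → Piece) : Prop where
  isOpen : IsOpen Ω
  isConnected : IsConnected Ω
  subset : ∀ i, (T i).openSet ⊆ Ω
  disj : ∀ i j, i ≠ j → Disjoint (T i).openSet (T j).openSet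
  cover : Ω ⊆ ⋃ i, closure (T i).openSet
  sides : ∀ i j, i ≠ j → ∀ e f, (T i).IsSide e → (T j).IsSide f → (e ∩ f).Nontrivial →
    (T i).IsQSide e ∧ (T j).IsQSide f

/-- Two distinct pieces have an identical `Q`-side. -/
def SharesQSide {n : ℕ} (T : Fin n → Piece) (i j : Fin n) : Prop :=
  i ≠ j ∧ ∃ b c, (T i).qSide b = (T j).qSide c

/-- Distinct pieces listed so that each one shares a `Q`-side with the next one. -/
def IsPreChain {n : ℕ} (T : Fin n → Piece) (L : List (Fin n)) : Prop :=
  L ≠ [] ∧ L.Nodup ∧ L.IsChain (SharesQSide T)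

/-- A chain, in one of its possible orderings: no larger collection of pieces is of this kind. -/
def IsChainList {n : ℕ} (T : Fin n → Piece) (L : List (Fin n)) : Prop :=
  IsPreChain T L ∧ ∀ L', IsPreChain T L' → L ⊆ L' → L' ⊆ L

/-- The chains, as collections of pieces. -/
def chains {n : ℕ} (T : Fin n → Piece) : Set (Finset (Fin n)) :=
  {C | ∃ L, IsChainList T L ∧ L.toFinset = C}

/-- The number of chains. -/
noncomputable def numChains {n : ℕ} (T : Fin n → Piece) : ℕ := (chains T).ncard

/-- The `Q`-side `b` of the piece `j` is a `Q`-end of a chain: the chain can be listed starting with `j`, and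
the side is not shared with the second piece of the list, if there is one.  (Listing a chain backwards turns
its last piece into the first one.) -/
def IsQEnd {n : ℕ} (T : Fin n → Piece) (j : Fin n) (b : Bool) : Prop :=
  ∃ L, IsChainList T (j :: L) ∧ ∀ i ∈ L.head?, ∀ c, (T j).qSide b ≠ (T i).qSide c

/-- One crossing of a piece from one `Q`-side to the other: from `s = -1` to `s = 1` if `fwd`, and from
`s = 1` to `s = -1` otherwise. -/
structure Crossing (n : ℕ) where
  piece : Fin n
  fwd : Bool

namespace Crossing

/-- The point where the crossing at height `t` enters the piece. -/
noncomputable def entry {n : ℕ} (T : Fin n → Piece) (c : Crossing n) (t : ℝ) : ℂ :=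
  (T c.piece).pt (Piece.sgn (!c.fwd)) t

/-- The point where the crossing at height `t` leaves the piece. -/
noncomputable def exit {n : ℕ} (T : Fin n → Piece) (c : Crossing n) (t : ℝ) : ℂ :=
  (T c.piece).pt (Piece.sgn c.fwd) t

end Crossing

/-- A nonempty finite sequence of crossings of pieces (there are `last + 1` of them) at given heights. -/
structure Track (n : ℕ) where
  last : ℕ
  cross : Fin (last + 1) → Crossing n
  height : Fin (last + 1) → ℝ

namespace Track

variable {n : ℕ}

/-- The number of segments. -/
def numSegs (γ : Track n) : ℕ := γ.last + 1

/-- The `k`-th segment. -/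
noncomputable def seg (T : Fin n → Piece) (γ : Track n) (k : Fin (γ.last + 1)) : Set ℂ :=
  (T (γ.cross k).piece).pSeg (γ.height k)

/-- The initial point of the `k`-th segment. -/
noncomputable def entry (T : Fin n → Piece) (γ : Track n) (k : Fin (γ.last + 1)) : ℂ :=
  (γ.cross k).entry T (γ.height k)

/-- The final point of the `k`-th segment. -/
noncomputable def exit (T : Fin n → Piece) (γ : Track n) (k : Fin (γ.last + 1)) : ℂ :=
  (γ.cross k).exit T (γ.height k)

/-- The union of the segments. -/
noncomputable def carrier (T : Fin n → Piece) (γ : Track n) : Set ℂ := ⋃ k, γ.seg T k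

/-- The initial point. -/
noncomputable def start (T : Fin n → Piece) (γ : Track n) : ℂ := γ.entry T 0

/-- The final point. -/
noncomputable def finish (T : Fin n → Piece) (γ : Track n) : ℂ := γ.exit T (Fin.last γ.last)

/-- Consecutive segments are joined end-to-end. -/
def Joined (T : Fin n → Piece) (γ : Track n) : Prop :=
  ∀ i j : Fin (γ.last + 1), (j : ℕ) = i + 1 → γ.exit T i = γ.entry T j

/-- A `P`-path: a simple polygonal arc formed by adjoining `P`-segments end-to-end. -/
structure IsPPath (T : Fin n → Piece) (γ : Track n) : Prop where
  height_mem : ∀ k, γ.height k ∈ Ioo (0 : ℝ) 1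
  joined : γ.Joined T
  simple : ∀ i j : Fin (γ.last + 1), i < j → ∀ z, z ∈ γ.seg T i → z ∈ γ.seg T j →
    (j : ℕ) = i + 1 ∧ z = γ.exit T i

/-- A `P`-path that begins and ends on the `Q`-side `b` of the piece `j` and intersects any `Q`-segment of
any piece at most three times. -/
structure IsReturnPath (T : Fin n → Piece) (j : Fin n) (b : Bool) (γ : Track n) : Prop where
  isPPath : γ.IsPPath T
  start_mem : γ.start T ∈ (T j).qSide b
  finish_mem : γ.finish T ∈ (T j).qSide b
  le_three : ∀ i, ∀ s ∈ Icc (-1 : ℝ) 1, (γ.carrier T ∩ (T i).qSeg s).encard ≤ 3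

/-- The points, other than the two endpoints, where `γ` crosses the `Q`-side. -/
noncomputable def crossings (T : Fin n → Piece) (j : Fin n) (b : Bool) (γ : Track n) : Set ℂ :=
  {z | z ∈ γ.carrier T ∩ (T j).qSide b ∧ z ≠ γ.start T ∧ z ≠ γ.finish T}

/-- The first and the last segment of `γ` lie on the same side of the `Q`-side. -/
def SameSide (T : Fin n → Piece) (j : Fin n) (b : Bool) (γ : Track n) : Prop :=
  0 < (T j).sideOf b (γ.exit T 0) * (T j).sideOf b (γ.entry T (Fin.last γ.last))

/-- The first and the last segment of `γ` lie on different sides of the `Q`-side. -/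
def OppSide (T : Fin n → Piece) (j : Fin n) (b : Bool) (γ : Track n) : Prop :=
  (T j).sideOf b (γ.exit T 0) * (T j).sideOf b (γ.entry T (Fin.last γ.last)) < 0

end Track

/-- The union of the unbounded components of the complement of `X` (there is exactly one if `X` is a
compact subset of the plane). -/
def unboundedPart (X : Set ℂ) : Set ℂ :=
  {z | z ∈ Xᶜ ∧ ¬ Bornology.IsBounded (connectedComponentIn Xᶜ z)}

/-- The four types of return paths. -/
inductive Kind
  | C
  | S
  | G1
  | G2

/-- `γ` is a return path of the given type with respect to the `Q`-side `b` of the piece `j`. -/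
def IsReturnCurve {n : ℕ} (T : Fin n → Piece) (j : Fin n) (b : Bool) (γ : Track n) : Kind → Prop
  | Kind.C => γ.IsReturnPath T j b ∧ γ.SameSide T j b ∧
      ∀ t ∈ ({0, 1} : Set ℝ),
        (T j).pt (Piece.sgn b) t ∉ closure (unboundedPart (γ.carrier T ∪ (T j).qSide b))
  | Kind.S => γ.IsReturnPath T j b ∧ γ.OppSide T j b ∧
      ∃ z, γ.crossings T j b = {z} ∧ z ∈ segment ℝ (γ.start T) (γ.finish T)
  | Kind.G1 => γ.IsReturnPath T j b ∧ γ.OppSide T j b ∧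
      ∃ z, γ.crossings T j b = {z} ∧ z ∉ segment ℝ (γ.start T) (γ.finish T)
  | Kind.G2 => γ.IsReturnPath T j b ∧ γ.OppSide T j b ∧ γ.crossings T j b = ∅

/-- A tube of positive width: a sequence of crossings of pieces, with two parallel `P`-sides crossing these
pieces at the heights `h₀` and `h₁`.  The `P`-sides may contain base sides of pieces (heights `0` and `1`). -/
structure Tube {n : ℕ} (T : Fin n → Piece) where
  last : ℕ
  cross : Fin (last + 1) → Crossing n
  h₀ : Fin (last + 1) → ℝ
  h₁ : Fin (last + 1) → ℝ
  h₀_mem : ∀ k, h₀ k ∈ Icc (0 : ℝ) 1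
  h₁_mem : ∀ k, h₁ k ∈ Icc (0 : ℝ) 1
  ne : ∀ k, h₀ k ≠ h₁ k
  joined₀ : Track.Joined T ⟨last, cross, h₀⟩
  joined₁ : Track.Joined T ⟨last, cross, h₁⟩

namespace Tube

variable {n : ℕ} {T : Fin n → Piece}

/-- The parallel paths of the tube; `s = 0` and `s = 1` give the two `P`-sides. -/
def path (R : Tube T) (s : ℝ) : Track n := ⟨R.last, R.cross, fun k => (1 - s) * R.h₀ k + s * R.h₁ k⟩

/-- The tube as a (closed) region: the union of the `Q`-segments that connect the two `P`-sides, which is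
the union of the parallel paths. -/
noncomputable def carrier (R : Tube T) : Set ℂ := ⋃ s ∈ Icc (0 : ℝ) 1, (R.path s).carrier T

/-- A return tube of the given type: the parallel paths strictly between the two `P`-sides are return
paths of this type, with respect to one `Q`-side. -/
def IsReturnTube (R : Tube T) (κ : Kind) : Prop :=
  ∃ j b, ∀ s ∈ Ioo (0 : ℝ) 1, IsReturnCurve T j b (R.path s) κ

/-- A standard return region: a return tube of one of the four types that begins and ends on segments that
are `Q`-ends of chains. -/
def IsStandard (R : Tube T) : Prop :=
  (∃ κ, R.IsReturnTube κ) ∧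
  (∃ j b, IsQEnd T j b ∧ ∀ s ∈ Icc (0 : ℝ) 1, (R.path s).start T ∈ (T j).qSide b) ∧
  (∃ j b, IsQEnd T j b ∧ ∀ s ∈ Icc (0 : ℝ) 1, (R.path s).finish T ∈ (T j).qSide b)

end Tube

end Iso

/-! The crossings of pieces form a finite alphabet. A letter is a piece together with the `Q`-side
through which it is left, so there are `2n` letters; a state adds the arc length parameter of the
exit point. Touching `Q`-sides of different pieces have opposite tangents, so the passage from one
letter to the next is a translation, and a `P`-path is an orbit without repeated states. A gate is a
letter whose entry side is shared with no other piece; `M` chains allow at most `2M` gates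
(`card_gate_le`).

Without a gate between two occurrences of a letter, the distance to the lower end of the side would
be preserved and the state would repeat. Away from gates predecessors are unique. Hence an orbit
that visits some letter three times, as more than `4n` segments force, contains a window starting at
a gate: a stretch that returns to its first letter without any other repetition
(`IsPath.exists_window`). The windows with a given word are parallel lines, and an interval of them
sweeps out a tube. Distinctness of the letters gives the bound three for `Q`-segments. The returning
path comes back to the entry side of its first letter from across, so the tube is of type `S`, `G1`
or `G2`.

It remains to meet all windows by boundedly many disjoint strips per gate. In one round
(`exists_round`) a widest free strip is chosen at each corner, a corner being a lower end at a gate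
or an end of an edge of an earlier strip. A free line need not be hit by the new strips, but it
shares a state with a free line that is hit. If it is not hit itself, that other window must
continue beyond one of its two ends. Windows are never strictly nested (`IsWin.not_nested`), and
therefore two rounds cannot both do this at the same end (`IsWin.false_of_blocked`). After three
rounds every window is hit. Cutting with the widest strip first makes strips disjoint without
increasing their number (`exists_disjoint_strips`). -/

namespace Iso

/-! ### Strips and isometric overlaps -/

/-- An interval `[p, q]` of lines labelled by `idx`. -/
structure Strip (ι : Type*) where
  idx : ι
  p : ℝ
  q : ℝ
  lt : p < q

/-- The line `x` of `i` meets one of the closed strips in `X`. -/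
def Hit {ι : Type*} (Ov : ι → ℝ → ι → ℝ → Prop) (X : List (Strip ι)) (i : ι) (x : ℝ) : Prop :=
  ∃ s ∈ X, ∃ y ∈ Icc s.p s.q, Ov i x s.idx y

/-- For each pair of labels, the relation `Ov` is the union of the graphs of finitely many isometries. -/
structure IsometricOverlap {ι : Type*} (Ov : ι → ℝ → ι → ℝ → Prop) : Prop where
  refl : ∀ i x, Ov i x i x
  symm : ∀ i x j y, Ov i x j y → Ov j y i x
  graphs : ∀ i j, ∃ E : Set (ℝ × ℝ), E.Finite ∧ (∀ e ∈ E, e.1 = 1 ∨ e.1 = -1) ∧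
    ∀ x y, Ov i x j y ↔ ∃ e ∈ E, y = e.1 * x + e.2

/-- The open strips are pairwise disjoint. -/
def DisjointStrips {ι : Type*} (Ov : ι → ℝ → ι → ℝ → Prop) (s t : Strip ι) : Prop :=
  ∀ x ∈ Ioo s.p s.q, ∀ y ∈ Ioo t.p t.q, ¬ Ov s.idx x t.idx y

section Overlap

variable {ι : Type*} {Ov : ι → ℝ → ι → ℝ → Prop}

theorem IsometricOverlap.isClosed_hit_strip (h : IsometricOverlap Ov) (i : ι) (s : Strip ι) :
    IsClosed {x | ∃ y ∈ Icc s.p s.q, Ov i x s.idx y} := by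
  obtain ⟨E, hE, -, hEO⟩ := h.graphs i s.idx
  have : {x | ∃ y ∈ Icc s.p s.q, Ov i x s.idx y}
      = ⋃ e ∈ E, (fun x : ℝ => e.1 * x + e.2) ⁻¹' Icc s.p s.q := by
    ext x
    simp only [mem_ofPred_eq, hEO, mem_iUnion, mem_preimage, exists_prop]
    constructor
    · rintro ⟨y, hy, e, he, rfl⟩
      exact ⟨e, he, hy⟩
    · rintro ⟨e, he, hy⟩
      exact ⟨_, hy, e, he, rfl⟩
  rw [this]
  exact hE.isClosed_biUnion fun e _ => isClosed_Icc.preimage (by fun_prop)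

theorem IsometricOverlap.isClosed_hit (h : IsometricOverlap Ov) (X : List (Strip ι)) (i : ι) :
    IsClosed {x | Hit Ov X i x} := by
  have : {x | Hit Ov X i x} = ⋃ s ∈ {s | s ∈ X}, {x | ∃ y ∈ Icc s.p s.q, Ov i x s.idx y} := by
    ext x; simp [Hit]
  rw [this]
  exact (List.finite_toSet X).isClosed_biUnion fun s _ => h.isClosed_hit_strip i s

theorem Hit.mono {X Y : List (Strip ι)} (hXY : ∀ s ∈ X, s ∈ Y) {i : ι} {x : ℝ} (h : Hit Ov X i x) :
    Hit Ov Y i x := by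
  obtain ⟨s, hs, h⟩ := h
  exact ⟨s, hXY s hs, h⟩

/-- What a strip leaves uncovered of a narrower one is an interval. -/
theorem IsometricOverlap.exists_remainder (h : IsometricOverlap Ov) (f g : Strip ι)
    (hfg : g.q - g.p ≤ f.q - f.p) (x₀ : ℝ) (hx₀ : x₀ ∈ Ioo g.p g.q)
    (hx₀' : ¬ ∃ y ∈ Icc f.p f.q, Ov g.idx x₀ f.idx y) :
    ∃ t : Strip ι, t.idx = g.idx ∧ g.p ≤ t.p ∧ t.q ≤ g.q ∧
      ∀ x, x ∈ Ioo t.p t.q ↔ x ∈ Ioo g.p g.q ∧ ¬ ∃ y ∈ Icc f.p f.q, Ov g.idx x f.idx y := by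
  set O : Set ℝ := Ioo g.p g.q ∩ {x | ∃ y ∈ Icc f.p f.q, Ov g.idx x f.idx y}ᶜ with hO
  have hopen : IsOpen O := isOpen_Ioo.inter (h.isClosed_hit_strip g.idx f).isOpen_compl
  have hconn : OrdConnected O := by
    rw [ordConnected_def]
    rintro x ⟨hx, hx'⟩ z ⟨hz, hz'⟩ y hy
    refine ⟨⟨hx.1.trans_le hy.1, hy.2.trans_lt hz.2⟩, ?_⟩
    rintro ⟨v, hv, hov⟩
    obtain ⟨E, -, hE1, hEO⟩ := h.graphs g.idx f.idx
    obtain ⟨e, he, rfl⟩ := (hEO _ _).1 hov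
    have key : ∀ u, e.1 * u + e.2 ∈ Icc f.p f.q → u ∈ {x | ∃ y ∈ Icc f.p f.q, Ov g.idx x f.idx y} :=
      fun u hu => ⟨_, hu, (hEO _ _).2 ⟨e, he, rfl⟩⟩
    have h1 : ¬ e.1 * x + e.2 ∈ Icc f.p f.q := fun hc => hx' (key x hc)
    have h2 : ¬ e.1 * z + e.2 ∈ Icc f.p f.q := fun hc => hz' (key z hc)
    simp only [mem_Icc, mem_Ioo, not_and_or, not_le] at *
    -- The slope is `±1`, so the preimage of `[f.p, f.q]` through `y` is an interval as long as `f`.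
    -- It would have to fit between `x` and `z`, inside the open strip `g`, which is no longer than
    -- `f`.
    rcases hE1 e he with h3 | h3 <;> rw [h3] at h1 h2 hv <;>
      rcases h1 with h1 | h1 <;> rcases h2 with h2 | h2 <;> linarith [hy.1, hy.2, hx.1, hz.2, hv.1, hv.2]
  have hne : O.Nonempty := ⟨x₀, hx₀, hx₀'⟩
  have hbb : BddBelow O := ⟨g.p, fun x hx => hx.1.1.le⟩
  have hba : BddAbove O := ⟨g.q, fun x hx => hx.1.2.le⟩
  have hIoo : O = Ioo (sInf O) (sSup O) := by
    apply Subset.antisymm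
    · intro x hx
      obtain ⟨ε, hε, hball⟩ := Metric.isOpen_iff.1 hopen x hx
      have hl : x - ε / 2 ∈ O := hball (by simp [abs_of_pos hε, hε])
      have hr : x + ε / 2 ∈ O := hball (by simp [abs_of_pos hε, hε])
      have := csInf_le hbb hl
      have := le_csSup hba hr
      constructor <;> linarith
    · rintro x ⟨hx1, hx2⟩
      obtain ⟨a, ha, hax⟩ := exists_lt_of_csInf_lt hne hx1
      obtain ⟨b, hb, hbx⟩ := exists_lt_of_lt_csSup hne hx2
      exact hconn.out ha hb ⟨hax.le, hbx.le⟩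
  have hx0 : x₀ ∈ Ioo (sInf O) (sSup O) := hIoo ▸ ⟨hx₀, hx₀'⟩
  refine ⟨⟨g.idx, sInf O, sSup O, hx0.1.trans hx0.2⟩, rfl, le_csInf hne fun x hx => hx.1.1.le,
    csSup_le hne fun x hx => hx.1.2.le, fun x => ?_⟩
  show x ∈ Ioo (sInf O) (sSup O) ↔ _
  rw [← hIoo]
  rfl

/-- Each strip leaves at most one remainder, and a strip that is covered entirely leaves none, so
the number does not grow. -/
theorem IsometricOverlap.exists_remainders (h : IsometricOverlap Ov) (f : Strip ι) (G : List (Strip ι))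
    (hG : ∀ g ∈ G, g.q - g.p ≤ f.q - f.p) :
    ∃ H : List (Strip ι), H.length ≤ G.length ∧
      (∀ t ∈ H, (∃ g ∈ G, t.idx = g.idx ∧ g.p ≤ t.p ∧ t.q ≤ g.q) ∧
        ∀ x ∈ Ioo t.p t.q, ∀ y ∈ Icc f.p f.q, ¬ Ov t.idx x f.idx y) ∧
      ∀ g ∈ G, ∀ x ∈ Ioo g.p g.q, (∃ y ∈ Icc f.p f.q, Ov g.idx x f.idx y) ∨
        ∃ t ∈ H, t.idx = g.idx ∧ x ∈ Ioo t.p t.q := by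
  induction G with
  | nil => exact ⟨[], by simp, by simp, by simp⟩
  | cons g G ih =>
    obtain ⟨H, hlen, hH, hcov⟩ := ih fun g hg => hG g (List.mem_cons_of_mem _ hg)
    by_cases hx : ∃ x₀ ∈ Ioo g.p g.q, ¬ ∃ y ∈ Icc f.p f.q, Ov g.idx x₀ f.idx y
    · obtain ⟨x₀, hx₀, hx₀'⟩ := hx
      obtain ⟨t, hti, htp, htq, ht⟩ := h.exists_remainder f g (hG g (by simp)) x₀ hx₀ hx₀'
      refine ⟨t :: H, by simpa using hlen, ?_, ?_⟩
      · intro s hs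
        rcases List.mem_cons.1 hs with rfl | hs
        · refine ⟨⟨g, by simp, hti, htp, htq⟩, fun x hx y hy hov => ?_⟩
          exact ((ht x).1 hx).2 ⟨y, hy, hti ▸ hov⟩
        · obtain ⟨⟨g', hg', h'⟩, h''⟩ := hH s hs
          exact ⟨⟨g', List.mem_cons_of_mem _ hg', h'⟩, h''⟩
      · intro g' hg' x hx
        rcases List.mem_cons.1 hg' with rfl | hg'
        · by_cases hc : ∃ y ∈ Icc f.p f.q, Ov g'.idx x f.idx y
          · exact Or.inl hc
          · exact Or.inr ⟨t, by simp, hti, (ht x).2 ⟨hx, hc⟩⟩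
        · rcases hcov g' hg' x hx with hc | ⟨t', ht', h'⟩
          · exact Or.inl hc
          · exact Or.inr ⟨t', List.mem_cons_of_mem _ ht', h'⟩
    · push Not at hx
      refine ⟨H, by simpa using hlen.trans (Nat.le_succ _), ?_, ?_⟩
      · intro s hs
        obtain ⟨⟨g', hg', h'⟩, h''⟩ := hH s hs
        exact ⟨⟨g', List.mem_cons_of_mem _ hg', h'⟩, h''⟩
      · intro g' hg' x hx'
        rcases List.mem_cons.1 hg' with rfl | hg'
        · exact Or.inl (hx x hx')
        · exact hcov g' hg' x hx'

/-- Selecting a widest strip and cutting the others, again and again, makes a family of strips disjoint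
without increasing their number. -/
theorem IsometricOverlap.exists_disjoint_strips (h : IsometricOverlap Ov) (n : ℕ) (F : List (Strip ι))
    (hF : F.length ≤ n) :
    ∃ X : List (Strip ι), X.length ≤ F.length ∧
      (∀ s ∈ X, ∃ f ∈ F, s.idx = f.idx ∧ f.p ≤ s.p ∧ s.q ≤ f.q) ∧
      X.Pairwise (DisjointStrips Ov) ∧
      ∀ f ∈ F, ∀ x ∈ Ioo f.p f.q, Hit Ov X f.idx x := by
  classical
  induction n generalizing F with
  | zero =>
    obtain rfl : F = [] := List.length_eq_zero_iff.1 (Nat.le_zero.1 hF)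
    exact ⟨[], by simp, by simp, by simp, by simp⟩
  | succ n ih =>
    rcases eq_or_ne F [] with rfl | hne
    · exact ⟨[], by simp, by simp, by simp, by simp⟩
    obtain ⟨f, hf, hmax⟩ : ∃ f ∈ F, ∀ g ∈ F, g.q - g.p ≤ f.q - f.p := by
      obtain ⟨f, hf, hm⟩ := F.toFinset.exists_max_image (fun g => g.q - g.p)
        (by simpa [Finset.nonempty_iff_ne_empty] using hne)
      exact ⟨f, by simpa using hf, fun g hg => hm g (by simpa using hg)⟩
    have hperm := List.perm_cons_erase hf
    have hlen : F.length = (F.erase f).length + 1 := by simpa using hperm.length_eq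
    obtain ⟨H, hHl, hH, hcov⟩ := h.exists_remainders f (F.erase f)
      fun g hg => hmax g (List.mem_of_mem_erase hg)
    obtain ⟨X, hXl, hXs, hXd, hXh⟩ := ih H (by omega)
    refine ⟨f :: X, by simp; omega, ?_, ?_, ?_⟩
    · intro s hs
      rcases List.mem_cons.1 hs with rfl | hs
      · exact ⟨s, hf, rfl, le_rfl, le_rfl⟩
      · obtain ⟨t, ht, h1, h2, h3⟩ := hXs s hs
        obtain ⟨⟨g, hg, h1', h2', h3'⟩, -⟩ := hH t ht
        exact ⟨g, List.mem_of_mem_erase hg, h1.trans h1', h2'.trans h2, h3.trans h3'⟩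
    · refine List.pairwise_cons.2 ⟨fun s hs x hx y hy hov => ?_, hXd⟩
      obtain ⟨t, ht, h1, h2, h3⟩ := hXs s hs
      exact (hH t ht).2 y ⟨h2.trans_lt hy.1, hy.2.trans_le h3⟩ x ⟨hx.1.le, hx.2.le⟩
        (h1 ▸ h.symm _ _ _ _ hov)
    · intro g hg x hx
      rcases List.mem_cons.1 (hperm.mem_iff.1 hg) with rfl | hg
      · exact ⟨g, by simp, x, ⟨hx.1.le, hx.2.le⟩, h.refl _ _⟩
      · rcases hcov g hg x hx with ⟨y, hy, hov⟩ | ⟨t, ht, hti, hxt⟩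
        · exact ⟨f, by simp, y, hy, hov⟩
        · exact hti ▸ (hXh t ht x hxt).mono fun s hs => List.mem_cons_of_mem _ hs

end Overlap

/-! ### Symbolic flow, orbits and windows -/

/-- A symbolic model of the parallel flow: states are pairs of a letter `a` and a transversal coordinate
in `(lo a, hi a)`, the flow passes from a letter to a next one by a translation, and `bar` reverses its
direction.  A letter is followed into unambiguously, with matching lower ends, unless it is a gate. -/
structure IntervalFlow (α : Type*) where
  bar : α → α
  lo : α → ℝ
  hi : α → ℝ
  nxt : α → α → Prop
  tr : α → α → ℝ
  gate : Finset α
  bar_bar : ∀ a, bar (bar a) = a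
  bar_ne : ∀ a, bar a ≠ a
  hi_bar : ∀ a, hi (bar a) = -lo a
  nxt_bar : ∀ a b, nxt a b → nxt (bar b) (bar a)
  tr_bar : ∀ a b, nxt a b → tr (bar b) (bar a) = tr a b
  not_nxt_bar : ∀ a, ¬ nxt a (bar a)
  det : ∀ a b c y, nxt a b → nxt a c → y ∈ Ioo (lo a) (hi a) → y + tr a b ∈ Ioo (lo b) (hi b) →
    y + tr a c ∈ Ioo (lo c) (hi c) → b = c
  lo_eq : ∀ a b, nxt a b → b ∉ gate → lo b = lo a + tr a b
  prev_unique : ∀ a b c, nxt a c → nxt b c → c ∉ gate → a = b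

namespace IntervalFlow

variable {α : Type*} (F : IntervalFlow α)

theorem lo_bar (a : α) : F.lo (F.bar a) = -F.hi a := by
  have := F.hi_bar (F.bar a)
  rw [F.bar_bar] at this
  linarith

def Valid (s : α × ℝ) : Prop := s.2 ∈ Ioo (F.lo s.1) (F.hi s.1)

def rev (s : α × ℝ) : α × ℝ := (F.bar s.1, -s.2)

def Step (s t : α × ℝ) : Prop := F.Valid s ∧ F.Valid t ∧ F.nxt s.1 t.1 ∧ t.2 = s.2 + F.tr s.1 t.1

@[simp] theorem rev_rev (s : α × ℝ) : F.rev (F.rev s) = s := by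
  simp [rev, F.bar_bar]

theorem rev_injective : Function.Injective F.rev := fun s t h => by
  rw [← F.rev_rev s, h, F.rev_rev]

theorem Valid.rev {s : α × ℝ} (h : F.Valid s) : F.Valid (F.rev s) := by
  obtain ⟨h1, h2⟩ := h
  constructor
  · simp only [IntervalFlow.rev, F.lo_bar]; linarith
  · simp only [IntervalFlow.rev, F.hi_bar]; linarith

theorem Step.rev {s t : α × ℝ} (h : F.Step s t) : F.Step (F.rev t) (F.rev s) := by
  obtain ⟨h1, h2, h3, h4⟩ := h
  refine ⟨h2.rev, h1.rev, F.nxt_bar _ _ h3, ?_⟩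
  simp only [IntervalFlow.rev, F.tr_bar _ _ h3, h4]
  ring

theorem Step.eq_right {s t t' : α × ℝ} (h : F.Step s t) (h' : F.Step s t') : t = t' := by
  obtain ⟨h1, h2, h3, h4⟩ := h
  obtain ⟨-, h2', h3', h4'⟩ := h'
  have : t.1 = t'.1 := F.det _ _ _ s.2 h3 h3' h1 (h4 ▸ h2) (h4' ▸ h2')
  exact Prod.ext this (by rw [h4, h4', this])

theorem Step.eq_left {s s' t : α × ℝ} (h : F.Step s t) (h' : F.Step s' t) : s = s' :=
  F.rev_injective (h.rev.eq_right F h'.rev)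

/-- The first `b + 1` terms of `f` form an orbit. -/
def IsPath (f : ℕ → α × ℝ) (b : ℕ) : Prop := F.Valid (f 0) ∧ ∀ k < b, F.Step (f k) (f (k + 1))

variable {F}

theorem IsPath.valid {f : ℕ → α × ℝ} {b k : ℕ} (h : F.IsPath f b) (hk : k ≤ b) : F.Valid (f k) := by
  rcases k with _ | k
  · exact h.1
  · exact (h.2 k hk).2.1

theorem IsPath.eq_add {f g : ℕ → α × ℝ} {b b' k k' : ℕ} (hf : F.IsPath f b) (hg : F.IsPath g b')
    (h : f k = g k') (j : ℕ) (hj : k + j ≤ b) (hj' : k' + j ≤ b') : f (k + j) = g (k' + j) := by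
  induction j with
  | zero => exact h
  | succ j ih =>
    have := hf.2 (k + j) (by omega)
    rw [ih (by omega) (by omega)] at this
    exact this.eq_right F (hg.2 (k' + j) (by omega))

theorem IsPath.eq_sub {f g : ℕ → α × ℝ} {b b' k k' : ℕ} (hf : F.IsPath f b) (hg : F.IsPath g b')
    (h : f k = g k') (hk : k ≤ b) (hk' : k' ≤ b') (j : ℕ) (hj : j ≤ k) (hj' : j ≤ k') :
    f (k - j) = g (k' - j) := by
  induction j with
  | zero => exact h
  | succ j ih =>
    have h1 := hf.2 (k - (j + 1)) (by omega)
    have h2 := hg.2 (k' - (j + 1)) (by omega)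
    rw [show k - (j + 1) + 1 = k - j by omega, ih (by omega) (by omega)] at h1
    rw [show k' - (j + 1) + 1 = k' - j by omega] at h2
    exact h1.eq_left F h2

variable (F) in
/-- The same orbit in the opposite direction. -/
def revPath (f : ℕ → α × ℝ) (b : ℕ) : ℕ → α × ℝ := fun k => F.rev (f (b - k))

theorem IsPath.revPath {f : ℕ → α × ℝ} {b : ℕ} (h : F.IsPath f b) : F.IsPath (F.revPath f b) b := by
  refine ⟨(h.valid (Nat.sub_le _ _)).rev, fun k hk => ?_⟩
  have := (h.2 (b - (k + 1)) (by omega)).rev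
  rwa [show b - (k + 1) + 1 = b - k by omega] at this

/-- No orbit runs back along itself. -/
theorem IsPath.ne_rev {f : ℕ → α × ℝ} {b : ℕ} (hf : F.IsPath f b) {k k' : ℕ} (hk : k ≤ k') (hk' : k' ≤ b) :
    f k' ≠ F.rev (f k) := by
  intro h
  induction hd : k' - k using Nat.strong_induction_on generalizing k k' with
  | _ d ih =>
    -- Both indices move inwards by one step until they coincide, against `bar_ne`, or are adjacent,
    -- against `not_nxt_bar`.
    rcases Nat.lt_or_ge k k' with hlt | hge
    · have h1 := hf.2 (k' - 1) (by omega)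
      have h2 := (hf.2 k (by omega)).rev
      rw [show k' - 1 + 1 = k' by omega, h] at h1
      have h3 := h1.eq_left F h2
      rcases Nat.lt_or_ge (k + 1) k' with h4 | h4
      · exact ih (k' - 1 - (k + 1)) (by omega) (by omega) (by omega) h3 rfl
      · obtain rfl : k' = k + 1 := by omega
        have := (hf.2 k (by omega)).2.2.1
        rw [h] at this
        exact F.not_nxt_bar _ this
    · obtain rfl : k = k' := by omega
      exact F.bar_ne _ (congrArg Prod.fst h).symm

variable (F) in
/-- An orbit that ends with the letter with which it starts, the letters being distinct otherwise. -/
structure IsWin (f : ℕ → α × ℝ) (b : ℕ) : Prop where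
  pos : 0 < b
  isPath : F.IsPath f b
  fst_eq : (f 0).1 = (f b).1
  inj : ∀ i j, i < j → j ≤ b → (f i).1 = (f j).1 → i = 0 ∧ j = b

theorem IsWin.revPath {f : ℕ → α × ℝ} {b : ℕ} (h : F.IsWin f b) : F.IsWin (F.revPath f b) b where
  pos := h.pos
  isPath := h.isPath.revPath
  fst_eq := by simp [IntervalFlow.revPath, rev, h.fst_eq]
  inj := by
    intro i j hij hj he
    simp only [IntervalFlow.revPath, rev] at he
    have he' := congrArg F.bar he
    rw [F.bar_bar, F.bar_bar] at he'
    have := h.inj (b - j) (b - i) (by omega) (by omega) he'.symm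
    omega

/-- A window does not lie strictly inside another one. -/
theorem IsWin.not_nested {f g : ℕ → α × ℝ} {b b' k k' : ℕ} (hf : F.IsWin f b) (hg : F.IsWin g b')
    (h : f k = g k') (hk : k ≤ b) (hk' : k' ≤ b') : k ≤ k' ∨ b - k ≤ b' - k' := by
  by_contra! hc
  have h1 := hf.isPath.eq_sub hg.isPath h hk hk' k' (by omega) le_rfl
  have h2 := hf.isPath.eq_add hg.isPath h (b' - k') (by omega) (by omega)
  rw [Nat.sub_self] at h1
  rw [show k' + (b' - k') = b' by omega] at h2
  have := hg.pos
  -- The first and last letters of `g` are equal and would occur at inner positions of `f`.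
  have := hf.inj (k - k') (k + (b' - k')) (by omega) (by omega) (by rw [h1, h2, hg.fst_eq])
  omega

/-- Two windows `g`, `g'` that end at `z`, reach a set `H` only in `g`, and a window through `g'` that avoids
`H` and `z`, contradict each other. -/
theorem IsWin.false_of_blocked {H : Set (α × ℝ)} {z : α × ℝ} {g g' p : ℕ → α × ℝ} {b b' c u h u' h' e : ℕ}
    (hg : F.IsWin g b) (hg' : F.IsWin g' b') (hp : F.IsWin p c) (hu : g u = z) (hhu : h < u) (hub : u ≤ b)
    (hh : g h ∈ H) (hu' : g' u' = z) (hhu' : h' < u') (hub' : u' ≤ b') (hav : ∀ k ≤ b', g' k ∉ H)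
    (hpe : p e = g' h') (hec : e ≤ c) (hpH : ∀ k ≤ c, p k ∉ H) (hpz : ∀ k ≤ c, p k ≠ z) : False := by
  have huu : g u = g' u' := hu.trans hu'.symm
  -- Backwards from `z`, both `g` and `g'` follow the same orbit. Since `g'` avoids `H`, it begins
  -- after `g h`; hence its state `h'` lies on `g`. From there `p` can reach neither `g h` nor `z`,
  -- so `p` lies strictly inside `g`.
  have h1 : u' < u - h := by
    by_contra! hc
    have := hg.isPath.eq_sub hg'.isPath huu hub hub' (u - h) (by omega) hc
    rw [show u - (u - h) = h by omega] at this
    exact hav _ (by omega) (this ▸ hh)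
  have h2 := hg.isPath.eq_sub hg'.isPath huu hub hub' (u' - h') (by omega) (by omega)
  rw [show u' - (u' - h') = h' by omega, ← hpe] at h2
  have h3 : e < u - (u' - h') - h := by
    by_contra! hc
    have := hg.isPath.eq_sub hp.isPath h2 (by omega) hec (u - (u' - h') - h) (by omega) hc
    rw [show u - (u' - h') - (u - (u' - h') - h) = h by omega] at this
    exact hpH _ (by omega) (this ▸ hh)
  have h4 : c - e < u' - h' := by
    by_contra! hc
    have := hg.isPath.eq_add hp.isPath h2 (u' - h') (by omega) (by omega)
    rw [show u - (u' - h') + (u' - h') = u by omega, hu] at this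
    exact hpz _ (by omega) this.symm
  rcases hg.not_nested hp h2 (by omega) hec with h5 | h5 <;> omega

/-- Between two occurrences of a letter in an orbit without repeated states there is a gate. -/
theorem IsPath.exists_gate {f : ℕ → α × ℝ} {L : ℕ} (hf : F.IsPath f L)
    (hinj : ∀ i j, i < j → j ≤ L → f i ≠ f j) {i j : ℕ} (hij : i < j) (hj : j ≤ L)
    (h : (f i).1 = (f j).1) : ∃ m, i < m ∧ m ≤ j ∧ (f m).1 ∈ F.gate ∧
      ∀ k, m < k → k ≤ j → (f k).1 ∉ F.gate := by
  have hex : ∃ m, i < m ∧ m ≤ j ∧ (f m).1 ∈ F.gate := by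
    by_contra! hc
    -- Without gates the distance to the lower end is constant, so equal letters would mean equal
    -- states.
    have key : ∀ k, i + k ≤ j → (f (i + k)).2 - F.lo (f (i + k)).1 = (f i).2 - F.lo (f i).1 := by
      intro k
      induction k with
      | zero => intro _; rfl
      | succ k ih =>
        intro hk
        obtain ⟨-, -, h1, h2⟩ := hf.2 (i + k) (by omega)
        have h3 := F.lo_eq _ _ h1 (hc (i + k + 1) (by omega) hk)
        have := ih (by omega)
        rw [← add_assoc, h2, h3]
        linarith
    have := key (j - i) (by omega)
    rw [show i + (j - i) = j by omega, h] at this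
    exact hinj i j hij hj (Prod.ext h (by linarith))
  classical
  obtain ⟨m, hm, hmax⟩ := ((Finset.Icc (i + 1) j).filter fun m => (f m).1 ∈ F.gate).exists_max_image id (by
    obtain ⟨m, h1, h2, h3⟩ := hex
    exact ⟨m, by simp only [Finset.mem_filter, Finset.mem_Icc]; exact ⟨⟨h1, h2⟩, h3⟩⟩)
  simp only [Finset.mem_filter, Finset.mem_Icc, id] at hm hmax
  refine ⟨m, by omega, hm.1.2, hm.2, fun k hk hkj hg => ?_⟩
  have := hmax k ⟨⟨by omega, hkj⟩, hg⟩
  omega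

/-- Equal letters have equal predecessors, as long as there is no gate. -/
theorem IsPath.fst_sub_eq {f : ℕ → α × ℝ} {L : ℕ} (hf : F.IsPath f L) {i j : ℕ} (hi : i ≤ L) (hj : j ≤ L)
    (h : (f i).1 = (f j).1) (r : ℕ) (hri : r ≤ i) (hrj : r ≤ j)
    (hg : ∀ k, j - r < k → k ≤ j → (f k).1 ∉ F.gate) : (f (i - r)).1 = (f (j - r)).1 := by
  induction r with
  | zero => exact h
  | succ r ih =>
    have h1 := ih (by omega) (by omega) fun k hk hkj => hg k (by omega) hkj
    have h2 := (hf.2 (i - (r + 1)) (by omega)).2.2.1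
    have h3 := (hf.2 (j - (r + 1)) (by omega)).2.2.1
    rw [show i - (r + 1) + 1 = i - r by omega] at h2
    rw [show j - (r + 1) + 1 = j - r by omega] at h3
    exact F.prev_unique _ _ _ (h1 ▸ h2) h3 (hg (j - r) (by omega) (by omega))

/-- An orbit without repeated states in which a letter occurs three times contains a window that starts at
a gate. -/
theorem IsPath.exists_window {f : ℕ → α × ℝ} {L : ℕ} (hf : F.IsPath f L)
    (hinj : ∀ i j, i < j → j ≤ L → f i ≠ f j) {k₁ k₂ k₃ : ℕ} (h12 : k₁ < k₂) (h23 : k₂ < k₃) (h3 : k₃ ≤ L)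
    (e12 : (f k₁).1 = (f k₂).1) (e23 : (f k₂).1 = (f k₃).1) :
    ∃ a c, 0 < c ∧ a + c ≤ L ∧ (f a).1 ∈ F.gate ∧ F.IsWin (fun k => f (a + k)) c := by
  classical
  have hex : ∃ c, ∃ a, 0 < c ∧ a + c ≤ L ∧ (f a).1 ∈ F.gate ∧ (f a).1 = (f (a + c)).1 := by
    obtain ⟨m, hm1, hm2, hmg, hm⟩ := hf.exists_gate hinj h12 (by omega) e12
    -- The letter at the last gate `m` before `k₂` is found again equally far before `k₃`. This is
    -- where the third occurrence is needed.
    have := hf.fst_sub_eq h3 (by omega : k₂ ≤ L) e23.symm (k₂ - m) (by omega) (by omega)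
      fun k hk hk' => hm k (by omega) hk'
    rw [show k₂ - (k₂ - m) = m by omega] at this
    refine ⟨k₃ - k₂, m, by omega, by omega, hmg, ?_⟩
    rw [show m + (k₃ - k₂) = k₃ - (k₂ - m) by omega, this]
  -- The shortest return to a gate letter is chosen. A repetition inside it can be traced back to a
  -- gate: either the start `a` reappears as a gate after the last one, or a shorter return results.
  obtain ⟨a, hc, hL, hga, he⟩ := Nat.find_spec hex
  set c := Nat.find hex with hcdef
  refine ⟨a, c, hc, hL, hga, hc, ⟨hf.valid (by omega), fun k hk => hf.2 (a + k) (by omega)⟩, he, ?_⟩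
  intro i j hij hj hl
  by_contra hne
  have hlt : j - i < c := by omega
  obtain ⟨m, hm1, hm2, hmg, hm⟩ := hf.exists_gate hinj (show a + i < a + j by omega) (by omega) hl
  set r := a + j - m with hr
  rcases Nat.lt_or_ge i r with hir | hir
  · have := hf.fst_sub_eq (by omega) (by omega) hl i (by omega) (by omega)
      fun k hk hk' => hm k (by omega) hk'
    rw [show a + i - i = a by omega] at this
    exact hm (a + j - i) (by omega) (by omega) (this ▸ hga)
  · have := hf.fst_sub_eq (by omega) (by omega) hl r (by omega) (by omega)
      fun k hk hk' => hm k (by omega) hk'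
    rw [show a + j - r = m by omega] at this
    refine Nat.find_min hex hlt ⟨a + i - r, by omega, by omega, this ▸ hmg, ?_⟩
    rw [show a + i - r + (j - i) = m by omega, this]

end IntervalFlow

/-! ### Words, corners and one round of selection -/

namespace IntervalFlow

variable {α : Type*} (F : IntervalFlow α)

/-- The letters of a window whose first and last state are different. -/
structure Word where
  len : ℕ
  A : ℕ → α
  shift : ℕ → ℝ
  pos : 0 < len
  shift_zero : shift 0 = 0
  nxt : ∀ k < len, F.nxt (A k) (A (k + 1))
  shift_succ : ∀ k < len, shift (k + 1) = shift k + F.tr (A k) (A (k + 1))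
  gate : A 0 ∈ F.gate
  ends : A 0 = A len
  inj : ∀ i j, i < j → j ≤ len → A i = A j → i = 0 ∧ j = len
  shift_ne : shift len ≠ 0

variable {F} {ι : Type*} (W : ι → F.Word)

/-- The `k`-th state on the line `x`. -/
def state (i : ι) (x : ℝ) (k : ℕ) : α × ℝ := ((W i).A k, x + (W i).shift k)

/-- The lines along which all states are valid. -/
def dom (i : ι) : Set ℝ := {x | ∀ k ≤ (W i).len, F.Valid (state W i x k)}

/-- Two lines have a state in common, up to direction. -/
def Over (i : ι) (x : ℝ) (j : ι) (y : ℝ) : Prop :=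
  ∃ k ≤ (W i).len, ∃ k' ≤ (W j).len, state W j y k' = state W i x k ∨ state W j y k' = F.rev (state W i x k)

theorem isometricOverlap : IsometricOverlap (Over W) where
  refl i x := ⟨0, Nat.zero_le _, 0, Nat.zero_le _, Or.inl rfl⟩
  symm := by
    rintro i x j y ⟨k, hk, k', hk', h | h⟩
    · exact ⟨k', hk', k, hk, Or.inl h.symm⟩
    · exact ⟨k', hk', k, hk, Or.inr (by rw [h, F.rev_rev])⟩
  graphs i j := by
    classical
    refine ⟨{e | ∃ k ≤ (W i).len, ∃ k' ≤ (W j).len,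
      ((W j).A k' = (W i).A k ∧ e = (1, (W i).shift k - (W j).shift k')) ∨
      ((W j).A k' = F.bar ((W i).A k) ∧ e = (-1, -(W i).shift k - (W j).shift k'))}, ?_, ?_, ?_⟩
    · refine Set.Finite.subset (s := (⋃ k ∈ Iic (W i).len, ⋃ k' ∈ Iic (W j).len,
        {((1 : ℝ), (W i).shift k - (W j).shift k'), (-1, -(W i).shift k - (W j).shift k')})) ?_ ?_
      · exact (finite_Iic _).biUnion fun k _ => (finite_Iic _).biUnion fun k' _ => by simp
      · rintro e ⟨k, hk, k', hk', ⟨-, h⟩ | ⟨-, h⟩⟩ <;> simp only [mem_iUnion] <;>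
          exact ⟨k, hk, k', hk', by simp [h]⟩
    · rintro e ⟨k, hk, k', hk', ⟨-, h⟩ | ⟨-, h⟩⟩ <;> simp [h]
    · intro x y
      constructor
      · rintro ⟨k, hk, k', hk', h | h⟩
        · refine ⟨_, ⟨k, hk, k', hk', Or.inl ⟨congrArg Prod.fst h, rfl⟩⟩, ?_⟩
          have := congrArg Prod.snd h
          simp only [state] at this ⊢
          linarith
        · refine ⟨_, ⟨k, hk, k', hk', Or.inr ⟨congrArg Prod.fst h, rfl⟩⟩, ?_⟩
          have := congrArg Prod.snd h
          simp only [state, rev] at this ⊢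
          linarith
      · rintro ⟨e, ⟨k, hk, k', hk', ⟨h1, rfl⟩ | ⟨h1, rfl⟩⟩, rfl⟩
        · exact ⟨k, hk, k', hk', Or.inl (Prod.ext h1 (by simp only [state]; ring))⟩
        · exact ⟨k, hk, k', hk', Or.inr (Prod.ext h1 (by simp only [state, rev]; ring))⟩

variable {W}

theorem isPath_state {i : ι} {x : ℝ} (hx : x ∈ dom W i) : F.IsPath (state W i x) (W i).len := by
  refine ⟨hx 0 (Nat.zero_le _), fun k hk => ⟨hx k hk.le, hx (k + 1) hk, (W i).nxt k hk, ?_⟩⟩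
  simp only [state, (W i).shift_succ k hk]
  ring

theorem isWin_state {i : ι} {x : ℝ} (hx : x ∈ dom W i) : F.IsWin (state W i x) (W i).len :=
  ⟨(W i).pos, isPath_state hx, (W i).ends, (W i).inj⟩

theorem isOpen_dom (i : ι) : IsOpen (dom W i) := by
  have : dom W i = ⋂ k ∈ Iic (W i).len, (fun x => x + (W i).shift k) ⁻¹'
      Ioo (F.lo ((W i).A k)) (F.hi ((W i).A k)) := by
    ext x
    simp only [dom, mem_ofPred_eq, mem_iInter]
    rfl
  rw [this]
  exact (finite_Iic _).isOpen_biInter fun k _ => isOpen_Ioo.preimage (by fun_prop)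

/-- Validity is strict inside the strip; at its edges only the weak inequalities survive, since an
edge may run through an end of a side. -/
theorem bounds_of_subset_dom {i : ι} {p q : ℝ} (hpq : p < q) (h : Ioo p q ⊆ dom W i) {k : ℕ}
    (hk : k ≤ (W i).len) :
    F.lo ((W i).A k) ≤ p + (W i).shift k ∧ q + (W i).shift k ≤ F.hi ((W i).A k) := by
  have h' : Ioo p q ⊆ Icc (F.lo ((W i).A k) - (W i).shift k) (F.hi ((W i).A k) - (W i).shift k) := by
    intro x hx
    obtain ⟨h1, h2⟩ := h hx k hk
    simp only [state] at h1 h2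
    constructor <;> linarith
  have := closure_minimal h' isClosed_Icc
  rw [closure_Ioo hpq.ne] at this
  have h1 := (this (left_mem_Icc.2 hpq.le)).1
  have h2 := (this (right_mem_Icc.2 hpq.le)).2
  constructor <;> linarith

variable (W) in
/-- The lines free of the strips in `X`. -/
def free (X : List (Strip ι)) (i : ι) : Set ℝ := dom W i ∩ {x | Hit (Over W) X i x}ᶜ

theorem isOpen_free (X : List (Strip ι)) (i : ι) : IsOpen (free W X i) :=
  (isOpen_dom i).inter ((isometricOverlap W).isClosed_hit X i).isOpen_compl

variable (W) in
open Classical in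
/-- The possible positions of the left edge of a widest free strip. -/
noncomputable def corners (X : List (Strip ι)) : List (α × ℝ) :=
  F.gate.toList.map (fun a => (a, F.lo a)) ++
  X.flatMap fun s =>
    [state W s.idx s.p 0, state W s.idx s.q 0,
      state W s.idx s.p (W s.idx).len, state W s.idx s.q (W s.idx).len,
      F.rev (state W s.idx s.p 0), F.rev (state W s.idx s.q 0),
      F.rev (state W s.idx s.p (W s.idx).len), F.rev (state W s.idx s.q (W s.idx).len)]

theorem length_corners (X : List (Strip ι)) : (corners W X).length = F.gate.card + 8 * X.length := by
  simp [corners, List.length_flatMap, mul_comm]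

/-- The overlap of a line with the edge of a strip extends to an end of the strip. -/
theorem exists_corner_of_edge {X : List (Strip ι)} {s : Strip ι} (hs : s ∈ X) {i : ι} {l y : ℝ}
    (hy : y = s.p ∨ y = s.q) {x' y' : ℝ} (hx' : x' ∈ dom W i) (hy' : y' ∈ dom W s.idx) {k k' : ℕ}
    (hk : k ≤ (W i).len) (hk' : k' ≤ (W s.idx).len)
    (h : (state W s.idx y k' = state W i l k ∧ y' - y = x' - l) ∨
      (state W s.idx y k' = F.rev (state W i l k) ∧ y' - y = -(x' - l))) :
    ∃ m ≤ (W i).len, state W i l m ∈ corners W X := by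
  have hmem : ∀ c ∈ [state W s.idx s.p 0, state W s.idx s.q 0,
      state W s.idx s.p (W s.idx).len, state W s.idx s.q (W s.idx).len,
      F.rev (state W s.idx s.p 0), F.rev (state W s.idx s.q 0),
      F.rev (state W s.idx s.p (W s.idx).len), F.rev (state W s.idx s.q (W s.idx).len)],
      c ∈ corners W X := fun c hc => List.mem_append_right _ (List.mem_flatMap.2 ⟨s, hs, hc⟩)
  have hends : ∀ r, r = 0 ∨ r = (W s.idx).len → state W s.idx y r ∈ corners W X ∧
      F.rev (state W s.idx y r) ∈ corners W X := by
    rintro r (rfl | rfl) <;> rcases hy with rfl | rfl <;> constructor <;> apply hmem <;> simp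
  -- The edge itself need not be an orbit, so the comparison takes place on the valid lines `x'` and
  -- `y'` at the same displacement, and is then translated back.
  have hf := isWin_state hy'
  rcases h with ⟨h1, h2⟩ | ⟨h1, h2⟩
  · have hg := isWin_state hx'
    have h3 : state W s.idx y' k' = state W i x' k := by
      have e1 := congrArg Prod.fst h1
      have e2 := congrArg Prod.snd h1
      refine Prod.ext e1 ?_
      simp only [state] at e2 ⊢
      linarith
    have key : ∀ r m, state W s.idx y' r = state W i x' m → state W i l m = state W s.idx y r := by
      intro r m hrm
      have e1 := congrArg Prod.fst hrm
      have e2 := congrArg Prod.snd hrm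
      refine Prod.ext e1.symm ?_
      simp only [state] at e2 ⊢
      linarith
    -- The window of the strip is not strictly inside that of `i`, so its first or its last state is
    -- reached along `i`.
    rcases hf.not_nested hg h3 hk' hk with h4 | h4
    · have := hf.isPath.eq_sub hg.isPath h3 hk' hk k' le_rfl h4
      exact ⟨k - k', by omega, key _ _ this ▸ (hends _ (Or.inl (by omega))).1⟩
    · have := hf.isPath.eq_add hg.isPath h3 ((W s.idx).len - k') (by omega) (by omega)
      exact ⟨k + ((W s.idx).len - k'), by omega, key _ _ this ▸ (hends _ (Or.inr (by omega))).1⟩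
  · have hg := (isWin_state hx').revPath
    have h3 : state W s.idx y' k' = F.revPath (state W i x') (W i).len ((W i).len - k) := by
      have e1 := congrArg Prod.fst h1
      have e2 := congrArg Prod.snd h1
      simp only [revPath]
      rw [show (W i).len - ((W i).len - k) = k by omega]
      refine Prod.ext e1 ?_
      simp only [state, rev] at e2 ⊢
      linarith
    have key : ∀ r m, state W s.idx y' r = F.revPath (state W i x') (W i).len m →
        state W i l ((W i).len - m) = F.rev (state W s.idx y r) := by
      intro r m hrm
      have e1 := congrArg Prod.fst hrm
      have e2 := congrArg Prod.snd hrm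
      simp only [revPath, rev, state] at e1 e2
      refine Prod.ext ?_ ?_
      · simp only [state, rev, e1, F.bar_bar]
      · simp only [state, rev]
        linarith
    rcases hf.not_nested hg h3 hk' (by omega) with h4 | h4
    · have := hf.isPath.eq_sub hg.isPath h3 hk' (by omega) k' le_rfl h4
      exact ⟨_, Nat.sub_le _ _, key _ _ this ▸ (hends _ (Or.inl (by omega))).2⟩
    · have := hf.isPath.eq_add hg.isPath h3 ((W s.idx).len - k') (by omega) (by omega)
      exact ⟨_, Nat.sub_le _ _, key _ _ this ▸ (hends _ (Or.inr (by omega))).2⟩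

/-- Every free line belongs to an interval of free lines that starts at a corner. -/
theorem exists_corner {X : List (Strip ι)} (hX : ∀ s ∈ X, Ioo s.p s.q ⊆ dom W s.idx) {i : ι} {x : ℝ}
    (hx : x ∈ free W X i) :
    ∃ l < x, Ioc l x ⊆ free W X i ∧ ∃ k ≤ (W i).len, state W i l k ∈ corners W X := by
  set B : Set ℝ := (free W X i)ᶜ ∩ Iic x with hB
  have hBc : IsClosed B := (isOpen_free X i).isClosed_compl.inter isClosed_Iic
  have hBne : B.Nonempty := by
    have hx0 := hx.1 0 (Nat.zero_le _)
    refine ⟨F.lo ((W i).A 0) - (W i).shift 0, fun hc => ?_, ?_⟩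
    · have := (hc.1 0 (Nat.zero_le _)).1
      simp [state] at this
    · have := hx0.1
      simp only [state] at this
      simp only [mem_Iic]
      linarith
  have hBb : BddAbove B := ⟨x, fun y hy => hy.2⟩
  set l := sSup B with hl
  have hlB : l ∈ B := hBc.csSup_mem hBne hBb
  have hlx : l < x := lt_of_le_of_ne hlB.2 fun h => hlB.1 (h ▸ hx)
  have hfree : Ioc l x ⊆ free W X i := by
    intro y hy
    by_contra hc
    exact absurd (le_csSup hBb ⟨hc, hy.2⟩) (not_le.2 hy.1)
  refine ⟨l, hlx, hfree, ?_⟩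
  -- The last line `l` before `x` that is not free is either valid and touched by a strip along an
  -- edge, or stopped by the lower end of a letter.
  by_cases hld : l ∈ dom W i
  · have hhit : Hit (Over W) X i l := by
      by_contra hc
      exact hlB.1 ⟨hld, hc⟩
    obtain ⟨s, hs, y, hy, k, hk, k', hk', h⟩ := hhit
    obtain ⟨ε, hε, hball⟩ := Metric.isOpen_iff.1 (isOpen_dom i) l hld
    have hspq := s.lt
    rcases h with h | h
    -- The overlap moves in parallel with the line, and the lines just above `l` are free; so `y` is
    -- the upper edge.
    · have hno : ∀ u, 0 < u → u ≤ x - l → y + u ∉ Icc s.p s.q := by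
        intro u hu hux hc
        refine (hfree (show l + u ∈ Ioc l x by constructor <;> linarith)).2 ⟨s, hs, y + u, hc, k, hk, k', hk', ?_⟩
        refine Or.inl (Prod.ext (show _ from (congrArg Prod.fst h :)) ?_)
        have := congrArg Prod.snd h
        simp only [state] at this ⊢
        linarith
      have hyq : y = s.q := by
        by_contra hne
        have hlt := lt_of_le_of_ne hy.2 hne
        refine hno (min (x - l) (s.q - y)) (by simp [hlx, hlt]) (min_le_left _ _) ⟨?_, ?_⟩
        · have : 0 < min (x - l) (s.q - y) := by simp [hlx, hlt]
          linarith [hy.1]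
        · linarith [min_le_right (x - l) (s.q - y)]
      set u := min ε (s.q - s.p) / 2 with hu
      have hu0 : 0 < u := by
        have : 0 < min ε (s.q - s.p) := by simp [hε, hspq]
        linarith
      have hu1 : u < ε := by linarith [min_le_left ε (s.q - s.p)]
      have hu2 : u < s.q - s.p := by linarith [min_le_right ε (s.q - s.p)]
      exact exists_corner_of_edge hs (Or.inr hyq) (x' := l - u) (y' := y - u)
        (hball (by simp [abs_of_pos hu0, hu1])) (hX s hs ⟨by linarith, by linarith⟩) hk hk'
        (Or.inl ⟨h, by ring⟩)
    -- In the reversed direction the parameter decreases, and `y` is the lower edge.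
    · have hno : ∀ u, 0 < u → u ≤ x - l → y - u ∉ Icc s.p s.q := by
        intro u hu hux hc
        refine (hfree (show l + u ∈ Ioc l x by constructor <;> linarith)).2 ⟨s, hs, y - u, hc, k, hk, k', hk', ?_⟩
        refine Or.inr (Prod.ext (show _ from (congrArg Prod.fst h :)) ?_)
        have := congrArg Prod.snd h
        simp only [state, rev] at this ⊢
        linarith
      have hyq : y = s.p := by
        by_contra hne
        have hlt := lt_of_le_of_ne hy.1 (Ne.symm hne)
        refine hno (min (x - l) (y - s.p)) (by simp [hlx, hlt]) (min_le_left _ _) ⟨?_, ?_⟩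
        · linarith [min_le_right (x - l) (y - s.p)]
        · have : 0 < min (x - l) (y - s.p) := by simp [hlx, hlt]
          linarith [hy.2]
      set u := min ε (s.q - s.p) / 2 with hu
      have hu0 : 0 < u := by
        have : 0 < min ε (s.q - s.p) := by simp [hε, hspq]
        linarith
      have hu1 : u < ε := by linarith [min_le_left ε (s.q - s.p)]
      have hu2 : u < s.q - s.p := by linarith [min_le_right ε (s.q - s.p)]
      exact exists_corner_of_edge hs (Or.inl hyq) (x' := l - u) (y' := y + u)
        (hball (by simp [abs_of_pos hu0, hu1])) (hX s hs ⟨by linarith, by linarith⟩) hk hk'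
        (Or.inr ⟨h, by ring⟩)
  · have hsub : Ioo l x ⊆ dom W i := fun y hy => (hfree ⟨hy.1, hy.2.le⟩).1
    have : ∃ k ≤ (W i).len, (state W i l k).2 = F.lo ((W i).A k) := by
      simp only [dom, mem_ofPred_eq] at hld
      push Not at hld
      obtain ⟨k, hk, hv⟩ := hld
      refine ⟨k, hk, ?_⟩
      have h1 := bounds_of_subset_dom hlx hsub hk
      by_contra hne
      refine hv ⟨lt_of_le_of_ne h1.1 (Ne.symm hne), ?_⟩
      simp only [state]
      linarith [h1.2]
    obtain ⟨k, hk, hlo⟩ := this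
    -- Contact with the lower end is inherited by the preceding letter unless the present one is a
    -- gate. The word starts at a gate, so one is found.
    have key : ∀ k ≤ (W i).len, (state W i l k).2 = F.lo ((W i).A k) →
        ∃ m ≤ (W i).len, (W i).A m ∈ F.gate ∧ (state W i l m).2 = F.lo ((W i).A m) := by
      intro k
      induction k with
      | zero => exact fun hk h => ⟨0, hk, (W i).gate, h⟩
      | succ k ih =>
        intro hk h
        by_cases hg : (W i).A (k + 1) ∈ F.gate
        · exact ⟨k + 1, hk, hg, h⟩
        · refine ih (by omega) ?_
          rw [F.lo_eq _ _ ((W i).nxt k hk) hg] at h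
          simp only [state, (W i).shift_succ k hk] at h ⊢
          linarith
    obtain ⟨m, hm, hmg, hmlo⟩ := key k hk hlo
    refine ⟨m, hm, List.mem_append_left _ (List.mem_map.2 ⟨(W i).A m, by simpa using hmg, ?_⟩)⟩
    exact Prod.ext rfl hmlo.symm

/-- Among the free strips whose left edge starts at a given state there is a widest one. -/
theorem exists_widest [Finite ι] (X : List (Strip ι)) (c : α × ℝ)
    (hne : ∃ j d k, 0 < d ∧ k ≤ (W j).len ∧ (W j).A k = c.1 ∧
      Ioo (c.2 - (W j).shift k) (c.2 - (W j).shift k + d) ⊆ free W X j) :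
    ∃ j d k, (0 < d ∧ k ≤ (W j).len ∧ (W j).A k = c.1 ∧
      Ioo (c.2 - (W j).shift k) (c.2 - (W j).shift k + d) ⊆ free W X j) ∧
      ∀ j' d' k', 0 < d' → k' ≤ (W j').len → (W j').A k' = c.1 →
        Ioo (c.2 - (W j').shift k') (c.2 - (W j').shift k' + d') ⊆ free W X j' → d' ≤ d := by
  set D : ι → ℕ → Set ℝ := fun j k => {d | 0 < d ∧ k ≤ (W j).len ∧ (W j).A k = c.1 ∧
    Ioo (c.2 - (W j).shift k) (c.2 - (W j).shift k + d) ⊆ free W X j} with hD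
  have hbdd : ∀ j k, ∀ d ∈ D j k, d ≤ F.hi c.1 - F.lo c.1 := by
    rintro j k d ⟨h1, h2, h3, h4⟩
    have := bounds_of_subset_dom (by linarith) (h4.trans fun x hx => hx.1) h2
    rw [h3] at this
    linarith [this.1, this.2]
  -- The supremum of the widths is attained, because an open interval is the union of the shorter
  -- ones with the same left end.
  have hmax : ∀ j k, (D j k).Nonempty → sSup (D j k) ∈ D j k := by
    intro j k hne
    obtain ⟨d, hd⟩ := hne
    have hb : BddAbove (D j k) := ⟨_, hbdd j k⟩
    refine ⟨hd.1.trans_le (le_csSup hb hd), hd.2.1, hd.2.2.1, fun x hx => ?_⟩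
    obtain ⟨e, he, hxe⟩ := exists_lt_of_lt_csSup ⟨d, hd⟩
      (show x - (c.2 - (W j).shift k) < sSup (D j k) by linarith [hx.2])
    exact he.2.2.2 ⟨hx.1, by linarith⟩
  set P : Set (ι × ℕ) := {jk | (D jk.1 jk.2).Nonempty} with hP
  have hPfin : P.Finite := by
    refine Set.Finite.subset (s := ⋃ j : ι, (fun k => (j, k)) '' Iic (W j).len) ?_ ?_
    · exact finite_iUnion fun j => (finite_Iic _).image _
    · rintro ⟨j, k⟩ ⟨d, hd⟩
      exact mem_iUnion.2 ⟨j, k, hd.2.1, rfl⟩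
  obtain ⟨j, d, k, hd⟩ := hne
  obtain ⟨⟨j', k'⟩, hjk, hm⟩ := Set.exists_max_image P (fun jk => sSup (D jk.1 jk.2)) hPfin
    ⟨(j, k), d, hd⟩
  refine ⟨j', sSup (D j' k'), k', hmax j' k' hjk, fun j'' d'' k'' h1 h2 h3 h4 => ?_⟩
  exact (le_csSup ⟨_, hbdd j'' k''⟩ ⟨h1, h2, h3, h4⟩).trans (hm (j'', k'') ⟨d'', h1, h2, h3, h4⟩)

/-- One round of selection of strips. -/
theorem exists_round [Finite ι] (X : List (Strip ι)) (hX : ∀ s ∈ X, Ioo s.p s.q ⊆ dom W s.idx) :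
    ∃ Y : List (Strip ι), Y.length ≤ F.gate.card + 8 * X.length ∧
      (∀ s ∈ Y, Ioo s.p s.q ⊆ free W X s.idx) ∧ Y.Pairwise (DisjointStrips (Over W)) ∧
      ∀ i, ∀ x ∈ free W X i, ∃ j δ ε, 0 < ε ∧ ∀ u, |u| < ε → x + δ + u ∈ free W X j ∧
        Hit (Over W) Y j (x + δ + u) ∧ Over W i (x + u) j (x + δ + u) := by
  classical
  have hch : ∀ c : α × ℝ, ∃ o : Option (Strip ι), (∀ s ∈ o, Ioo s.p s.q ⊆ free W X s.idx) ∧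
      ∀ j d k, 0 < d → k ≤ (W j).len → (W j).A k = c.1 →
        Ioo (c.2 - (W j).shift k) (c.2 - (W j).shift k + d) ⊆ free W X j →
        ∃ s ∈ o, ∃ k' ≤ (W s.idx).len, (W s.idx).A k' = c.1 ∧ s.p = c.2 - (W s.idx).shift k' ∧
          s.p + d ≤ s.q := by
    intro c
    by_cases hne : ∃ j d k, 0 < d ∧ k ≤ (W j).len ∧ (W j).A k = c.1 ∧
      Ioo (c.2 - (W j).shift k) (c.2 - (W j).shift k + d) ⊆ free W X j
    · obtain ⟨j, d, k, ⟨h1, h2, h3, h4⟩, hm⟩ := exists_widest X c hne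
      refine ⟨some ⟨j, c.2 - (W j).shift k, c.2 - (W j).shift k + d, by linarith⟩, ?_, ?_⟩
      · rintro s hs
        obtain rfl := Option.mem_some_iff.1 hs
        exact h4
      · intro j' d' k' h1' h2' h3' h4'
        refine ⟨_, Option.mem_some_iff.2 rfl, k, h2, h3, rfl, ?_⟩
        have := hm j' d' k' h1' h2' h3' h4'
        simp only
        linarith
    · refine ⟨none, by simp, fun j d k h1 h2 h3 h4 => (hne ⟨j, d, k, h1, h2, h3, h4⟩).elim⟩
  choose o ho1 ho2 using hch
  obtain ⟨Y, hYl, hYs, hYd, hYh⟩ := (isometricOverlap W).exists_disjoint_strips _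
    ((corners W X).filterMap o) le_rfl
  refine ⟨Y, hYl.trans ((List.length_filterMap_le _ _).trans (length_corners X).le), ?_, hYd, ?_⟩
  · intro s hs x hx
    obtain ⟨f, hf, h1, h2, h3⟩ := hYs s hs
    obtain ⟨c, -, hc⟩ := List.mem_filterMap.1 hf
    rw [h1]
    exact ho1 c f hc ⟨h2.trans_lt hx.1, hx.2.trans_le h3⟩
  · intro i x hx
    obtain ⟨l, hlx, hfree, k, hk, hcor⟩ := exists_corner hX hx
    obtain ⟨η, hη, hball⟩ := Metric.isOpen_iff.1 (isOpen_free X i) x hx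
    have hsub : Ioo ((state W i l k).2 - (W i).shift k)
        ((state W i l k).2 - (W i).shift k + (x - l + η)) ⊆ free W X i := by
      intro z hz
      have hz1 : l < z := by have := hz.1; simp only [state] at this; linarith
      have hz2 : z < x + η := by have := hz.2; simp only [state] at this; linarith
      rcases le_or_gt z x with hzx | hzx
      · exact hfree ⟨hz1, hzx⟩
      · exact hball (by rw [Metric.mem_ball, Real.dist_eq, abs_of_pos] <;> linarith)
    obtain ⟨s, hs, k', hk', hA, hp, hq⟩ := ho2 (state W i l k) i (x - l + η) k (by linarith) hk rfl hsub
    -- `δ` moves the left edge `l` to the left edge of the selected strip. Both pass through the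
    -- same corner, so lines at equal distance from these edges share a state. The selected strip
    -- has width at least `x - l + η`, whence the choice of `ε`.
    refine ⟨s.idx, s.p - l, min (x - l) η, by simp [hlx, hη], fun u hu => ?_⟩
    obtain ⟨hu1, hu2⟩ := abs_lt.1 hu
    have hu3 := min_le_left (x - l) η
    have hu4 := min_le_right (x - l) η
    have hmem : x + (s.p - l) + u ∈ Ioo s.p s.q := by constructor <;> linarith
    refine ⟨ho1 _ s hs hmem, hYh s (List.mem_filterMap.2 ⟨_, hcor, hs⟩) _ hmem, k, hk, k', hk', Or.inl ?_⟩
    refine Prod.ext hA ?_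
    simp only [state] at hp ⊢
    linarith

end IntervalFlow

/-! ### Three rounds hit all windows -/

namespace IntervalFlow

variable {α : Type*} {F : IntervalFlow α} {ι : Type*} (W : ι → F.Word)

/-- The states in the closed strips in `X`, in both directions. -/
def occ (X : List (Strip ι)) : Set (α × ℝ) :=
  {t | ∃ s ∈ X, ∃ y ∈ Icc s.p s.q, ∃ k ≤ (W s.idx).len,
    state W s.idx y k = t ∨ state W s.idx y k = F.rev t}

variable {W}

theorem occ_mono {X Y : List (Strip ι)} (h : ∀ s ∈ X, s ∈ Y) : occ W X ⊆ occ W Y := by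
  rintro t ⟨s, hs, ht⟩
  exact ⟨s, h s hs, ht⟩

theorem rev_mem_occ {X : List (Strip ι)} {t : α × ℝ} : F.rev t ∈ occ W X ↔ t ∈ occ W X := by
  constructor <;> rintro ⟨s, hs, y, hy, k, hk, h⟩ <;> refine ⟨s, hs, y, hy, k, hk, ?_⟩ <;>
    simpa [or_comm] using h

theorem hit_iff {X : List (Strip ι)} {i : ι} {x : ℝ} :
    Hit (Over W) X i x ↔ ∃ k ≤ (W i).len, state W i x k ∈ occ W X := by
  constructor
  · rintro ⟨s, hs, y, hy, k, hk, k', hk', h⟩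
    exact ⟨k, hk, s, hs, y, hy, k', hk', h⟩
  · rintro ⟨k, hk, s, hs, y, hy, k', hk', h⟩
    exact ⟨s, hs, y, hy, k, hk, k', hk', h⟩

variable (W) in
/-- A window free of `X` leads back from `z` to a state on a window that is free of `X` and is contained in
a strip in `Y`. -/
def Blocked (X Y : List (Strip ι)) (z : α × ℝ) : Prop :=
  ∃ g b u h p c e, F.IsWin g b ∧ g u = z ∧ h < u ∧ u ≤ b ∧ (∀ k ≤ b, g k ∉ occ W X) ∧
    F.IsWin p c ∧ p e = g h ∧ e ≤ c ∧ (∀ k ≤ c, p k ∉ occ W X) ∧ ∀ k ≤ c, p k ∈ occ W Y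

/-- The window of the later round avoids the strips `Y`, which the window of the earlier round
reaches before `z`. This is the configuration excluded by `IsWin.false_of_blocked`. -/
theorem Blocked.false {X Y X' Y' : List (Strip ι)} {z : α × ℝ} (h : Blocked W X Y z)
    (h' : Blocked W X' Y' z) (hY : ∀ s ∈ Y, s ∈ X') (hz : z ∉ occ W Y') : False := by
  obtain ⟨g, b, u, m, p, c, e, hg, hu, hm, hub, -, -, hpe, hec, -, hpY⟩ := h
  obtain ⟨g', b', u', m', p', c', e', hg', hu', hm', hub', hav, hp', hpe', hec', hpX', hpY'⟩ := h'
  exact IsWin.false_of_blocked (H := occ W Y) hg hg' hp' hu hm hub (hpe ▸ hpY e hec) hu' hm' hub'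
    (fun k hk hc => hav k hk (occ_mono hY hc)) hpe' hec' (fun k hk hc => hpX' k hk (occ_mono hY hc))
    fun k hk hc => hz (hc ▸ hpY' k hk)

theorem revPath_sub {f : ℕ → α × ℝ} {b k : ℕ} (hk : k ≤ b) : F.revPath f b (b - k) = F.rev (f k) := by
  rw [revPath, show b - (b - k) = k by omega]

theorem revPath_notMem_occ {X : List (Strip ι)} {f : ℕ → α × ℝ} {b : ℕ} (h : ∀ k ≤ b, f k ∉ occ W X) :
    ∀ k ≤ b, F.revPath f b k ∉ occ W X := fun _ _ hc => h _ (Nat.sub_le _ _) (rev_mem_occ.1 hc)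

/-- A window that meets a free window and is hit by a strip at `t` leads back from one of the ends of the
free window to `t`. -/
theorem exists_end {X Y : List (Strip ι)} {f g : ℕ → α × ℝ} {L b m m' h : ℕ} {t : α × ℝ}
    (hf : F.IsWin f L) (hg : F.IsWin g b) (hm : m ≤ L) (hm' : m' ≤ b)
    (hfg : g m' = f m ∨ g m' = F.rev (f m)) (hfY : ∀ k ≤ L, f k ∉ occ W Y) (hh : h ≤ b)
    (ht : t = g h ∨ t = F.rev (g h)) (htY : t ∈ occ W Y) (hgX : ∀ k ≤ b, g k ∉ occ W X) :
    ∃ z ∈ ({f 0, F.rev (f L)} : Set (α × ℝ)), ∃ g b u h, F.IsWin g b ∧ g u = z ∧ h < u ∧ u ≤ b ∧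
      (t = g h ∨ t = F.rev (g h)) ∧ ∀ k ≤ b, g k ∉ occ W X := by
  -- If necessary `g` is reversed, so that it runs in the direction of `f`.
  obtain ⟨g, b, m', h, hg, hm', hfg, hh, ht, hgX⟩ : ∃ g b m' h, F.IsWin g b ∧ m' ≤ b ∧ g m' = f m ∧ h ≤ b ∧
      (t = g h ∨ t = F.rev (g h)) ∧ ∀ k ≤ b, g k ∉ occ W X := by
    rcases hfg with hfg | hfg
    · exact ⟨g, b, m', h, hg, hm', hfg, hh, ht, hgX⟩
    · refine ⟨F.revPath g b, b, b - m', b - h, hg.revPath, Nat.sub_le _ _, ?_, Nat.sub_le _ _, ?_,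
        revPath_notMem_occ hgX⟩
      · rw [revPath_sub hm', hfg, F.rev_rev]
      · rw [revPath_sub hh, F.rev_rev]
        exact ht.symm
  have hgY : g h ∈ occ W Y := by
    rcases ht with rfl | rfl
    · exact htY
    · exact rev_mem_occ.1 htY
  rcases le_or_gt m' h with hmh | hmh
  -- As `f` avoids the strips, `g` runs through the end `f L` before it reaches `g h`. In reverse,
  -- it arrives at `F.rev (f L)` afterwards.
  · have h1 : L - m < h - m' := by
      by_contra! hc
      have := hf.isPath.eq_add hg.isPath hfg.symm (h - m') (by omega) (by omega)
      rw [show m' + (h - m') = h by omega] at this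
      exact hfY _ (by omega) (this ▸ hgY)
    have h2 := hf.isPath.eq_add hg.isPath hfg.symm (L - m) (by omega) (by omega)
    rw [show m + (L - m) = L by omega] at h2
    refine ⟨F.rev (f L), by simp, F.revPath g b, b, b - (m' + (L - m)), b - h, hg.revPath, ?_, by omega,
      Nat.sub_le _ _, ?_, revPath_notMem_occ hgX⟩
    · rw [revPath_sub (by omega), h2]
    · rw [revPath_sub hh, F.rev_rev]
      exact ht.symm
  · have h1 : m < m' - h := by
      by_contra! hc
      have := hf.isPath.eq_sub hg.isPath hfg.symm hm hm' (m' - h) (by omega) (by omega)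
      rw [show m' - (m' - h) = h by omega] at this
      exact hfY _ (by omega) (this ▸ hgY)
    have h2 := hf.isPath.eq_sub hg.isPath hfg.symm hm hm' m le_rfl (by omega)
    rw [Nat.sub_self] at h2
    exact ⟨f 0, by simp, g, b, m' - m, h, hg, h2.symm, by omega, by omega, ht, hgX⟩

/-- These are the exceptional lines to be avoided: along an edge of a strip the states need not be
valid or free. -/
theorem finite_edges (Y : List (Strip ι)) (j : ι) :
    {w | ∃ s ∈ Y, ∃ y, (y = s.p ∨ y = s.q) ∧ Over W j w s.idx y}.Finite := by
  have : {w | ∃ s ∈ Y, ∃ y, (y = s.p ∨ y = s.q) ∧ Over W j w s.idx y} =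
      ⋃ s ∈ {s | s ∈ Y}, ⋃ y ∈ ({s.p, s.q} : Set ℝ), {w | Over W s.idx y j w} := by
    ext w
    simp only [mem_ofPred_eq, mem_iUnion, mem_insert_iff, mem_singleton_iff, exists_prop]
    constructor
    · rintro ⟨s, hs, y, hy, h⟩
      exact ⟨s, hs, y, hy, (isometricOverlap W).symm _ _ _ _ h⟩
    · rintro ⟨s, hs, y, hy, h⟩
      exact ⟨s, hs, y, hy, (isometricOverlap W).symm _ _ _ _ h⟩
  rw [this]
  refine (List.finite_toSet Y).biUnion fun s _ => (by simp : ({s.p, s.q} : Set ℝ).Finite).biUnion fun y _ => ?_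
  obtain ⟨E, hE, -, hEO⟩ := (isometricOverlap W).graphs s.idx j
  refine (hE.image fun e => e.1 * y + e.2).subset ?_
  rintro w hw
  obtain ⟨e, he, rfl⟩ := (hEO _ _).1 hw
  exact ⟨e, he, rfl⟩

/-- The line and its near parallels share states with lines that the round has hit. By `exists_end`,
a line not hit itself is continued beyond an end. Outside the finite set the hit takes place inside
an open strip, on a genuine free window. -/
theorem exists_blocked {X Y : List (Strip ι)} (hY : ∀ s ∈ Y, Ioo s.p s.q ⊆ free W X s.idx)
    {i : ι} {x : ℝ} (hround : ∃ j δ ε, 0 < ε ∧ ∀ u, |u| < ε → x + δ + u ∈ free W X j ∧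
        Hit (Over W) Y j (x + δ + u) ∧ Over W i (x + u) j (x + δ + u)) :
    ∃ ε > 0, ∃ B : Set ℝ, B.Finite ∧ ∀ u, |u| < ε → u ∉ B → x + u ∈ dom W i → ¬ Hit (Over W) Y i (x + u) →
      ∃ z ∈ ({state W i (x + u) 0, F.rev (state W i (x + u) (W i).len)} : Set (α × ℝ)), Blocked W X Y z := by
  obtain ⟨j, δ, ε, hε, h⟩ := hround
  refine ⟨ε, hε, _, (finite_edges (W := W) Y j).preimage
    (add_right_injective (x + δ)).injOn, fun u hu huB hdom hhit => ?_⟩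
  obtain ⟨hfree, ⟨s, hs, y, hy, k, hk, k', hk', hov⟩, ⟨m, hm, m', hm', hfg⟩⟩ := h u hu
  have hyI : y ∈ Ioo s.p s.q := by
    refine ⟨lt_of_le_of_ne hy.1 fun hc => huB ⟨s, hs, y, Or.inl hc.symm, k, hk, k', hk', hov⟩,
      lt_of_le_of_ne hy.2 fun hc => huB ⟨s, hs, y, Or.inr hc, k, hk, k', hk', hov⟩⟩
  have hyf := hY s hs hyI
  have hX : ∀ {j : ι} {w : ℝ}, w ∈ free W X j → ∀ k ≤ (W j).len, state W j w k ∉ occ W X :=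
    fun hw k hk hc => hw.2 (hit_iff.2 ⟨k, hk, hc⟩)
  have hpY : ∀ k ≤ (W s.idx).len, state W s.idx y k ∈ occ W Y := fun k hk => ⟨s, hs, y, hy, k, hk, Or.inl rfl⟩
  obtain ⟨z, hz, g, b, u', h', hg, hgu, hlt, hub, ht, hgX⟩ := exists_end (X := X) (Y := Y)
    (isWin_state hdom) (isWin_state hfree.1) hm hm' hfg (fun k hk hc => hhit (hit_iff.2 ⟨k, hk, hc⟩)) hk hov
    (hpY k' hk') (hX hfree)
  refine ⟨z, hz, ?_⟩
  rcases ht with ht | ht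
  · exact ⟨g, b, u', h', _, _, k', hg, hgu, hlt, hub, hgX, isWin_state hyf.1, ht, hk', hX hyf, hpY⟩
  · refine ⟨g, b, u', h', _, _, _, hg, hgu, hlt, hub, hgX, (isWin_state hyf.1).revPath, ?_,
      Nat.sub_le _ k', revPath_notMem_occ (hX hyf), fun k hk => rev_mem_occ.2 (hpY _ (Nat.sub_le _ _))⟩
    rw [revPath_sub hk', ht, F.rev_rev]

variable (W) in
/-- Boundedly many disjoint strips per gate hit all lines of a finite family of windows. -/
theorem exists_strips [Finite ι] :
    ∃ X : List (Strip ι), X.length ≤ 91 * F.gate.card ∧ (∀ s ∈ X, Ioo s.p s.q ⊆ dom W s.idx) ∧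
      X.Pairwise (DisjointStrips (Over W)) ∧ ∀ i, ∀ x ∈ dom W i, Hit (Over W) X i x := by
  obtain ⟨X₁, hl₁, hs₁, hd₁, hr₁⟩ := exists_round (W := W) [] (by simp)
  have hdom₁ : ∀ s ∈ X₁, Ioo s.p s.q ⊆ dom W s.idx := fun s hs x hx => (hs₁ s hs hx).1
  obtain ⟨X₂, hl₂, hs₂, hd₂, hr₂⟩ := exists_round X₁ hdom₁
  have hdom₂ : ∀ s ∈ X₁ ++ X₂, Ioo s.p s.q ⊆ dom W s.idx := by
    intro s hs
    rcases List.mem_append.1 hs with hs | hs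
    · exact hdom₁ s hs
    · exact fun x hx => (hs₂ s hs hx).1
  obtain ⟨X₃, hl₃, hs₃, hd₃, hr₃⟩ := exists_round (X₁ ++ X₂) hdom₂
  have hdom₃ : ∀ s ∈ X₁ ++ X₂ ++ X₃, Ioo s.p s.q ⊆ dom W s.idx := by
    intro s hs
    rcases List.mem_append.1 hs with hs | hs
    · exact hdom₂ s hs
    · exact fun x hx => (hs₃ s hs hx).1
  have hdisj : ∀ X Y : List (Strip ι), (∀ s ∈ Y, Ioo s.p s.q ⊆ free W X s.idx) →
      ∀ s ∈ X, ∀ t ∈ Y, DisjointStrips (Over W) s t := by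
    intro X Y hY s hs t ht x hx y hy hov
    exact (hY t ht hy).2 ⟨s, hs, x, ⟨hx.1.le, hx.2.le⟩, (isometricOverlap W).symm _ _ _ _ hov⟩
  refine ⟨X₁ ++ X₂ ++ X₃, ?_, hdom₃, ?_, ?_⟩
  -- With `g` gates, the rounds yield at most `g`, `g + 8 · g = 9g` and `g + 8 · 10g = 81g` strips.
  · simp only [List.length_append, List.length_nil] at *
    omega
  · exact List.pairwise_append.2 ⟨List.pairwise_append.2 ⟨hd₁, hd₂, hdisj _ _ hs₂⟩, hd₃, hdisj _ _ hs₃⟩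
  intro i x hx
  by_contra hno
  have hxf : x ∈ free W (X₁ ++ X₂ ++ X₃) i := ⟨hx, hno⟩
  obtain ⟨ε₀, hε₀, hball⟩ := Metric.isOpen_iff.1 (isOpen_free _ i) x hxf
  have hsub : ∀ {X : List (Strip ι)}, (∀ s ∈ X, s ∈ X₁ ++ X₂ ++ X₃) → ∀ {x}, x ∈ free W (X₁ ++ X₂ ++ X₃) i →
      x ∈ free W X i := fun hX _ hx => ⟨hx.1, fun hc => hx.2 (hc.mono hX)⟩
  obtain ⟨ε₁, hε₁, B₁, hB₁, hb₁⟩ := exists_blocked hs₁ (hr₁ i x (hsub (by simp) hxf))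
  obtain ⟨ε₂, hε₂, B₂, hB₂, hb₂⟩ := exists_blocked hs₂ (hr₂ i x (hsub (fun s hs => by simp only [List.mem_append] at *; tauto) hxf))
  obtain ⟨ε₃, hε₃, B₃, hB₃, hb₃⟩ := exists_blocked hs₃ (hr₃ i x (hsub (fun s hs => by simp only [List.mem_append] at *; tauto) hxf))
  set ε := min (min ε₀ ε₁) (min ε₂ ε₃) with hε
  have hεpos : 0 < ε := by simp [hε, hε₀, hε₁, hε₂, hε₃]
  -- A generic small shift keeps the line free and avoids the exceptional parameters of all three
  -- rounds at once.
  obtain ⟨u, hu, huB⟩ : ∃ u ∈ Ioo (-ε) ε, u ∉ B₁ ∪ B₂ ∪ B₃ := by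
    obtain ⟨u, hu, hu'⟩ := (Ioo_infinite (show -ε < ε by linarith)).exists_notMem_finite ((hB₁.union hB₂).union hB₃)
    exact ⟨u, hu, hu'⟩
  have hue : |u| < ε := abs_lt.2 hu
  simp only [mem_union, not_or] at huB
  have hu0 : |u| < ε₀ := hue.trans_le ((min_le_left _ _).trans (min_le_left _ _))
  have hu1 : |u| < ε₁ := hue.trans_le ((min_le_left _ _).trans (min_le_right _ _))
  have hu2 : |u| < ε₂ := hue.trans_le ((min_le_right _ _).trans (min_le_left _ _))
  have hu3 : |u| < ε₃ := hue.trans_le ((min_le_right _ _).trans (min_le_right _ _))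
  have hxu : x + u ∈ free W (X₁ ++ X₂ ++ X₃) i := hball (by simpa using hu0)
  obtain ⟨z₁, hz₁, h₁⟩ := hb₁ u hu1 huB.1.1 hxu.1 (hsub (by simp +contextual) hxu).2
  obtain ⟨z₂, hz₂, h₂⟩ := hb₂ u hu2 huB.1.2 hxu.1 (hsub (by simp +contextual) hxu).2
  obtain ⟨z₃, hz₃, h₃⟩ := hb₃ u hu3 huB.2 hxu.1 (hsub (by simp +contextual) hxu).2
  have hocc : ∀ z ∈ ({state W i (x + u) 0, F.rev (state W i (x + u) (W i).len)} : Set (α × ℝ)),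
      z ∉ occ W (X₁ ++ X₂ ++ X₃) := by
    rintro z (rfl | rfl) hc
    · exact hxu.2 (hit_iff.2 ⟨0, Nat.zero_le _, hc⟩)
    · exact hxu.2 (hit_iff.2 ⟨_, le_rfl, rev_mem_occ.1 hc⟩)
  have n12 : z₁ ≠ z₂ := by
    rintro rfl
    exact h₁.false h₂ (by simp) fun hc => hocc _ hz₂ (occ_mono (by simp +contextual) hc)
  have n13 : z₁ ≠ z₃ := by
    rintro rfl
    exact h₁.false h₃ (by simp +contextual) fun hc => hocc _ hz₃ (occ_mono (by simp +contextual) hc)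
  have n23 : z₂ ≠ z₃ := by
    rintro rfl
    exact h₂.false h₃ (by simp +contextual) fun hc => hocc _ hz₃ (occ_mono (by simp +contextual) hc)
  -- Three pairwise different states do not fit into a set of two.
  rcases hz₁ with hz₁ | hz₁ <;> rcases hz₂ with hz₂ | hz₂ <;> rcases hz₃ with hz₃ | hz₃ <;>
    first
    | exact n12 (hz₁.trans hz₂.symm)
    | exact n13 (hz₁.trans hz₃.symm)
    | exact n23 (hz₂.trans hz₃.symm)

end IntervalFlow

/-! ### Finiteness of words; long orbits -/

namespace IntervalFlow

variable {α : Type*} {F : IntervalFlow α}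

theorem Word.len_le_card [Fintype α] (w : F.Word) : w.len ≤ Fintype.card α := by
  have h : Function.Injective fun k : Fin w.len => w.A k := by
    intro i j hij
    by_contra hne
    rcases lt_or_gt_of_ne (fun h => hne (Fin.ext h) : (i : ℕ) ≠ j) with h | h
    · have := w.inj _ _ h j.2.le hij
      omega
    · have := w.inj _ _ h i.2.le hij.symm
      omega
  simpa using Fintype.card_le_of_injective _ h

/-- The shifts of a word are determined by its letters. -/
theorem Word.shift_eq_of_eq {w v : F.Word} (hlen : w.len = v.len) (h : ∀ k ≤ w.len, w.A k = v.A k) (k : ℕ)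
    (hk : k ≤ w.len) : w.shift k = v.shift k := by
  induction k with
  | zero => rw [w.shift_zero, v.shift_zero]
  | succ k ih =>
    rw [w.shift_succ k hk, v.shift_succ k (hlen ▸ hk), ih (by omega), h k (by omega), h (k + 1) hk]

variable (F) in
/-- Words without irrelevant information beyond their last letter. -/
abbrev NormalWord : Type _ := {w : F.Word // ∀ k, w.len < k → w.A k = w.A 0 ∧ w.shift k = 0}

/-- The length is at most the number of letters, and the letters determine the shifts. Finiteness of
the set of words is what guarantees widest strips. -/
theorem finite_normalWord [Finite α] : Finite F.NormalWord := by
  have := Fintype.ofFinite α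
  set N := Fintype.card α with hN
  refine Finite.of_injective
    (fun w : F.NormalWord => ((⟨w.1.len, Nat.lt_succ_of_le w.1.len_le_card⟩, fun k => w.1.A k) :
      Fin (N + 1) × (Fin (N + 1) → α))) ?_
  intro w v h
  simp only [Prod.mk.injEq, Fin.mk.injEq] at h
  obtain ⟨hlen, hA⟩ := h
  have hAk : ∀ k ≤ w.1.len, w.1.A k = v.1.A k := fun k hk =>
    congrFun hA ⟨k, Nat.lt_succ_of_le (hk.trans w.1.len_le_card)⟩
  have hA' : w.1.A = v.1.A := by
    funext k
    rcases le_or_gt k w.1.len with hk | hk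
    · exact hAk k hk
    · rw [(w.2 k hk).1, (v.2 k (hlen ▸ hk)).1, hAk 0 (Nat.zero_le _)]
  have hs : w.1.shift = v.1.shift := by
    funext k
    rcases le_or_gt k w.1.len with hk | hk
    · exact Word.shift_eq_of_eq hlen hAk k hk
    · rw [(w.2 k hk).2, (v.2 k (hlen ▸ hk)).2]
  obtain ⟨⟨⟩, _⟩ := w
  obtain ⟨⟨⟩, _⟩ := v
  simp_all

/-- A window that starts at a gate and does not close up is a line of some word. -/
theorem IsWin.exists_word {f : ℕ → α × ℝ} {c : ℕ} (hf : F.IsWin f c) (hg : (f 0).1 ∈ F.gate)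
    (hne : f 0 ≠ f c) : ∃ w : F.NormalWord, w.1.len = c ∧
      ∀ k ≤ c, state (Subtype.val : F.NormalWord → F.Word) w (f 0).2 k = f k := by
  -- Beyond `c` the values are those prescribed by the normal form.
  refine ⟨⟨⟨c, fun k => if k ≤ c then (f k).1 else (f 0).1, fun k => if k ≤ c then (f k).2 - (f 0).2 else 0,
    hf.pos, by simp, ?_, ?_, by simpa using hg, by simpa using hf.fst_eq, ?_, ?_⟩, ?_⟩, rfl, ?_⟩
  · intro k hk
    have := (hf.isPath.2 k hk).2.2.1
    simpa [hk.le, Nat.succ_le_of_lt hk] using this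
  · intro k hk
    have := (hf.isPath.2 k hk).2.2.2
    simp only [hk.le, Nat.succ_le_of_lt hk, if_true]
    rw [this]
    ring
  · intro i j hij hj h
    simp only [hij.le.trans hj, hj, if_true] at h
    exact hf.inj i j hij hj h
  · simp only [le_refl, if_true]
    intro h
    exact hne (Prod.ext hf.fst_eq (by linarith))
  · intro k hk
    simp only at hk
    simp [not_le.2 hk]
  · intro k hk
    simp [state, hk]

variable (F) in
/-- Boundedly many disjoint strips per gate meet every long orbit. -/
theorem exists_strips_of_path [Finite α] :
    ∃ X : List (Strip F.NormalWord), X.length ≤ 91 * F.gate.card ∧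
      (∀ s ∈ X, Ioo s.p s.q ⊆ dom Subtype.val s.idx) ∧ X.Pairwise (DisjointStrips (Over Subtype.val)) ∧
      ∀ f L, F.IsPath f L → (∀ i j, i < j → j ≤ L → f i ≠ f j) →
        (∃ k₁ k₂ k₃, k₁ < k₂ ∧ k₂ < k₃ ∧ k₃ ≤ L ∧ (f k₁).1 = (f k₂).1 ∧ (f k₂).1 = (f k₃).1) →
        ∃ s ∈ X, ∃ y ∈ Icc s.p s.q, ∃ k ≤ s.idx.1.len, ∃ k' ≤ L,
          state Subtype.val s.idx y k = f k' ∨ state Subtype.val s.idx y k = F.rev (f k') := by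
  have : Finite F.NormalWord := finite_normalWord
  obtain ⟨X, hl, hs, hd, hX⟩ := exists_strips (Subtype.val : F.NormalWord → F.Word)
  refine ⟨X, hl, hs, hd, ?_⟩
  rintro f L hf hinj ⟨k₁, k₂, k₃, h12, h23, h3, e12, e23⟩
  obtain ⟨a, c, hc, hac, hg, hw⟩ := hf.exists_window hinj h12 h23 h3 e12 e23
  obtain ⟨w, hwl, hst⟩ := hw.exists_word hg (hinj _ _ (by omega) hac)
  have hdom : (f a).2 ∈ dom Subtype.val w := by
    intro k hk
    have := hst k (hwl ▸ hk)
    simp only [add_zero] at this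
    rw [this]
    exact hf.valid (by omega)
  obtain ⟨s, hs', y, hy, k, hk, k', hk', h⟩ := hX w _ hdom
  have hfk := hst k (hwl ▸ hk)
  simp only [add_zero] at hfk
  rw [hfk] at h
  exact ⟨s, hs', y, hy, k', hk', a + k, by omega, h⟩

end IntervalFlow

/-! ### Euclidean coordinates on a piece -/

namespace Piece

variable (T : Piece)

theorem sgn_not (b : Bool) : sgn (!b) = -sgn b := by cases b <;> simp [sgn]

theorem sgn_mul_self (b : Bool) : sgn b * sgn b = 1 := by cases b <;> simp [sgn]

theorem sgn_mem_Icc (b : Bool) : sgn b ∈ Icc (-1 : ℝ) 1 := by cases b <;> simp [sgn]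

theorem sgn_injective : Function.Injective sgn := by
  intro b c h
  cases b <;> cases c <;> simp [sgn] at h ⊢ <;> linarith

/-- The height of the piece. -/
noncomputable def height : ℝ := ‖T.m₁ - T.m₀‖

theorem height_pos : 0 < T.height := norm_pos_iff.2 (sub_ne_zero.2 T.ne.symm)

/-- The unit vector along the axis. -/
noncomputable def axis : ℂ := (T.m₁ - T.m₀) / (T.height : ℂ)

theorem norm_axis : ‖T.axis‖ = 1 := by
  rw [axis, norm_div, Complex.norm_real, Real.norm_of_nonneg T.height_pos.le]
  exact div_self T.height_pos.ne'

theorem conj_axis_mul_axis : (starRingEnd ℂ) T.axis * T.axis = 1 := by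
  rw [mul_comm, Complex.mul_conj, Complex.normSq_eq_norm_sq, T.norm_axis]
  simp

theorem dir_eq : T.dir = Complex.I * T.axis := rfl

/-- The half width of the piece at a height. -/
def rad (t : ℝ) : ℝ := (1 - t) * T.r₀ + t * T.r₁

theorem rad_pos {t : ℝ} (ht : t ∈ Ioo (0 : ℝ) 1) : 0 < T.rad t := by
  have h0 := T.r₀_nonneg
  have h1 := T.r₁_nonneg
  have h2 := T.r_pos
  have h3 : 0 < 1 - t := by linarith [ht.2]
  unfold rad
  rcases h0.eq_or_lt with h | h
  · have : 0 < T.r₁ := by linarith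
    have := mul_pos ht.1 this
    have := mul_nonneg h3.le h0
    linarith
  · have := mul_pos h3 h
    have := mul_nonneg ht.1.le h1
    linarith

theorem pt_eq (s t : ℝ) :
    T.pt s t = T.m₀ + T.axis * ((t * T.height : ℝ) + (s * T.rad t : ℝ) * Complex.I) := by
  have h : (T.height : ℂ) ≠ 0 := by exact_mod_cast T.height_pos.ne'
  have h1 : T.axis * T.height = T.m₁ - T.m₀ := by rw [axis, div_mul_cancel₀ _ h]
  rw [pt, dir_eq]
  simp only [rad]
  push_cast
  linear_combination (-(t : ℂ)) * h1

/-- Cartesian coordinates adapted to the piece: the height is the real part. -/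
noncomputable def coord (z : ℂ) : ℂ := (starRingEnd ℂ) T.axis * (z - T.m₀)

theorem coord_pt (s t : ℝ) : T.coord (T.pt s t) = (t * T.height : ℝ) + (s * T.rad t : ℝ) * Complex.I := by
  rw [coord, pt_eq]
  linear_combination ((t * T.height : ℝ) + (s * T.rad t : ℝ) * Complex.I) * T.conj_axis_mul_axis

theorem coord_pt_re (s t : ℝ) : (T.coord (T.pt s t)).re = t * T.height := by
  rw [coord_pt]; simp

theorem coord_pt_im (s t : ℝ) : (T.coord (T.pt s t)).im = s * T.rad t := by
  rw [coord_pt]; simp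

theorem eq_of_coord (z : ℂ) : z = T.m₀ + T.axis * T.coord z := by
  rw [coord]
  linear_combination (-(z - T.m₀)) * T.conj_axis_mul_axis

theorem coord_injective : Function.Injective T.coord := fun z w h => by
  rw [T.eq_of_coord z, T.eq_of_coord w, h]

theorem continuous_coord : Continuous T.coord := by
  unfold coord; fun_prop

theorem height_eq_of_pt_eq {s t s' t' : ℝ} (h : T.pt s t = T.pt s' t') : t = t' := by
  have := congrArg (fun z => (T.coord z).re) h
  simp only [coord_pt_re] at this
  exact mul_right_cancel₀ T.height_pos.ne' this

theorem pos_eq_of_pt_eq {s t s' t' : ℝ} (ht : t ∈ Ioo (0 : ℝ) 1) (h : T.pt s t = T.pt s' t') : s = s' := by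
  have h1 := T.height_eq_of_pt_eq h
  subst h1
  have := congrArg (fun z => (T.coord z).im) h
  simp only [coord_pt_im] at this
  exact mul_right_cancel₀ (T.rad_pos ht).ne' this

/-- In adapted coordinates the piece is cut out by strict inequalities, which gives openness and,
near a side, half discs. -/
theorem mem_openSet_iff (z : ℂ) : z ∈ T.openSet ↔ 0 < (T.coord z).re ∧ (T.coord z).re < T.height ∧
    -T.rad ((T.coord z).re / T.height) < (T.coord z).im ∧
    (T.coord z).im < T.rad ((T.coord z).re / T.height) := by
  have hh := T.height_pos
  constructor
  · rintro ⟨s, hs, t, ht, rfl⟩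
    have hr := T.rad_pos ht
    rw [coord_pt_re, coord_pt_im, mul_div_cancel_right₀ _ hh.ne']
    refine ⟨mul_pos ht.1 hh, ?_, ?_, ?_⟩ <;> nlinarith [ht.1, ht.2, hs.1, hs.2]
  · rintro ⟨h1, h2, h3, h4⟩
    have ht : (T.coord z).re / T.height ∈ Ioo (0 : ℝ) 1 := ⟨div_pos h1 hh, (div_lt_one hh).2 h2⟩
    have hr := T.rad_pos ht
    refine ⟨(T.coord z).im / T.rad ((T.coord z).re / T.height), ⟨?_, ?_⟩, (T.coord z).re / T.height, ht, ?_⟩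
    · rw [lt_div_iff₀ hr]; linarith
    · rw [div_lt_one hr]; linarith
    · apply T.coord_injective
      rw [coord_pt, div_mul_cancel₀ _ hh.ne', div_mul_cancel₀ _ hr.ne']
      exact Complex.re_add_im _

theorem continuous_rad : Continuous T.rad := by
  unfold rad; fun_prop

theorem isOpen_openSet : IsOpen T.openSet := by
  have hc := T.continuous_coord
  have hr := T.continuous_rad
  have : T.openSet = {z | 0 < (T.coord z).re ∧ (T.coord z).re < T.height ∧
    -T.rad ((T.coord z).re / T.height) < (T.coord z).im ∧
    (T.coord z).im < T.rad ((T.coord z).re / T.height)} := by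
    ext z; exact T.mem_openSet_iff z
  rw [this]
  exact (isOpen_lt (by fun_prop) (by fun_prop)).and ((isOpen_lt (by fun_prop) (by fun_prop)).and
    ((isOpen_lt (by fun_prop) (by fun_prop)).and (isOpen_lt (by fun_prop) (by fun_prop))))

theorem continuous_pt : Continuous fun p : ℝ × ℝ => T.pt p.1 p.2 := by
  unfold pt; fun_prop

theorem pt_mem_closure {s t : ℝ} (hs : s ∈ Icc (-1 : ℝ) 1) (ht : t ∈ Icc (0 : ℝ) 1) :
    T.pt s t ∈ closure T.openSet := by
  have h : (s, t) ∈ closure (Ioo (-1 : ℝ) 1 ×ˢ Ioo (0 : ℝ) 1) := by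
    rw [closure_prod_eq, closure_Ioo (by norm_num), closure_Ioo (by norm_num)]
    exact ⟨hs, ht⟩
  refine closure_mono ?_ (image_closure_subset_closure_image T.continuous_pt ⟨_, h, rfl⟩)
  rintro _ ⟨⟨s, t⟩, ⟨hs, ht⟩, rfl⟩
  exact ⟨s, hs, t, ht, rfl⟩

theorem pt_mem_openSet {s t : ℝ} (hs : s ∈ Ioo (-1 : ℝ) 1) (ht : t ∈ Ioo (0 : ℝ) 1) :
    T.pt s t ∈ T.openSet := ⟨s, hs, t, ht, rfl⟩

theorem mem_qSeg_iff {s : ℝ} {z : ℂ} : z ∈ T.qSeg s ↔ ∃ t ∈ Icc (0 : ℝ) 1, z = T.pt s t := by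
  rw [qSeg, segment_eq_image]
  have : ∀ t : ℝ, (1 - t) • T.pt s 0 + t • T.pt s 1 = T.pt s t := by
    intro t
    simp only [pt_eq, rad, Complex.real_smul]
    push_cast
    ring
  simp only [this, mem_image, eq_comm]

theorem mem_pSeg_iff {t : ℝ} {z : ℂ} : z ∈ T.pSeg t ↔ ∃ s ∈ Icc (-1 : ℝ) 1, z = T.pt s t := by
  rw [pSeg, segment_eq_image]
  have : ∀ u : ℝ, (1 - u) • T.pt (-1) t + u • T.pt 1 t = T.pt (2 * u - 1) t := by
    intro u
    simp only [pt_eq, Complex.real_smul]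
    push_cast
    ring
  simp only [this, mem_image]
  constructor
  · rintro ⟨u, ⟨h0, h1⟩, rfl⟩
    exact ⟨2 * u - 1, ⟨by linarith, by linarith⟩, rfl⟩
  · rintro ⟨s, ⟨h0, h1⟩, rfl⟩
    refine ⟨(s + 1) / 2, ⟨by linarith, by linarith⟩, ?_⟩
    congr 1
    ring

/-- The length of the `Q`-sides. -/
noncomputable def len : ℝ := √(T.height ^ 2 + (T.r₁ - T.r₀) ^ 2)

theorem len_pos : 0 < T.len := Real.sqrt_pos.2 (by have := T.height_pos; positivity)

/-- The unit tangent vector to the `Q`-side `b` with the piece on its right. -/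
noncomputable def tan (b : Bool) : ℂ :=
  T.axis * (((sgn b * T.height / T.len : ℝ) : ℂ) + (((T.r₁ - T.r₀) / T.len : ℝ) : ℂ) * Complex.I)

/-- The `Q`-side `b` parametrized by arc length in the direction of `tan`. -/
noncomputable def sidePt (b : Bool) (y : ℝ) : ℂ := T.pt (sgn b) (sgn b * y / T.len)

/-- Motion at unit speed along the side: matching two sides then becomes an isometry of parameters.
-/
theorem sidePt_add (b : Bool) (y u : ℝ) : T.sidePt b (y + u) = T.sidePt b y + u * T.tan b := by
  have h : (T.len : ℂ) ≠ 0 := by exact_mod_cast T.len_pos.ne'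
  have h1 : ((sgn b : ℝ) : ℂ) * sgn b = 1 := by exact_mod_cast sgn_mul_self b
  simp only [sidePt, tan, pt_eq, rad]
  push_cast
  field_simp
  linear_combination (T.axis * Complex.I * u * (T.r₁ - T.r₀)) * h1

theorem norm_tan (b : Bool) : ‖T.tan b‖ = 1 := by
  rw [tan, norm_mul, T.norm_axis, one_mul, Complex.norm_add_mul_I, Real.sqrt_eq_one]
  have h : T.len ^ 2 = T.height ^ 2 + (T.r₁ - T.r₀) ^ 2 := Real.sq_sqrt (by positivity)
  have h0 := T.len_pos
  rw [div_pow, div_pow, mul_pow, pow_two (sgn b), sgn_mul_self, one_mul, ← add_div, ← h]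
  exact div_self (by positivity)

/-- The cross product. -/
noncomputable def cross (u v : ℂ) : ℝ := ((starRingEnd ℂ) u * v).im

theorem cross_tan (b : Bool) (v : ℂ) : cross (T.tan b) v * T.len =
    sgn b * T.height * ((starRingEnd ℂ) T.axis * v).im
      - (T.r₁ - T.r₀) * ((starRingEnd ℂ) T.axis * v).re := by
  have h0 := T.len_pos.ne'
  have : (starRingEnd ℂ) (T.tan b) * v = ((((sgn b * T.height / T.len : ℝ) : ℂ) -
      (((T.r₁ - T.r₀) / T.len : ℝ) : ℂ) * Complex.I)) * ((starRingEnd ℂ) T.axis * v) := by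
    rw [tan, map_mul, map_add, map_mul, Complex.conj_ofReal, Complex.conj_ofReal, Complex.conj_I]
    ring
  rw [cross, this, Complex.mul_im]
  simp only [Complex.sub_re, Complex.sub_im, Complex.ofReal_re, Complex.ofReal_im, Complex.mul_re,
    Complex.mul_im, Complex.I_re, Complex.I_im]
  field_simp
  ring

/-- The piece is on the right of its `Q`-sides. -/
theorem cross_tan_pt_sub (b : Bool) (y s t : ℝ) :
    cross (T.tan b) (T.pt s t - T.sidePt b y) * T.len = T.height * T.rad t * (sgn b * s - 1) := by
  have h0 := T.len_pos.ne'
  have h1 := sgn_mul_self b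
  have : (starRingEnd ℂ) T.axis * (T.pt s t - T.sidePt b y) = T.coord (T.pt s t) - T.coord (T.sidePt b y) := by
    rw [coord, coord]; ring
  rw [cross_tan, this, Complex.sub_im, Complex.sub_re, sidePt, coord_pt_re, coord_pt_im, coord_pt_re,
    coord_pt_im]
  simp only [rad]
  field_simp
  linear_combination T.height * (T.r₀ * (sgn b * y - T.len) - T.r₁ * sgn b * y) * h1

/-- A half disc around a point of a `Q`-side is contained in the piece. -/
theorem exists_half_disc (b : Bool) {y : ℝ} (hy : sgn b * y / T.len ∈ Ioo (0 : ℝ) 1) :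
    ∃ δ > 0, ∀ v : ℂ, ‖v‖ < δ → cross (T.tan b) v < 0 → T.sidePt b y + v ∈ T.openSet := by
  have hc := T.continuous_coord
  have hr := T.continuous_rad
  have hh := T.height_pos
  -- Near an inner point of the side only the inequality belonging to this side can fail; the others
  -- define the open set `U`.
  set U : Set ℂ := {z | 0 < (T.coord z).re ∧ (T.coord z).re < T.height ∧
    0 < T.rad ((T.coord z).re / T.height) + sgn b * (T.coord z).im} with hU
  have hUo : IsOpen U := by
    exact (isOpen_lt (by fun_prop) (by fun_prop)).and ((isOpen_lt (by fun_prop) (by fun_prop)).and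
      (isOpen_lt (by fun_prop) (by fun_prop)))
  have hmem : T.sidePt b y ∈ U := by
    have hp := T.rad_pos hy
    refine ⟨?_, ?_, ?_⟩ <;> simp only [sidePt, coord_pt_re, coord_pt_im]
    · exact mul_pos hy.1 hh
    · nlinarith [hy.2]
    · rw [mul_div_cancel_right₀ _ hh.ne', ← mul_assoc, sgn_mul_self]
      linarith
  obtain ⟨δ, hδ, hball⟩ := Metric.isOpen_iff.1 hUo _ hmem
  refine ⟨δ, hδ, fun v hv hcr => ?_⟩
  obtain ⟨h1, h2, h3⟩ := hball (show T.sidePt b y + v ∈ Metric.ball _ _ by simpa using hv)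
  rw [mem_openSet_iff]
  have hcr' := mul_neg_of_neg_of_pos hcr T.len_pos
  rw [cross_tan] at hcr'
  have e : T.coord (T.sidePt b y + v) = T.coord (T.sidePt b y) + (starRingEnd ℂ) T.axis * v := by
    rw [coord, coord]; ring
  have hlt : sgn b * (T.coord (T.sidePt b y + v)).im < T.rad ((T.coord (T.sidePt b y + v)).re / T.height) := by
    rw [e, Complex.add_re, Complex.add_im, sidePt, coord_pt_re, coord_pt_im, add_div,
      mul_div_cancel_right₀ _ hh.ne']
    set h := sgn b * y / T.len
    set ν := (starRingEnd ℂ) T.axis * v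
    have e2 : T.rad (h + ν.re / T.height) = T.rad h + (T.r₁ - T.r₀) * ν.re / T.height := by
      simp only [rad]; ring
    rw [e2, mul_add, ← mul_assoc, sgn_mul_self, one_mul]
    have : sgn b * ν.im < (T.r₁ - T.r₀) * ν.re / T.height := by
      rw [lt_div_iff₀ hh]; linarith
    linarith
  refine ⟨h1, h2, ?_⟩
  cases b <;> simp only [sgn, if_true, Bool.false_eq_true, if_false] at h3 hlt ⊢ <;> constructor <;> linarith

end Piece

/-- Each difference of endpoints is a multiple of the other. The two factors have product `1` and
absolute value at most `1`, so the first is `±1` and its parameters are extreme. -/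
theorem segment_eq_segment {E : Type*} [AddCommGroup E] [Module ℝ E] {P Q P' Q' : E} (hne : P ≠ Q)
    (h : segment ℝ P Q = segment ℝ P' Q') : (P = P' ∧ Q = Q') ∨ (P = Q' ∧ Q = P') := by
  have hP : P ∈ segment ℝ P' Q' := h ▸ left_mem_segment ℝ P Q
  have hQ : Q ∈ segment ℝ P' Q' := h ▸ right_mem_segment ℝ P Q
  have hP' : P' ∈ segment ℝ P Q := h ▸ left_mem_segment ℝ P' Q'
  have hQ' : Q' ∈ segment ℝ P Q := h ▸ right_mem_segment ℝ P' Q'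
  rw [segment_eq_image'] at hP hQ hP' hQ'
  obtain ⟨t, ht, hP⟩ := hP
  obtain ⟨u, hu, hQ⟩ := hQ
  obtain ⟨t', ht', hP'⟩ := hP'
  obtain ⟨u', hu', hQ'⟩ := hQ'
  have h1 : Q - P = (u - t) • (Q' - P') := by
    rw [← hP, ← hQ]
    module
  have h2 : Q' - P' = (u' - t') • (Q - P) := by
    conv_lhs => rw [← hP', ← hQ']
    module
  have h3 : ((u - t) * (u' - t') - 1) • (Q - P) = 0 := by
    rw [sub_smul, mul_smul, ← h2, ← h1, one_smul, sub_self]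
  have h4 : (u - t) * (u' - t') = 1 := by
    rcases smul_eq_zero.1 h3 with h | h
    · linarith
    · exact absurd (sub_eq_zero.1 h).symm hne
  obtain ⟨ht0, ht1⟩ := ht
  obtain ⟨hu0, hu1⟩ := hu
  obtain ⟨ht0', ht1'⟩ := ht'
  obtain ⟨hu0', hu1'⟩ := hu'
  have h5 : (t = 0 ∧ u = 1) ∨ (t = 1 ∧ u = 0) := by
    have hb1 : |u' - t'| ≤ 1 := abs_le.2 ⟨by linarith, by linarith⟩
    have hb : |u - t| = 1 := by
      apply le_antisymm (abs_le.2 ⟨by linarith, by linarith⟩)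
      have h6 : |u - t| * |u' - t'| = 1 := by rw [← abs_mul, h4, abs_one]
      nlinarith [abs_nonneg (u - t)]
    rcases (abs_eq one_pos.le).1 hb with h | h
    · left; constructor <;> linarith
    · right; constructor <;> linarith
  rcases h5 with ⟨rfl, rfl⟩ | ⟨rfl, rfl⟩
  · left
    simpa using And.intro hP.symm hQ.symm
  · right
    simpa using And.intro hP.symm hQ.symm

namespace Piece

/-- The dot product. -/
noncomputable def dot (u v : ℂ) : ℝ := ((starRingEnd ℂ) u * v).re

theorem dot_comm (u v : ℂ) : dot u v = dot v u := by
  simp only [dot, Complex.mul_re, Complex.conj_re, Complex.conj_im]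
  ring

theorem dot_self (u : ℂ) : dot u u = ‖u‖ ^ 2 := by
  rw [dot, mul_comm, Complex.mul_conj, Complex.normSq_eq_norm_sq, Complex.ofReal_re]

theorem norm_add_sq_eq {u v : ℂ} (hu : ‖u‖ = 1) (hv : ‖v‖ = 1) : ‖u + v‖ ^ 2 = 2 + 2 * dot u v := by
  have h1 := dot_self (u + v)
  have h2 := dot_self u
  have h3 := dot_self v
  rw [hu] at h2
  rw [hv] at h3
  simp only [dot, Complex.mul_re, Complex.conj_re, Complex.conj_im, Complex.add_re, Complex.add_im] at *
  rw [← h1]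
  linear_combination h2 + h3

theorem cross_rotate (u v : ℂ) (ε : ℝ) : cross u (-(ε * Complex.I * v)) = -(ε * dot u v) := by
  simp only [cross, dot, Complex.mul_re, Complex.mul_im, Complex.conj_re, Complex.conj_im, Complex.neg_re,
    Complex.neg_im, Complex.ofReal_re, Complex.ofReal_im, Complex.I_re, Complex.I_im]
  ring

theorem dot_add (u v w : ℂ) : dot u (v + w) = dot u v + dot u w := by
  simp [dot, mul_add]

theorem dot_ofReal_mul (u v : ℂ) (r : ℝ) : dot u (r * v) = r * dot u v := by
  simp only [dot, Complex.mul_re, Complex.mul_im, Complex.conj_re, Complex.conj_im, Complex.ofReal_re,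
    Complex.ofReal_im]
  ring

end Piece

open Piece

/-! ### Contact between `Q`-sides of disjoint pieces -/

section Sides

variable {n : ℕ} (T : Fin n → Piece)

/-- The least value of the arc length parameter on a `Q`-side. -/
noncomputable def sideLo (a : Fin n × Bool) : ℝ := if a.2 then 0 else -(T a.1).len

/-- The greatest value of the arc length parameter on a `Q`-side. -/
noncomputable def sideHi (a : Fin n × Bool) : ℝ := if a.2 then (T a.1).len else 0

/-- The height in the piece that corresponds to the arc length parameter. -/
noncomputable def ht (s : (Fin n × Bool) × ℝ) : ℝ := sgn s.1.2 * s.2 / (T s.1.1).len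

/-- The points of a `Q`-side, parametrized by arc length. -/
noncomputable def sidePoint (a : Fin n × Bool) (y : ℝ) : ℂ := (T a.1).sidePt a.2 y

noncomputable def sideTan (a : Fin n × Bool) : ℂ := (T a.1).tan a.2

/-- The other `Q`-side of the same piece. -/
def opp (a : Fin n × Bool) : Fin n × Bool := (a.1, !a.2)

theorem opp_opp (a : Fin n × Bool) : opp (opp a) = a := by simp [opp]

theorem mem_range_iff (a : Fin n × Bool) (y : ℝ) :
    y ∈ Ioo (sideLo T a) (sideHi T a) ↔ ht T (a, y) ∈ Ioo (0 : ℝ) 1 := by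
  have h := (T a.1).len_pos
  obtain ⟨i, b⟩ := a
  simp only [ht, sideLo, sideHi, mem_Ioo, div_lt_one h, lt_div_iff₀ h, zero_mul]
  cases b <;> simp only [sgn, if_true, Bool.false_eq_true, if_false] <;> constructor <;> rintro ⟨h1, h2⟩ <;>
    constructor <;> linarith

theorem mem_closed_range_iff (a : Fin n × Bool) (y : ℝ) :
    y ∈ Icc (sideLo T a) (sideHi T a) ↔ ht T (a, y) ∈ Icc (0 : ℝ) 1 := by
  have h := (T a.1).len_pos
  obtain ⟨i, b⟩ := a
  simp only [ht, sideLo, sideHi, mem_Icc, div_le_one h, le_div_iff₀ h, zero_mul]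
  cases b <;> simp only [sgn, if_true, Bool.false_eq_true, if_false] <;> constructor <;> rintro ⟨h1, h2⟩ <;>
    constructor <;> linarith

theorem sideHi_sub_sideLo (a : Fin n × Bool) : sideHi T a - sideLo T a = (T a.1).len := by
  obtain ⟨i, b⟩ := a
  cases b <;> simp [sideHi, sideLo]

theorem sideLo_lt_sideHi (a : Fin n × Bool) : sideLo T a < sideHi T a := by
  have := sideHi_sub_sideLo T a
  have := (T a.1).len_pos
  linarith

theorem sideHi_opp (a : Fin n × Bool) : sideHi T (opp a) = -sideLo T a := by
  obtain ⟨i, b⟩ := a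
  cases b <;> simp [sideHi, sideLo, opp]

theorem sideLo_opp (a : Fin n × Bool) : sideLo T (opp a) = -sideHi T a := by
  obtain ⟨i, b⟩ := a
  cases b <;> simp [sideHi, sideLo, opp]

theorem sidePoint_eq (a : Fin n × Bool) (y : ℝ) : sidePoint T a y = (T a.1).pt (sgn a.2) (ht T (a, y)) := rfl

theorem ht_opp_neg (a : Fin n × Bool) (y : ℝ) : ht T (opp a, -y) = ht T (a, y) := by
  simp [ht, opp, sgn_not]

theorem sidePoint_opp (a : Fin n × Bool) (y : ℝ) :
    sidePoint T (opp a) (-y) = (T a.1).pt (sgn (!a.2)) (ht T (a, y)) := by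
  rw [sidePoint_eq, ht_opp_neg]
  rfl

theorem sidePoint_add (a : Fin n × Bool) (y u : ℝ) :
    sidePoint T a (y + u) = sidePoint T a y + u * sideTan T a := (T a.1).sidePt_add a.2 y u

theorem norm_sideTan (a : Fin n × Bool) : ‖sideTan T a‖ = 1 := (T a.1).norm_tan a.2

theorem sidePoint_injective (a : Fin n × Bool) : Function.Injective (sidePoint T a) := by
  intro y y' h
  have := sidePoint_add T a y (y' - y)
  rw [add_sub_cancel, ← h, left_eq_add, mul_eq_zero] at this
  rcases this with h1 | h1
  · have : y' - y = 0 := by exact_mod_cast h1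
    linarith
  · have := norm_sideTan T a
    rw [h1] at this
    simp at this

theorem qSide_eq_segment (a : Fin n × Bool) :
    (T a.1).qSide a.2 = segment ℝ (sidePoint T a (sideLo T a)) (sidePoint T a (sideHi T a)) := by
  have h := (T a.1).len_pos.ne'
  obtain ⟨i, b⟩ := a
  cases b
  · rw [segment_symm]
    simp [qSide, qSeg, sidePoint_eq, ht, sideLo, sideHi, sgn, h]
  · simp [qSide, qSeg, sidePoint_eq, ht, sideLo, sideHi, sgn, h]

/-- Two `Q`-sides of different pieces have a point in common that is not an endpoint. -/
def Meets (a c : Fin n × Bool) : Prop :=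
  a.1 ≠ c.1 ∧ ∃ y ∈ Ioo (sideLo T a) (sideHi T a), ∃ y' ∈ Ioo (sideLo T c) (sideHi T c),
    sidePoint T a y = sidePoint T c y'

variable {T}

theorem Meets.symm {a c : Fin n × Bool} (h : Meets T a c) : Meets T c a := by
  obtain ⟨hne, y, hy, y', hy', he⟩ := h
  exact ⟨hne.symm, y', hy', y, hy, he.symm⟩

theorem exists_half_disc_side (a : Fin n × Bool) {y : ℝ} (hy : y ∈ Ioo (sideLo T a) (sideHi T a)) :
    ∃ δ > 0, ∀ v : ℂ, ‖v‖ < δ → cross (sideTan T a) v < 0 → sidePoint T a y + v ∈ (T a.1).openSet :=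
  (T a.1).exists_half_disc a.2 ((mem_range_iff T a y).1 hy)

variable (hT : ∀ i j, i ≠ j → Disjoint (T i).openSet (T j).openSet)
include hT

theorem eq_of_mem_openSet {i j : Fin n} {z : ℂ} (hi : z ∈ (T i).openSet) (hj : z ∈ closure (T j).openSet) :
    i = j := by
  by_contra hne
  exact Set.disjoint_left.1 ((hT i j hne).closure_right (T i).isOpen_openSet) hi hj

/-- Pieces that both lie near a point on one side of a direction coincide. -/
theorem piece_eq_of_dot_pos {a c : Fin n × Bool} {y y' : ℝ} (hy : y ∈ Ioo (sideLo T a) (sideHi T a))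
    (hy' : y' ∈ Ioo (sideLo T c) (sideHi T c)) (h : sidePoint T a y = sidePoint T c y') {v : ℂ}
    (ha : 0 < dot (sideTan T a) v) (hc : 0 < dot (sideTan T c) v) : a.1 = c.1 := by
  obtain ⟨δ, hδ, h1⟩ := exists_half_disc_side a hy
  obtain ⟨δ', hδ', h2⟩ := exists_half_disc_side c hy'
  have hm : 0 < min δ δ' := lt_min hδ hδ'
  set ε := min δ δ' / (2 * (‖v‖ + 1)) with hε
  have hε0 : 0 < ε := by positivity
  have hw : ‖-((ε : ℂ) * Complex.I * v)‖ < min δ δ' := by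
    rw [norm_neg, norm_mul, norm_mul, Complex.norm_I, mul_one, Complex.norm_real, Real.norm_of_nonneg hε0.le,
      hε, div_mul_eq_mul_div, div_lt_iff₀ (by positivity)]
    nlinarith [norm_nonneg v]
  have m1 := h1 _ (hw.trans_le (min_le_left _ _))
    (by rw [cross_rotate]; exact neg_neg_of_pos (mul_pos hε0 ha))
  have m2 := h2 _ (hw.trans_le (min_le_right _ _))
    (by rw [cross_rotate]; exact neg_neg_of_pos (mul_pos hε0 hc))
  rw [← h] at m2
  exact eq_of_mem_openSet hT m1 (subset_closure m2)

/-- If the unit tangents did not cancel, their sum would have positive dot product with both; turned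
clockwise by a right angle, it would point into both pieces. -/
theorem sideTan_eq_neg {a c : Fin n × Bool} (hne : a.1 ≠ c.1) {y y' : ℝ}
    (hy : y ∈ Ioo (sideLo T a) (sideHi T a)) (hy' : y' ∈ Ioo (sideLo T c) (sideHi T c))
    (h : sidePoint T a y = sidePoint T c y') : sideTan T c = -sideTan T a := by
  by_contra hc
  have hsum : sideTan T a + sideTan T c ≠ 0 := fun h0 => hc (eq_neg_of_add_eq_zero_right h0)
  have hpos : 0 < ‖sideTan T a + sideTan T c‖ ^ 2 := by positivity
  rw [norm_add_sq_eq (norm_sideTan T a) (norm_sideTan T c)] at hpos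
  refine hne (piece_eq_of_dot_pos hT hy hy' h (v := sideTan T a + sideTan T c) ?_ ?_)
  · rw [dot_add, dot_self, norm_sideTan]; linarith
  · rw [dot_add, dot_self, norm_sideTan, dot_comm]; linarith

/-- At an inner point of a `Q`-side there is at most one `Q`-side of another piece. -/
theorem side_unique {a b c : Fin n × Bool} (hab : a.1 ≠ b.1) (hac : a.1 ≠ c.1) {y y' y'' : ℝ}
    (hy : y ∈ Ioo (sideLo T a) (sideHi T a)) (hy' : y' ∈ Ioo (sideLo T b) (sideHi T b))
    (hy'' : y'' ∈ Ioo (sideLo T c) (sideHi T c)) (h : sidePoint T a y = sidePoint T b y')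
    (h' : sidePoint T a y = sidePoint T c y'') : b = c := by
  have h1 := sideTan_eq_neg hT hab hy hy' h
  have h2 := sideTan_eq_neg hT hac hy hy'' h'
  have h3 : b.1 = c.1 := by
    refine piece_eq_of_dot_pos hT hy' hy'' (h.symm.trans h') (v := sideTan T b) ?_ ?_
    · rw [dot_self, norm_sideTan]; norm_num
    · rw [h2, ← h1, dot_self, norm_sideTan]; norm_num
  obtain ⟨i, b⟩ := b
  obtain ⟨j, c⟩ := c
  obtain rfl : i = j := h3
  have h4 : (T i).pt (sgn b) _ = (T i).pt (sgn c) _ := h.symm.trans h'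
  rw [sgn_injective ((T i).pos_eq_of_pt_eq ((mem_range_iff T _ _).1 hy') h4)]

omit hT in
variable (T) in
/-- The sum of the parameters of a common point of two `Q`-sides. -/
noncomputable def glue (a c : Fin n × Bool) : ℝ := dot (sideTan T a) (sidePoint T c 0 - sidePoint T a 0)

/-- Along the common line the two parameters run in opposite directions at unit speed, so their sum
at common points is constant. -/
theorem sidePoint_eq_iff {a c : Fin n × Bool} (h : Meets T a c) (y y' : ℝ) :
    sidePoint T a y = sidePoint T c y' ↔ y + y' = glue T a c := by
  obtain ⟨hne, u, hu, u', hu', he⟩ := h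
  have htan := sideTan_eq_neg hT hne hu hu' he
  have e1 := sidePoint_add T a 0 u
  have e2 := sidePoint_add T c 0 u'
  rw [zero_add] at e1 e2
  have e3 : sidePoint T c 0 - sidePoint T a 0 = ((u + u' : ℝ) : ℂ) * sideTan T a := by
    rw [htan] at e2
    push_cast
    linear_combination (-1 : ℂ) * he + e1 - e2
  have e4 : glue T a c = u + u' := by
    rw [glue, e3, dot_ofReal_mul, dot_self, norm_sideTan]
    ring
  have e5 : sidePoint T c (glue T a c - y) = sidePoint T a y := by
    have e6 := sidePoint_add T c 0 (glue T a c - y)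
    have e7 := sidePoint_add T a 0 y
    rw [zero_add] at e6 e7
    rw [e6, e7, e4, htan]
    push_cast at e3 ⊢
    linear_combination e3
  rw [← e5, (sidePoint_injective T c).eq_iff]
  constructor <;> intro h <;> linarith

theorem glue_comm {a c : Fin n × Bool} (h : Meets T a c) : glue T a c = glue T c a := by
  obtain ⟨-, u, -, u', -, he⟩ := id h
  rw [← (sidePoint_eq_iff hT h u u').1 he, add_comm]
  exact (sidePoint_eq_iff hT h.symm u' u).1 he.symm

/-- The endpoints agree only as an unordered pair, but the midpoints agree in either order, so the
sides meet. Then the parameters run in opposite directions, and lower ends face upper ends. -/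
theorem meets_of_qSide_eq {a c : Fin n × Bool} (hne : a.1 ≠ c.1)
    (h : (T a.1).qSide a.2 = (T c.1).qSide c.2) :
    Meets T a c ∧ glue T a c = sideLo T a + sideHi T c ∧ glue T a c = sideHi T a + sideLo T c := by
  have ha := sideLo_lt_sideHi T a
  have hc := sideLo_lt_sideHi T c
  have hmid : ∀ d : Fin n × Bool, sidePoint T d ((sideLo T d + sideHi T d) / 2) =
      (sidePoint T d (sideLo T d) + sidePoint T d (sideHi T d)) / 2 := by
    intro d
    have e1 := sidePoint_add T d 0 (sideLo T d)
    have e2 := sidePoint_add T d 0 (sideHi T d)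
    have e3 := sidePoint_add T d 0 ((sideLo T d + sideHi T d) / 2)
    rw [zero_add] at e1 e2 e3
    rw [e1, e2, e3]
    push_cast
    ring
  have hnorm : ∀ d : Fin n × Bool, ‖sidePoint T d (sideHi T d) - sidePoint T d (sideLo T d)‖ =
      sideHi T d - sideLo T d := by
    intro d
    have e1 := sidePoint_add T d (sideLo T d) (sideHi T d - sideLo T d)
    rw [add_sub_cancel] at e1
    rw [e1, add_sub_cancel_left, norm_mul, norm_sideTan, mul_one, Complex.norm_real,
      Real.norm_of_nonneg (sub_nonneg.2 (sideLo_lt_sideHi T d).le)]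
  rw [qSide_eq_segment, qSide_eq_segment] at h
  have hends := segment_eq_segment (fun h => ha.ne (sidePoint_injective T a h)) h
  have hm : sidePoint T a ((sideLo T a + sideHi T a) / 2) = sidePoint T c ((sideLo T c + sideHi T c) / 2) := by
    rw [hmid, hmid]
    rcases hends with ⟨h1, h2⟩ | ⟨h1, h2⟩ <;> rw [h1, h2]
    rw [add_comm]
  have hl : sideHi T a - sideLo T a = sideHi T c - sideLo T c := by
    rw [← hnorm, ← hnorm]
    rcases hends with ⟨h1, h2⟩ | ⟨h1, h2⟩ <;> rw [h1, h2]
    rw [norm_sub_rev]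
  have hmeets : Meets T a c := ⟨hne, _, ⟨by linarith, by linarith⟩, _, ⟨by linarith, by linarith⟩, hm⟩
  have := (sidePoint_eq_iff hT hmeets _ _).1 hm
  refine ⟨hmeets, ?_, ?_⟩ <;> linarith

/-- A `Q`-side that is identical to a `Q`-side of another piece meets no further one. -/
theorem eq_of_meets_of_qSide_eq {a b c : Fin n × Bool} (hab : Meets T a b) (hne : a.1 ≠ c.1)
    (h : (T a.1).qSide a.2 = (T c.1).qSide c.2) : b = c := by
  obtain ⟨hm, h1, h2⟩ := meets_of_qSide_eq hT hne h
  obtain ⟨hab', y, hy, y', hy', he⟩ := hab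
  refine side_unique hT hab' hne hy hy' (y'' := glue T a c - y) ?_ he
    ((sidePoint_eq_iff hT hm _ _).2 (by ring))
  constructor <;> linarith [hy.1, hy.2]

end Sides

open Piece

/-! ### The flow of a dissection -/

section Flow

variable {n : ℕ} {T : Fin n → Piece} (hT : ∀ i j, i ≠ j → Disjoint (T i).openSet (T j).openSet)

theorem exists_partner_of_notMem {b : Fin n × Bool}
    (h : ¬ ∀ c : Fin n × Bool, c.1 ≠ b.1 → (T b.1).qSide (!b.2) ≠ (T c.1).qSide c.2) :
    ∃ c : Fin n × Bool, (opp b).1 ≠ c.1 ∧ (T (opp b).1).qSide (opp b).2 = (T c.1).qSide c.2 := by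
  push Not at h
  obtain ⟨c, h1, h2⟩ := h
  exact ⟨c, h1.symm, h2⟩

open Classical in
/-- The parallel flow through the pieces of a dissection.  A letter is a crossing of a piece, named after
the side through which it leaves the piece, and it is a gate if it enters the piece through a side that is
not shared with another piece. -/
noncomputable def flow : IntervalFlow (Fin n × Bool) where
  bar := opp
  lo := sideLo T
  hi := sideHi T
  nxt a b := Meets T a (opp b)
  tr a b := -glue T a (opp b)
  gate := Finset.univ.filter fun b => ∀ c : Fin n × Bool, c.1 ≠ b.1 → (T b.1).qSide (!b.2) ≠ (T c.1).qSide c.2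
  bar_bar := opp_opp
  bar_ne a h := by
    have := congrArg Prod.snd h
    simp [opp] at this
  hi_bar := sideHi_opp T
  nxt_bar a b h := by
    rw [opp_opp]
    exact h.symm
  tr_bar a b h := by rw [opp_opp, glue_comm hT h]
  not_nxt_bar a h := h.1 (by simp [opp])
  det a b c y hab hac hy hb hc := by
    have h1 := (sidePoint_eq_iff hT hab y (glue T a (opp b) - y)).2 (by ring)
    have h2 := (sidePoint_eq_iff hT hac y (glue T a (opp c) - y)).2 (by ring)
    have := side_unique hT hab.1 hac.1 hy (y' := glue T a (opp b) - y) (y'' := glue T a (opp c) - y)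
      (by rw [sideLo_opp, sideHi_opp]; constructor <;> linarith [hb.1, hb.2])
      (by rw [sideLo_opp, sideHi_opp]; constructor <;> linarith [hc.1, hc.2]) h1 h2
    rw [← opp_opp b, this, opp_opp]
  lo_eq a b hab hb := by
    obtain ⟨c, hne, hc⟩ := exists_partner_of_notMem (by simpa using hb)
    obtain rfl := eq_of_meets_of_qSide_eq hT hab.symm hne hc
    obtain ⟨-, h1, h2⟩ := meets_of_qSide_eq hT hne hc
    rw [glue_comm hT hab, h2, sideHi_opp]
    ring
  prev_unique a b c hac hbc hc := by
    obtain ⟨d, hne, hd⟩ := exists_partner_of_notMem (by simpa using hc)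
    rw [eq_of_meets_of_qSide_eq hT hac.symm hne hd, eq_of_meets_of_qSide_eq hT hbc.symm hne hd]

theorem mem_gate_iff (b : Fin n × Bool) : b ∈ (flow hT).gate ↔
    ∀ c : Fin n × Bool, c.1 ≠ b.1 → (T b.1).qSide (!b.2) ≠ (T c.1).qSide c.2 := by
  classical
  simp [flow]

variable (T) in
/-- The point where a crossing leaves its piece. -/
noncomputable def exitPt (s : (Fin n × Bool) × ℝ) : ℂ := sidePoint T s.1 s.2

variable (T) in
/-- The point where a crossing enters its piece. -/
noncomputable def entryPt (s : (Fin n × Bool) × ℝ) : ℂ := sidePoint T (opp s.1) (-s.2)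

variable (T) in
/-- The segment of a crossing. -/
noncomputable def segOf (s : (Fin n × Bool) × ℝ) : Set ℂ := (T s.1.1).pSeg (ht T s)

theorem exitPt_eq (s : (Fin n × Bool) × ℝ) : exitPt T s = (T s.1.1).pt (sgn s.1.2) (ht T s) := rfl

theorem entryPt_eq (s : (Fin n × Bool) × ℝ) : entryPt T s = (T s.1.1).pt (sgn (!s.1.2)) (ht T s) :=
  sidePoint_opp T s.1 s.2

theorem exitPt_rev (s : (Fin n × Bool) × ℝ) : exitPt T ((flow hT).rev s) = entryPt T s := rfl

theorem entryPt_rev (s : (Fin n × Bool) × ℝ) : entryPt T ((flow hT).rev s) = exitPt T s := by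
  rw [← exitPt_rev hT, IntervalFlow.rev_rev]

theorem ht_rev (s : (Fin n × Bool) × ℝ) : ht T ((flow hT).rev s) = ht T s := ht_opp_neg T s.1 s.2

theorem segOf_rev (s : (Fin n × Bool) × ℝ) : segOf T ((flow hT).rev s) = segOf T s := by
  rw [segOf, ht_rev]
  rfl

theorem valid_iff (s : (Fin n × Bool) × ℝ) : (flow hT).Valid s ↔ ht T s ∈ Ioo (0 : ℝ) 1 :=
  mem_range_iff T s.1 s.2

theorem exitPt_mem_segOf (s : (Fin n × Bool) × ℝ) : exitPt T s ∈ segOf T s :=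
  (mem_pSeg_iff _).2 ⟨_, sgn_mem_Icc _, exitPt_eq s⟩

theorem entryPt_mem_segOf (s : (Fin n × Bool) × ℝ) : entryPt T s ∈ segOf T s :=
  (mem_pSeg_iff _).2 ⟨_, sgn_mem_Icc _, entryPt_eq s⟩

/-- A point of a segment lies inside the piece or is one of the two endpoints. -/
theorem mem_segOf_cases {s : (Fin n × Bool) × ℝ} (hs : (flow hT).Valid s) {z : ℂ} (hz : z ∈ segOf T s) :
    z ∈ (T s.1.1).openSet ∨ z = exitPt T s ∨ z = entryPt T s := by
  obtain ⟨u, hu, rfl⟩ := (mem_pSeg_iff _).1 hz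
  rw [exitPt_eq, entryPt_eq]
  rcases hu.1.eq_or_lt with h1 | h1
  · right
    rw [← h1]
    cases s.1.2 <;> simp [sgn]
  rcases hu.2.eq_or_lt with h2 | h2
  · right
    rw [h2]
    cases s.1.2 <;> simp [sgn]
  exact Or.inl (pt_mem_openSet _ ⟨h1, h2⟩ ((valid_iff hT s).1 hs))

theorem segOf_subset_closure {s : (Fin n × Bool) × ℝ} (hs : (flow hT).Valid s) :
    segOf T s ⊆ closure (T s.1.1).openSet := by
  intro z hz
  obtain ⟨u, hu, rfl⟩ := (mem_pSeg_iff _).1 hz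
  exact pt_mem_closure _ hu (Ioo_subset_Icc_self ((valid_iff hT s).1 hs))

/-- A common point at valid heights already makes the sides meet, and the translation is then
determined. So steps can be recognized from points alone. -/
theorem step_iff {s t : (Fin n × Bool) × ℝ} : (flow hT).Step s t ↔
    (flow hT).Valid s ∧ (flow hT).Valid t ∧ s.1.1 ≠ t.1.1 ∧ exitPt T s = entryPt T t := by
  constructor
  · rintro ⟨h1, h2, h3, h4⟩
    refine ⟨h1, h2, h3.1, (sidePoint_eq_iff hT h3 _ _).2 ?_⟩
    rw [h4]
    simp only [flow]
    ring
  · rintro ⟨h1, h2, h3, h4⟩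
    have h5 : Meets T s.1 (opp t.1) := ⟨h3, s.2, h1, -t.2, h2.rev, h4⟩
    refine ⟨h1, h2, h5, ?_⟩
    have := (sidePoint_eq_iff hT h5 _ _).1 h4
    simp only [flow]
    linarith

/-- Consecutive letters fit together along their whole sides. -/
theorem exitPt_eq_entryPt_of_nxt {a b : Fin n × Bool} (h : (flow hT).nxt a b) (y : ℝ) :
    exitPt T (a, y) = entryPt T (b, y + (flow hT).tr a b) := by
  refine (sidePoint_eq_iff hT h _ _).2 ?_
  simp only [flow]
  ring

/-- At a given height a piece has just two crossings, one in each direction. -/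
theorem eq_or_eq_rev {s t : (Fin n × Bool) × ℝ} (hp : s.1.1 = t.1.1) (hh : ht T s = ht T t) :
    s = t ∨ t = (flow hT).rev s := by
  obtain ⟨⟨i, b⟩, y⟩ := s
  obtain ⟨⟨j, c⟩, y'⟩ := t
  obtain rfl : i = j := hp
  have h := (T i).len_pos.ne'
  simp only [ht] at hh
  have h1 : sgn b * y = sgn c * y' := by
    field_simp at hh
    exact hh
  by_cases hbc : b = c
  · subst hbc
    left
    have := sgn_mul_self b
    have : y = y' := by linear_combination sgn b * h1 + (y' - y) * this
    rw [this]
  · right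
    have hc : c = !b := by cases b <;> cases c <;> simp_all
    subst hc
    have := sgn_mul_self b
    rw [sgn_not] at h1
    have : y' = -y := by linear_combination sgn b * h1 + (-y - y') * this
    rw [this]
    rfl

/-- At an inner point of a common part of two `Q`-sides there is no third piece. -/
theorem eq_or_eq_of_mem_closure {s t : (Fin n × Bool) × ℝ} (h : (flow hT).Step s t) {j : Fin n}
    (hj : exitPt T s ∈ closure (T j).openSet) : j = s.1.1 ∨ j = t.1.1 := by
  obtain ⟨h1, h2, h3, h4⟩ := (step_iff hT).1 h
  have r1 : s.2 ∈ Ioo (sideLo T s.1) (sideHi T s.1) := h1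
  have r2 : -t.2 ∈ Ioo (sideLo T (opp t.1)) (sideHi T (opp t.1)) := h2.rev
  have h4' : sidePoint T s.1 s.2 = sidePoint T (opp t.1) (-t.2) := h4
  obtain ⟨δ, hδ, d1⟩ := exists_half_disc_side (T := T) s.1 r1
  obtain ⟨δ', hδ', d2⟩ := exists_half_disc_side (T := T) (opp t.1) r2
  have htan := sideTan_eq_neg hT (c := opp t.1) h3 r1 r2 h4'
  have hm : 0 < min δ δ' := lt_min hδ hδ'
  set z := exitPt T s with hz
  have hU : IsOpen ((T j).openSet ∩ Metric.ball z (min δ δ')) := (T j).isOpen_openSet.inter Metric.isOpen_ball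
  obtain ⟨w, hw⟩ : ((T j).openSet ∩ Metric.ball z (min δ δ')).Nonempty := by
    obtain ⟨w, hw1, hw2⟩ := mem_closure_iff.1 hj _ Metric.isOpen_ball (Metric.mem_ball_self hm)
    exact ⟨w, hw2, hw1⟩
  -- An open set does not stay within the tangent line. Once `w` is off it, `w` lies in one of the
  -- two half discs.
  obtain ⟨w, hw, hcr⟩ : ∃ w ∈ (T j).openSet ∩ Metric.ball z (min δ δ'), cross (sideTan T s.1) (w - z) ≠ 0 := by
    by_cases hcr : cross (sideTan T s.1) (w - z) = 0
    · obtain ⟨ε, hε, hb⟩ := Metric.isOpen_iff.1 hU w hw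
      refine ⟨w + -(((ε / 2 : ℝ) : ℂ) * Complex.I * sideTan T s.1), hb ?_, ?_⟩
      · rw [Metric.mem_ball, dist_self_add_left, norm_neg, norm_mul, norm_mul, norm_sideTan, Complex.norm_I,
          Complex.norm_real, Real.norm_of_nonneg (by linarith)]
        linarith
      · have : cross (sideTan T s.1) (w + -(((ε / 2 : ℝ) : ℂ) * Complex.I * sideTan T s.1) - z) =
            cross (sideTan T s.1) (w - z) + cross (sideTan T s.1) (-(((ε / 2 : ℝ) : ℂ) * Complex.I * sideTan T s.1)) := by
          simp only [cross, ← Complex.add_im]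
          congr 1
          ring
        rw [this, hcr, cross_rotate, dot_self, norm_sideTan]
        linarith
    · exact ⟨w, hw, hcr⟩
  have hnorm : ‖w - z‖ < min δ δ' := by simpa [dist_eq_norm] using hw.2
  rcases lt_or_gt_of_ne hcr with hlt | hgt
  · left
    have := d1 (w - z) (hnorm.trans_le (min_le_left _ _)) hlt
    rw [show sidePoint T s.1 s.2 + (w - z) = w by rw [hz, exitPt]; ring] at this
    exact eq_of_mem_openSet hT hw.1 (subset_closure this)
  · right
    have hc' : cross (sideTan T (opp t.1)) (w - z) < 0 := by
      rw [htan]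
      simp only [cross, map_neg, neg_mul, Complex.neg_im] at hgt ⊢
      linarith
    have := d2 (w - z) (hnorm.trans_le (min_le_right _ _)) hc'
    have e : sidePoint T (opp t.1) (-t.2) + (w - z) = w := by
      rw [← h4', hz, exitPt]; ring
    rw [e] at this
    exact eq_of_mem_openSet hT hw.1 (subset_closure this)

/-- The segments of an orbit without repeated states form a simple arc. -/
theorem eq_succ_of_mem_segOf {f : ℕ → (Fin n × Bool) × ℝ} {b : ℕ} (hf : (flow hT).IsPath f b)
    (hinj : ∀ i j, i < j → j ≤ b → f i ≠ f j) {i j : ℕ} (hij : i < j) (hj : j < b) {z : ℂ}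
    (hi' : z ∈ segOf T (f i)) (hj' : z ∈ segOf T (f j)) : j = i + 1 ∧ z = exitPt T (f i) := by
  have vi := hf.valid (show i ≤ b by omega)
  have vj := hf.valid hj.le
  have hpne : (f i).1.1 ≠ (f j).1.1 := by
    intro hp
    have hh : ht T (f i) = ht T (f j) := by
      obtain ⟨u, -, h1⟩ := (mem_pSeg_iff _).1 hi'
      obtain ⟨u', -, h2⟩ := (mem_pSeg_iff _).1 hj'
      rw [h1, hp] at h2
      exact (T (f j).1.1).height_eq_of_pt_eq h2
    rcases eq_or_eq_rev hT hp hh with h | h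
    · exact hinj i j hij hj.le h
    · exact hf.ne_rev hij.le hj.le h
  rcases mem_segOf_cases hT vi hi' with h | h | h
  · exact absurd (eq_of_mem_openSet hT h (segOf_subset_closure hT vj hj')) hpne
  -- Coinciding endpoints would give a step between the two states or their reverses. Uniqueness of
  -- successors and predecessors leaves only consecutive segments.
  all_goals rcases mem_segOf_cases hT vj hj' with h' | h' | h'
  · exact absurd (eq_of_mem_openSet hT h' (segOf_subset_closure hT vi hi')).symm hpne
  · have s1 : (flow hT).Step (f i) ((flow hT).rev (f j)) := (step_iff hT).2
      ⟨vi, vj.rev, hpne, by rw [entryPt_rev, ← h, h']⟩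
    have := s1.eq_right _ (hf.2 i (by omega))
    exact absurd (by rw [← this, IntervalFlow.rev_rev]) (hf.ne_rev (show i + 1 ≤ j by omega) hj.le)
  · have s1 : (flow hT).Step (f i) (f j) := (step_iff hT).2 ⟨vi, vj, hpne, by rw [← h, h']⟩
    have := s1.eq_right _ (hf.2 i (by omega))
    refine ⟨?_, h⟩
    by_contra hne
    exact hinj (i + 1) j (by omega) hj.le this.symm
  · exact absurd (eq_of_mem_openSet hT h' (segOf_subset_closure hT vi hi')).symm hpne
  · have s1 : (flow hT).Step (f j) (f i) := (step_iff hT).2 ⟨vj, vi, hpne.symm, by rw [← h, h']⟩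
    have := s1.eq_right _ (hf.2 j hj)
    exact absurd this (hinj i (j + 1) (by omega) hj)
  · have s1 : (flow hT).Step ((flow hT).rev (f i)) (f j) := (step_iff hT).2
      ⟨vi.rev, vj, hpne, by rw [exitPt_rev, ← h, h']⟩
    have s2 := hf.2 (j - 1) (by omega)
    rw [show j - 1 + 1 = j by omega] at s2
    exact absurd (s2.eq_left _ s1) (hf.ne_rev (show i ≤ j - 1 by omega) (by omega))

end Flow

open Piece

theorem Piece.sideOf_eq (T : Piece) (b : Bool) (z : ℂ) (y : ℝ) :
    T.sideOf b z = sgn b * T.len * cross (T.tan b) (z - T.sidePt b y) := by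
  have h := T.len_pos.ne'
  have h0 : T.sidePt b 0 = T.pt (sgn b) 0 := by simp [sidePt]
  have h1 : T.sidePt b (sgn b * T.len) = T.pt (sgn b) 1 := by
    rw [sidePt, ← mul_assoc, sgn_mul_self, one_mul, div_self h]
  have h2 := T.sidePt_add b 0 (sgn b * T.len)
  have h3 := T.sidePt_add b 0 y
  rw [zero_add, h1, h0] at h2
  rw [zero_add, h0] at h3
  rw [sideOf, h2, h3, add_sub_cancel_left]
  have h4 : cross (T.tan b) (z - (T.pt (sgn b) 0 + y * T.tan b)) = cross (T.tan b) (z - T.pt (sgn b) 0) := by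
    simp only [cross, Complex.mul_im, Complex.conj_re, Complex.conj_im, Complex.sub_re, Complex.sub_im,
      Complex.add_re, Complex.add_im, Complex.mul_re, Complex.ofReal_re, Complex.ofReal_im]
    ring
  rw [h4, cross, map_mul, Complex.conj_ofReal, mul_assoc, Complex.im_ofReal_mul]

/-! ### Lines of words as return paths -/

section Lines

variable {n : ℕ} {T : Fin n → Piece} {hT : ∀ i j, i ≠ j → Disjoint (T i).openSet (T j).openSet}
  (w : (flow hT).Word)

/-- The `k`-th state on the line `x` of a word. -/
def lineState (x : ℝ) (k : ℕ) : (Fin n × Bool) × ℝ := (w.A k, x + w.shift k)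

/-- The line `x` of a word as a path. -/
noncomputable def lineTrack (x : ℝ) : Track n where
  -- There are `len` crossings; the state `len` contributes only its entry point, which is the
  -- finish.
  last := w.len - 1
  cross k := ⟨(w.A k).1, (w.A k).2⟩
  height k := ht T (lineState w x k)

theorem entry_lineTrack (x : ℝ) (k : Fin (w.len - 1 + 1)) :
    (lineTrack w x).entry T k = entryPt T (lineState w x k) := (entryPt_eq _).symm

theorem exitPt_lineState (x : ℝ) {k : ℕ} (hk : k < w.len) :
    exitPt T (lineState w x k) = entryPt T (lineState w x (k + 1)) := by
  rw [lineState, exitPt_eq_entryPt_of_nxt hT (w.nxt k hk), lineState, w.shift_succ k hk, add_assoc]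

theorem start_lineTrack (x : ℝ) : (lineTrack w x).start T = entryPt T (lineState w x 0) :=
  entry_lineTrack w x 0

theorem finish_lineTrack (x : ℝ) : (lineTrack w x).finish T = entryPt T (lineState w x w.len) := by
  have h := exitPt_lineState w x (k := w.len - 1) (by have := w.pos; omega)
  rw [show w.len - 1 + 1 = w.len by have := w.pos; omega] at h
  exact h

theorem joined_lineTrack (x : ℝ) : (lineTrack w x).Joined T := by
  intro i j hij
  have h : (lineTrack w x).entry T j = entryPt T (lineState w x j) := entry_lineTrack w x j
  rw [h, hij]
  exact exitPt_lineState w x (by have := i.2; have := j.2; simp only [lineTrack] at *; omega)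

theorem entryPt_mem_qSide {x : ℝ} {k : ℕ} (hk : ht T (lineState w x k) ∈ Icc (0 : ℝ) 1) :
    entryPt T (lineState w x k) ∈ (T (w.A k).1).qSide (!(w.A k).2) := by
  rw [entryPt_eq, qSide, mem_qSeg_iff]
  exact ⟨_, hk, rfl⟩

theorem start_mem_qSide {x : ℝ} (hk : ht T (lineState w x 0) ∈ Icc (0 : ℝ) 1) :
    (lineTrack w x).start T ∈ (T (w.A 0).1).qSide (!(w.A 0).2) := by
  rw [start_lineTrack]
  exact entryPt_mem_qSide w hk

theorem finish_mem_qSide {x : ℝ} (hk : ht T (lineState w x w.len) ∈ Icc (0 : ℝ) 1) :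
    (lineTrack w x).finish T ∈ (T (w.A 0).1).qSide (!(w.A 0).2) := by
  rw [finish_lineTrack, w.ends]
  exact entryPt_mem_qSide w hk

/-- Only the first and the last letter coincide, and their parameters differ by the nonzero total
shift. -/
theorem lineState_ne (x : ℝ) (i j : ℕ) (hij : i < j) (hj : j ≤ w.len) : lineState w x i ≠ lineState w x j := by
  intro h
  obtain ⟨rfl, rfl⟩ := w.inj i j hij hj (congrArg Prod.fst h)
  have := congrArg Prod.snd h
  simp only [lineState, w.shift_zero] at this
  exact w.shift_ne (by linarith)

variable {w} {x : ℝ} (hx : (flow hT).IsPath (lineState w x) w.len)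
include hx

theorem isPPath_lineTrack : (lineTrack w x).IsPPath T where
  height_mem k := (valid_iff hT _).1 (hx.valid (by have := k.2; simp only [lineTrack] at this; omega))
  joined := joined_lineTrack w x
  simple i j hij z hi hj := eq_succ_of_mem_segOf hT hx (lineState_ne w x) hij
    (by have := j.2; have := w.pos; simp only [lineTrack] at *; omega) hi hj

/-- A line meets the `Q`-segments of a piece where it crosses the piece, or else in one of its endpoints. -/
theorem mem_carrier_qSeg {i : Fin n} {s : ℝ} (hs : s ∈ Icc (-1 : ℝ) 1) {z : ℂ}
    (hz : z ∈ (lineTrack w x).carrier T) (hzs : z ∈ (T i).qSeg s) :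
    (∃ k < w.len, (w.A k).1 = i ∧ z = (T i).pt s (ht T (lineState w x k))) ∨
      (i = (w.A 0).1 ∧ z = (lineTrack w x).finish T) ∨ (i ≠ (w.A 0).1 ∧ z = (lineTrack w x).start T) := by
  have key : ∀ k, z ∈ segOf T (lineState w x k) → (w.A k).1 = i → z = (T i).pt s (ht T (lineState w x k)) := by
    intro k hk hi
    obtain ⟨u, -, h1⟩ := (mem_pSeg_iff _).1 hk
    obtain ⟨t, -, h2⟩ := (mem_qSeg_iff _).1 hzs
    have h3 : (T i).pt s t = (T i).pt u (ht T (lineState w x k)) := by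
      rw [← h2, h1]
      simp only [lineState, hi]
    rw [h2, (T i).height_eq_of_pt_eq h3]
  have hcl : z ∈ closure (T i).openSet := by
    obtain ⟨t, ht, rfl⟩ := (mem_qSeg_iff _).1 hzs
    exact pt_mem_closure _ hs ht
  obtain ⟨⟨k, hk⟩, hzk⟩ := mem_iUnion.1 hz
  have hk : k < w.len := by have := w.pos; simp only [lineTrack] at hk; omega
  change z ∈ segOf T (lineState w x k) at hzk
  by_cases hi : (w.A k).1 = i
  · exact Or.inl ⟨k, hk, hi, key k hzk hi⟩
  rcases mem_segOf_cases hT (hx.valid hk.le) hzk with h | h | h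
  · exact absurd (eq_of_mem_openSet hT h hcl) hi
  · have h1 := eq_or_eq_of_mem_closure hT (hx.2 k hk) (h ▸ hcl)
    have h2 : i = (w.A (k + 1)).1 := h1.resolve_left fun h => hi h.symm
    have h3 : z = entryPt T (lineState w x (k + 1)) := h.trans (exitPt_lineState w x hk)
    rcases Nat.lt_or_ge (k + 1) w.len with hlt | hge
    · exact Or.inl ⟨k + 1, hlt, h2.symm, key _ (h3 ▸ entryPt_mem_segOf _) h2.symm⟩
    · have hk1 : k + 1 = w.len := by omega
      exact Or.inr (Or.inl ⟨by rw [h2, w.ends, hk1], by rw [finish_lineTrack, h3, hk1]⟩)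
  · rcases k with _ | k
    · exact Or.inr (Or.inr ⟨fun h => hi h.symm, by rw [start_lineTrack, h]⟩)
    · have h3 : z = exitPt T (lineState w x k) := h.trans (exitPt_lineState w x (by omega)).symm
      have h1 := eq_or_eq_of_mem_closure hT (hx.2 k (by omega)) (h3 ▸ hcl)
      have h2 : i = (w.A k).1 := h1.resolve_right fun h => hi h.symm
      exact Or.inl ⟨k, by omega, h2.symm, key _ (h3 ▸ exitPt_mem_segOf _) h2.symm⟩

/-- The letters are distinct, so a piece is crossed at most once in each direction. The third point
`e` is the one endpoint of the path that may touch the piece without a crossing. -/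
theorem encard_carrier_inter_qSeg_le (i : Fin n) {s : ℝ} (hs : s ∈ Icc (-1 : ℝ) 1) :
    ((lineTrack w x).carrier T ∩ (T i).qSeg s).encard ≤ 3 := by
  classical
  set e : ℂ := if i = (w.A 0).1 then (lineTrack w x).finish T else (lineTrack w x).start T with he
  set g : Bool → ℂ := fun b =>
    if h : ∃ k < w.len, w.A k = (i, b) then (T i).pt s (ht T (lineState w x h.choose)) else e with hg
  have hsub : (lineTrack w x).carrier T ∩ (T i).qSeg s ⊆ {g true, g false, e} := by
    rintro z ⟨hz, hzs⟩
    rcases mem_carrier_qSeg hx hs hz hzs with ⟨k, hk, hi, h⟩ | ⟨hi, h⟩ | ⟨hi, h⟩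
    · have hex : ∃ m < w.len, w.A m = (i, (w.A k).2) := ⟨k, hk, by rw [← hi]⟩
      have hz : z = g (w.A k).2 := by
        simp only [hg, hex, dif_pos]
        obtain ⟨h1, h2⟩ := hex.choose_spec
        have : hex.choose = k := by
          by_contra hne
          have h3 : w.A hex.choose = w.A k := by rw [h2, ← hi]
          rcases lt_or_gt_of_ne hne with hlt | hlt
          · have := w.inj _ _ hlt hk.le h3; omega
          · have := w.inj _ _ hlt h1.le h3.symm; omega
        rw [this, h]
      rw [hz]
      cases (w.A k).2 <;> simp
    · simp [he, hi, h]
    · simp [he, hi, h]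
  refine (encard_le_encard hsub).trans ((encard_insert_le _ _).trans ?_)
  have h2 : ({g false, e} : Set ℂ).encard ≤ 2 := by
    refine (encard_insert_le _ _).trans ?_
    rw [encard_singleton]
    norm_num
  calc ({g false, e} : Set ℂ).encard + 1 ≤ 2 + 1 := by gcongr
    _ = 3 := by norm_num

theorem isReturnPath_lineTrack : (lineTrack w x).IsReturnPath T (w.A 0).1 (!(w.A 0).2) where
  isPPath := isPPath_lineTrack hx
  start_mem := start_mem_qSide w (Ioo_subset_Icc_self ((valid_iff hT _).1 (hx.valid (Nat.zero_le _))))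
  finish_mem := finish_mem_qSide w (Ioo_subset_Icc_self ((valid_iff hT _).1 (hx.valid le_rfl)))
  le_three i _ hs := encard_carrier_inter_qSeg_le hx i hs

/-- The first segment leaves the side into the piece of `A 0`; the last arrives where `A 0` would be
entered again, from the piece across the side, whose tangent is opposite. -/
theorem oppSide_lineTrack : (lineTrack w x).OppSide T (w.A 0).1 (!(w.A 0).2) := by
  have hpos := w.pos
  have v0 := (valid_iff hT _).1 (hx.valid (Nat.zero_le _))
  have v1 := (valid_iff hT _).1 (hx.valid (Nat.sub_le w.len 1))
  have hstep := hx.2 (w.len - 1) (by omega)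
  rw [show w.len - 1 + 1 = w.len by omega] at hstep
  obtain ⟨s1, s2, s3, s4⟩ := (step_iff hT).1 hstep
  set a := w.A (w.len - 1) with ha
  set c := opp (w.A w.len) with hc
  have htan : sideTan T c = -sideTan T a := sideTan_eq_neg hT (a := a) (c := c)
    (y := x + w.shift (w.len - 1)) (y' := -(x + w.shift w.len)) s3 s1 s2.rev s4
  have hc' : c = ((w.A 0).1, !(w.A 0).2) := by rw [hc, ← w.ends]; rfl
  have e1 : cross (sideTan T c) (exitPt T (lineState w x 0) - sidePoint T c 0) < 0 := by
    have h1 := (T c.1).cross_tan_pt_sub c.2 0 (sgn (w.A 0).2) (ht T (lineState w x 0))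
    have h2 := (T c.1).len_pos
    have h3 := (T c.1).height_pos
    have h4 := (T c.1).rad_pos v0
    have h5 : sgn c.2 * sgn (w.A 0).2 = -1 := by
      rw [hc', sgn_not]
      linear_combination -sgn_mul_self (w.A 0).2
    have h6 : exitPt T (lineState w x 0) = (T c.1).pt (sgn (w.A 0).2) (ht T (lineState w x 0)) := by
      rw [hc']; rfl
    rw [h5] at h1
    rw [h6]
    have h7 := mul_pos h3 h4
    by_contra! hneg
    have := mul_nonneg hneg h2.le
    simp only [sideTan, sidePoint] at this
    linarith
  have e2 : 0 < cross (sideTan T c) (entryPt T (lineState w x (w.len - 1)) - sidePoint T c (-(x + w.shift w.len))) := by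
    have h1 := (T a.1).cross_tan_pt_sub a.2 (x + w.shift (w.len - 1)) (sgn (!a.2)) (ht T (lineState w x (w.len - 1)))
    have h2 := (T a.1).len_pos
    have h3 := (T a.1).height_pos
    have h4 := (T a.1).rad_pos v1
    have h5 : sgn a.2 * sgn (!a.2) = -1 := by
      rw [sgn_not]
      linear_combination -sgn_mul_self a.2
    have h6 : sidePoint T c (-(x + w.shift w.len)) = sidePoint T a (x + w.shift (w.len - 1)) := s4.symm
    rw [h5] at h1
    rw [htan, h6, entryPt_eq]
    have h7 := mul_pos h3 h4
    by_contra! hneg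
    have h8 : ∀ u v, cross (-u) v = -cross u v := fun u v => by simp [cross]
    rw [h8] at hneg
    have := mul_nonneg (neg_nonpos.1 hneg) h2.le
    simp only [sideTan, sidePoint, lineState, ← ha] at this h1 h4 h7
    linarith
  have hlast : (lineTrack w x).entry T (Fin.last (lineTrack w x).last) = entryPt T (lineState w x (w.len - 1)) :=
    entry_lineTrack w x _
  have hfirst : (lineTrack w x).exit T 0 = exitPt T (lineState w x 0) := rfl
  rw [Track.OppSide, hlast, hfirst]
  have hsq : 0 < (sgn c.2 * (T c.1).len) ^ 2 := by
    rw [mul_pow, pow_two (sgn c.2), sgn_mul_self, one_mul]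
    exact pow_pos (T c.1).len_pos 2
  have h1 := (T c.1).sideOf_eq c.2 (exitPt T (lineState w x 0)) 0
  have h2 := (T c.1).sideOf_eq c.2 (entryPt T (lineState w x (w.len - 1))) (-(x + w.shift w.len))
  have h3 : (T c.1).sideOf c.2 (exitPt T (lineState w x 0)) *
      (T c.1).sideOf c.2 (entryPt T (lineState w x (w.len - 1))) < 0 := by
    rw [h1, h2]
    have := mul_neg_of_pos_of_neg hsq (mul_neg_of_neg_of_pos e1 e2)
    simp only [sideTan, sidePoint] at this
    linarith
  rw [hc'] at h3
  exact h3

/-- A point of the side other than an endpoint comes from a crossing of its piece. Before the end `A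
0` occurs only at the start, so this crossing has the opposite direction. -/
theorem crossings_lineTrack : (lineTrack w x).crossings T (w.A 0).1 (!(w.A 0).2) =
    {z | ∃ m < w.len, w.A m = opp (w.A 0) ∧ z = exitPt T (lineState w x m)} := by
  ext z
  constructor
  · rintro ⟨⟨hz, hzs⟩, hns, hnf⟩
    rcases mem_carrier_qSeg hx (sgn_mem_Icc _) hz hzs with ⟨k, hk, hi, h⟩ | ⟨-, h⟩ | ⟨hi, -⟩
    · by_cases hb : (w.A k).2 = (w.A 0).2
      · refine absurd ?_ hns
        rw [start_lineTrack, entryPt_eq]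
        have hk0 : k = 0 := by
          by_contra hne
          have := w.inj 0 k (by omega) hk.le (Prod.ext hi.symm hb.symm)
          omega
        rw [h, hk0]
        rfl
      · have hb' : (w.A k).2 = !(w.A 0).2 := by
          cases h1 : (w.A k).2 <;> cases h2 : (w.A 0).2 <;> simp_all
        refine ⟨k, hk, Prod.ext hi hb', ?_⟩
        rw [h, exitPt_eq]
        simp only [lineState, hi, hb']
    · exact absurd h hnf
    · exact absurd rfl hi
  · rintro ⟨m, hm, hA, rfl⟩
    have hv := (valid_iff hT _).1 (hx.valid hm.le)
    -- A coincidence with an endpoint would mean that the orbit runs back along itself.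
    have hne : ∀ k ≤ w.len, w.A k = w.A 0 → exitPt T (lineState w x m) ≠ entryPt T (lineState w x k) := by
      intro k hk hAk he
      have h1 : (lineState w x m).1 = opp (lineState w x k).1 := by simp [lineState, hA, hAk]
      have h2 : sidePoint T (lineState w x m).1 (lineState w x m).2 =
        sidePoint T (lineState w x m).1 (-(lineState w x k).2) := by
        rw [exitPt, entryPt, ← h1] at he
        exact he
      have h3 : lineState w x m = (flow hT).rev (lineState w x k) :=
        Prod.ext h1 (sidePoint_injective T _ h2)
      rcases Nat.le_total k m with hkm | hkm
      · exact hx.ne_rev hkm hm.le h3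
      · exact hx.ne_rev hkm hk (by rw [h3, IntervalFlow.rev_rev])
    refine ⟨⟨?_, ?_⟩, ?_, ?_⟩
    · exact mem_iUnion.2 ⟨⟨m, by simp only [lineTrack]; omega⟩, exitPt_mem_segOf (lineState w x m)⟩
    · rw [exitPt_eq, qSide, mem_qSeg_iff]
      exact ⟨_, Ioo_subset_Icc_self hv, by simp only [lineState, hA, opp]⟩
    · rw [start_lineTrack]
      exact hne 0 (Nat.zero_le _) rfl
    · rw [finish_lineTrack]
      exact hne _ le_rfl w.ends.symm

end Lines

open Piece

/-! ### Strips as standard return regions -/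

section Tubes

variable {n : ℕ} {T : Fin n → Piece} {hT : ∀ i j, i ≠ j → Disjoint (T i).openSet (T j).openSet}

theorem sidePoint_mem_segment_iff (c : Fin n × Bool) (u u' v : ℝ) :
    sidePoint T c v ∈ segment ℝ (sidePoint T c u) (sidePoint T c u') ↔ (v - u) * (v - u') ≤ 0 := by
  have h : ∀ v, sidePoint T c v = sidePoint T c u + (v - u : ℝ) * sideTan T c := by
    intro v
    rw [← sidePoint_add, add_sub_cancel]
  have h1 : sidePoint T c v ∈ segment ℝ (sidePoint T c u) (sidePoint T c u') ↔ v ∈ segment ℝ u u' := by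
    rw [segment_eq_image', segment_eq_image']
    refine exists_congr fun θ => and_congr_right fun _ => ?_
    have h2 : sidePoint T c u + θ • (sidePoint T c u' - sidePoint T c u) = sidePoint T c (u + θ • (u' - u)) := by
      rw [h (u + θ • (u' - u)), h u']
      simp only [Complex.real_smul, smul_eq_mul]
      push_cast
      ring
    simp only [h2, (sidePoint_injective T c).eq_iff]
  rw [h1, segment_eq_uIcc, mem_uIcc, mul_nonpos_iff]
  constructor
  · rintro (⟨h1, h2⟩ | ⟨h1, h2⟩)
    · exact Or.inl ⟨by linarith, by linarith⟩
    · exact Or.inr ⟨by linarith, by linarith⟩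
  · rintro (⟨h1, h2⟩ | ⟨h1, h2⟩)
    · exact Or.inl ⟨by linarith, by linarith⟩
    · exact Or.inr ⟨by linarith, by linarith⟩

theorem ht_injective (a : Fin n × Bool) : Function.Injective fun y => ht T (a, y) := by
  intro y y' h
  exact sidePoint_injective T a (by rw [sidePoint_eq, sidePoint_eq]; exact congrArg _ h)

/-- The range of lines of a strip consists of orbits. -/
def IsFlowStrip (s : Strip (flow hT).NormalWord) : Prop := Ioo s.p s.q ⊆ IntervalFlow.dom Subtype.val s.idx

variable {s t : Strip (flow hT).NormalWord}

theorem IsFlowStrip.ht_mem (hs : IsFlowStrip s) {x : ℝ} (hx : x ∈ Icc s.p s.q) {k : ℕ} (hk : k ≤ s.idx.1.len) :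
    ht T (lineState s.idx.1 x k) ∈ Icc (0 : ℝ) 1 := by
  have h := IntervalFlow.bounds_of_subset_dom s.lt hs hk
  refine (mem_closed_range_iff T _ _).1 ?_
  constructor
  · exact h.1.trans (by simpa using hx.1)
  · exact le_trans (by simpa using hx.2) h.2

theorem IsFlowStrip.isPath (hs : IsFlowStrip s) {x : ℝ} (hx : x ∈ Ioo s.p s.q) :
    (flow hT).IsPath (lineState s.idx.1 x) s.idx.1.len := IntervalFlow.isPath_state (hs hx)

/-- The tube swept out by the lines of a strip. -/
noncomputable def tubeOf (s : Strip (flow hT).NormalWord) (hs : IsFlowStrip s) : Tube T where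
  last := s.idx.1.len - 1
  cross k := ⟨(s.idx.1.A k).1, (s.idx.1.A k).2⟩
  h₀ k := ht T (lineState s.idx.1 s.p k)
  h₁ k := ht T (lineState s.idx.1 s.q k)
  h₀_mem k := hs.ht_mem (left_mem_Icc.2 s.lt.le) (by have := k.2; omega)
  h₁_mem k := hs.ht_mem (right_mem_Icc.2 s.lt.le) (by have := k.2; omega)
  ne k h := s.lt.ne (by simpa using ht_injective (s.idx.1.A k) h)
  joined₀ := joined_lineTrack s.idx.1 s.p
  joined₁ := joined_lineTrack s.idx.1 s.q

theorem path_tubeOf (hs : IsFlowStrip s) (σ : ℝ) :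
    (tubeOf s hs).path σ = lineTrack s.idx.1 ((1 - σ) * s.p + σ * s.q) := by
  have : (fun k : Fin (s.idx.1.len - 1 + 1) =>
      (1 - σ) * ht T (lineState s.idx.1 s.p k) + σ * ht T (lineState s.idx.1 s.q k)) =
      fun k : Fin (s.idx.1.len - 1 + 1) => ht T (lineState s.idx.1 ((1 - σ) * s.p + σ * s.q) k) := by
    funext k
    simp only [ht, lineState]
    ring
  exact congrArg (Track.mk (s.idx.1.len - 1) fun k => ⟨(s.idx.1.A k).1, (s.idx.1.A k).2⟩) this

theorem convex_comb_mem_Ioo (s : Strip (flow hT).NormalWord) {σ : ℝ} (hσ : σ ∈ Ioo (0 : ℝ) 1) :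
    (1 - σ) * s.p + σ * s.q ∈ Ioo s.p s.q := by
  have := s.lt
  have h1 := mul_pos hσ.1 (sub_pos.2 this)
  have h2 := mul_pos (sub_pos.2 hσ.2) (sub_pos.2 this)
  constructor <;> linarith

theorem convex_comb_mem_Icc (s : Strip (flow hT).NormalWord) {σ : ℝ} (hσ : σ ∈ Icc (0 : ℝ) 1) :
    (1 - σ) * s.p + σ * s.q ∈ Icc s.p s.q := by
  have := s.lt
  have h1 := mul_nonneg hσ.1 (sub_pos.2 this).le
  have h2 := mul_nonneg (sub_nonneg.2 hσ.2) (sub_pos.2 this).le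
  constructor <;> linarith

/-- Whether the side is crossed in between depends only on the word. If it is, the crossing point
never meets an endpoint, so by continuity its separating the endpoints or not is the same along the
whole strip. -/
theorem isReturnTube_tubeOf (hs : IsFlowStrip s) : ∃ κ, (tubeOf s hs).IsReturnTube κ := by
  suffices h : ∃ κ, ∀ x ∈ Ioo s.p s.q,
      IsReturnCurve T (s.idx.1.A 0).1 (!(s.idx.1.A 0).2) (lineTrack s.idx.1 x) κ by
    obtain ⟨κ, h⟩ := h
    exact ⟨κ, _, _, fun σ hσ => by rw [path_tubeOf]; exact h _ (convex_comb_mem_Ioo s hσ)⟩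
  set w := s.idx.1 with hw
  by_cases hex : ∃ m < w.len, w.A m = opp (w.A 0)
  · obtain ⟨m, hm, hA⟩ := hex
    have hcr : ∀ x ∈ Ioo s.p s.q, (lineTrack w x).crossings T (w.A 0).1 (!(w.A 0).2) =
        {exitPt T (lineState w x m)} := by
      intro x hx
      rw [crossings_lineTrack (hs.isPath hx)]
      ext z
      simp only [mem_ofPred_eq, mem_singleton_iff]
      constructor
      · rintro ⟨k, hk, hk', rfl⟩
        have : k = m := by
          by_contra hne
          rcases lt_or_gt_of_ne hne with hlt | hlt
          · exact absurd (w.inj _ _ hlt hm.le (hk'.trans hA.symm)).2 hm.ne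
          · exact absurd (w.inj _ _ hlt hk.le (hA.trans hk'.symm)).2 hk.ne
        rw [this]
      · rintro rfl
        exact ⟨m, hm, hA, rfl⟩
    set c := opp (w.A 0) with hc
    have hz : ∀ x, exitPt T (lineState w x m) = sidePoint T c (x + w.shift m) := by
      intro x; simp only [exitPt, lineState, hA]
    have hst : ∀ x, (lineTrack w x).start T = sidePoint T c (-(x + w.shift 0)) := start_lineTrack w
    have hfi : ∀ x, (lineTrack w x).finish T = sidePoint T c (-(x + w.shift w.len)) := by
      intro x; rw [finish_lineTrack]; simp only [entryPt, lineState, hc, w.ends]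
    set ψ : ℝ → ℝ := fun x => (x + w.shift m - -(x + w.shift 0)) * (x + w.shift m - -(x + w.shift w.len)) with hψ
    have hmem : ∀ x, exitPt T (lineState w x m) ∈ segment ℝ ((lineTrack w x).start T) ((lineTrack w x).finish T) ↔
        ψ x ≤ 0 := by
      intro x
      rw [hz, hst, hfi, sidePoint_mem_segment_iff]
    have hne : ∀ x ∈ Ioo s.p s.q, ψ x ≠ 0 := by
      intro x hx h0
      have : exitPt T (lineState w x m) ∈ (lineTrack w x).crossings T (w.A 0).1 (!(w.A 0).2) := by
        rw [hcr x hx]; rfl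
      obtain ⟨-, h1, h2⟩ := this
      rcases mul_eq_zero.1 h0 with h | h
      · exact h1 (by rw [hz, hst, sub_eq_zero.1 h])
      · exact h2 (by rw [hz, hfi, sub_eq_zero.1 h])
    by_cases hneg : ∃ x₀ ∈ Ioo s.p s.q, ψ x₀ ≤ 0
    · obtain ⟨x₀, hx₀, h0⟩ := hneg
      refine ⟨Kind.S, fun x hx => ⟨isReturnPath_lineTrack (hs.isPath hx), oppSide_lineTrack (hs.isPath hx),
        _, hcr x hx, (hmem x).2 ?_⟩⟩
      by_contra! hpos
      have hcont : ContinuousOn ψ (Ioo s.p s.q) := by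
        apply Continuous.continuousOn
        fun_prop
      obtain ⟨x₁, hx₁, h1⟩ := isPreconnected_Ioo.intermediate_value hx₀ hx hcont ⟨h0, hpos.le⟩
      exact hne x₁ hx₁ h1
    · push Not at hneg
      exact ⟨Kind.G1, fun x hx => ⟨isReturnPath_lineTrack (hs.isPath hx), oppSide_lineTrack (hs.isPath hx),
        _, hcr x hx, fun hc => absurd ((hmem x).1 hc) (not_le.2 (hneg x hx))⟩⟩
  · refine ⟨Kind.G2, fun x hx => ⟨isReturnPath_lineTrack (hs.isPath hx), oppSide_lineTrack (hs.isPath hx), ?_⟩⟩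
    rw [crossings_lineTrack (hs.isPath hx)]
    refine eq_empty_of_forall_notMem ?_
    rintro z ⟨m, hm, hA, -⟩
    exact hex ⟨m, hm, hA⟩

/-- Both ends lie on the entry side of the first letter, which is a gate, so a single `Q`-end serves
for both. -/
theorem isStandard_tubeOf (hs : IsFlowStrip s) (hQ : ∀ b ∈ (flow hT).gate, IsQEnd T b.1 (!b.2)) :
    (tubeOf s hs).IsStandard := by
  refine ⟨isReturnTube_tubeOf hs, ⟨_, _, hQ _ s.idx.1.gate, fun σ hσ => ?_⟩,
    ⟨_, _, hQ _ s.idx.1.gate, fun σ hσ => ?_⟩⟩ <;> rw [path_tubeOf]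
  · exact start_mem_qSide _ (hs.ht_mem (convex_comb_mem_Icc s hσ) (Nat.zero_le _))
  · exact finish_mem_qSide _ (hs.ht_mem (convex_comb_mem_Icc s hσ) le_rfl)

theorem mem_carrier_tubeOf (hs : IsFlowStrip s) {z : ℂ} :
    z ∈ (tubeOf s hs).carrier ↔ ∃ x ∈ Icc s.p s.q, ∃ k < s.idx.1.len, z ∈ segOf T (lineState s.idx.1 x k) := by
  have hlen := s.idx.1.pos
  constructor
  · intro hz
    obtain ⟨σ, hσ, hz⟩ := mem_iUnion₂.1 hz
    rw [path_tubeOf] at hz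
    obtain ⟨k, hk⟩ := mem_iUnion.1 hz
    exact ⟨_, convex_comb_mem_Icc s hσ, k, by have := k.2; simp only [lineTrack] at this; omega, hk⟩
  · rintro ⟨x, hx, k, hk, hz⟩
    have hpq := sub_pos.2 s.lt
    refine mem_iUnion₂.2 ⟨(x - s.p) / (s.q - s.p), ⟨?_, ?_⟩, ?_⟩
    · exact div_nonneg (by linarith [hx.1]) hpq.le
    · rw [div_le_one hpq]; linarith [hx.2]
    · rw [path_tubeOf]
      have : (1 - (x - s.p) / (s.q - s.p)) * s.p + (x - s.p) / (s.q - s.p) * s.q = x := by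
        field_simp
        ring
      rw [this]
      exact mem_iUnion.2 ⟨⟨k, by simp only [lineTrack]; omega⟩, hz⟩

/-- A point inside a piece lies on a segment of a line only where the line crosses this piece. -/
theorem IsFlowStrip.eq_of_mem_openSet (hs : IsFlowStrip s) {i : Fin n} {z : ℂ} (hz : z ∈ (T i).openSet)
    (hzs : z ∈ (tubeOf s hs).carrier) : ∃ x ∈ Icc s.p s.q, ∃ k < s.idx.1.len, i = (s.idx.1.A k).1 ∧
      ((T i).coord z).re = ht T (lineState s.idx.1 x k) * (T i).height := by
  obtain ⟨x, hx, k, hk, h⟩ := (mem_carrier_tubeOf hs).1 hzs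
  obtain ⟨u, hu, rfl⟩ := (mem_pSeg_iff _).1 h
  have hi := Iso.eq_of_mem_openSet hT hz (pt_mem_closure _ hu (hs.ht_mem hx hk.le))
  refine ⟨x, hx, k, hk, hi, ?_⟩
  simp only [lineState] at hi
  subst hi
  exact coord_pt_re _ _ _

/-- A common inner point can be moved into a piece and then along its axis, away from the finitely
many heights of tube edges. There the open strips have crossings of one piece at one height, hence a
common state up to direction. -/
theorem disjoint_interior_tubeOf (hs : IsFlowStrip s) (ht' : IsFlowStrip t)
    (hd : DisjointStrips (IntervalFlow.Over Subtype.val) s t) :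
    Disjoint (interior (tubeOf s hs).carrier) (interior (tubeOf t ht').carrier) := by
  rw [Set.disjoint_iff_inter_eq_empty, ← not_nonempty_iff_eq_empty]
  rintro ⟨z, hz⟩
  have hU : IsOpen (interior (tubeOf s hs).carrier ∩ interior (tubeOf t ht').carrier) :=
    isOpen_interior.inter isOpen_interior
  obtain ⟨i, hzi⟩ : ∃ i, z ∈ closure (T i).openSet := by
    obtain ⟨x, hx, k, hk, h⟩ := (mem_carrier_tubeOf hs).1 (interior_subset hz.1)
    obtain ⟨u, hu, rfl⟩ := (mem_pSeg_iff _).1 h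
    exact ⟨_, pt_mem_closure _ hu (hs.ht_mem hx hk.le)⟩
  obtain ⟨z₀, hz₀U, hz₀i⟩ := mem_closure_iff.1 hzi _ hU hz
  obtain ⟨δ, hδ, hball⟩ := Metric.isOpen_iff.1 (hU.inter (T i).isOpen_openSet) z₀ ⟨hz₀U, hz₀i⟩
  set B : Set ℝ := ⋃ r ∈ ({s, t} : Set (Strip (flow hT).NormalWord)), ⋃ k ∈ Iio r.idx.1.len,
    {ht T (lineState r.idx.1 r.p k) * (T i).height, ht T (lineState r.idx.1 r.q k) * (T i).height} with hB
  have hBfin : B.Finite := (by simp : ({s, t} : Set (Strip (flow hT).NormalWord)).Finite).biUnion fun r _ =>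
    (finite_Iio _).biUnion fun k _ => by simp
  obtain ⟨ε, hε, hεB⟩ := (Ioo_infinite hδ).exists_notMem_finite
    (hBfin.preimage (add_right_injective ((T i).coord z₀).re).injOn)
  set z₁ : ℂ := z₀ + ε * (T i).axis with hz₁
  obtain ⟨⟨h1s, h1t⟩, h1i⟩ := hball (show z₁ ∈ Metric.ball z₀ δ by
    rw [Metric.mem_ball, hz₁, dist_self_add_left, norm_mul, norm_axis, mul_one, Complex.norm_real,
      Real.norm_of_nonneg hε.1.le]
    exact hε.2)
  have hcoord : ((T i).coord z₁).re = ((T i).coord z₀).re + ε := by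
    have : (T i).coord z₁ = (T i).coord z₀ + ε := by
      rw [coord, coord, hz₁]
      linear_combination (ε : ℂ) * (T i).conj_axis_mul_axis
    rw [this, Complex.add_re, Complex.ofReal_re]
  have hgen : ((T i).coord z₁).re ∉ B := hcoord ▸ hεB
  have key : ∀ r ∈ ({s, t} : Set (Strip (flow hT).NormalWord)), ∀ hr : IsFlowStrip r,
      z₁ ∈ (tubeOf r hr).carrier → ∃ x ∈ Ioo r.p r.q, ∃ k < r.idx.1.len, i = (r.idx.1.A k).1 ∧
      ((T i).coord z₁).re = ht T (lineState r.idx.1 x k) * (T i).height := by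
    intro r hr hrs hz
    obtain ⟨x, hx, k, hk, hik, hc⟩ := hrs.eq_of_mem_openSet h1i hz
    refine ⟨x, ⟨lt_of_le_of_ne hx.1 ?_, lt_of_le_of_ne hx.2 ?_⟩, k, hk, hik, hc⟩
    · rintro rfl
      refine hgen (mem_iUnion₂.2 ⟨r, hr, mem_iUnion₂.2 ⟨k, hk, ?_⟩⟩)
      rw [hc]; simp
    · rintro rfl
      refine hgen (mem_iUnion₂.2 ⟨r, hr, mem_iUnion₂.2 ⟨k, hk, ?_⟩⟩)
      rw [hc]; simp
  obtain ⟨x, hx, k, hk, hik, hc⟩ := key s (by simp) hs (interior_subset h1s)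
  obtain ⟨x', hx', k', hk', hik', hc'⟩ := key t (by simp) ht' (interior_subset h1t)
  have hh : ht T (lineState s.idx.1 x k) = ht T (lineState t.idx.1 x' k') :=
    mul_right_cancel₀ (T i).height_pos.ne' (hc.symm.trans hc')
  refine hd x hx x' hx' ⟨k, hk.le, k', hk'.le, ?_⟩
  rcases eq_or_eq_rev hT (hik.symm.trans hik') hh with h | h
  · exact Or.inl h.symm
  · exact Or.inr h

/-- A crossing that takes place along a line of a strip meets its tube. -/
theorem inter_carrier_nonempty (hs : IsFlowStrip s) {x : ℝ} (hx : x ∈ Icc s.p s.q) {k : ℕ}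
    (hk : k ≤ s.idx.1.len) : (segOf T (lineState s.idx.1 x k) ∩ (tubeOf s hs).carrier).Nonempty := by
  have hlen := s.idx.1.pos
  rcases hk.lt_or_eq with h | h
  · exact ⟨_, entryPt_mem_segOf _, (mem_carrier_tubeOf hs).2 ⟨x, hx, k, h, entryPt_mem_segOf _⟩⟩
  -- The segment of the state `len` is not listed in the tube, but its entry point is the exit point
  -- of the preceding crossing.
  · refine ⟨_, entryPt_mem_segOf _, (mem_carrier_tubeOf hs).2 ⟨x, hx, k - 1, by omega, ?_⟩⟩
    have := exitPt_lineState s.idx.1 x (k := k - 1) (by omega)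
    rw [show k - 1 + 1 = k by omega] at this
    rw [← this]
    exact exitPt_mem_segOf _

end Tubes

/-! ### `P`-paths as orbits -/

section Paths

variable {n : ℕ} {T : Fin n → Piece} (hT : ∀ i j, i ≠ j → Disjoint (T i).openSet (T j).openSet)

variable (T) in
/-- The states of a track. -/
noncomputable def trackState (γ : Track n) (k : ℕ) : (Fin n × Bool) × ℝ :=
  let c := γ.cross (Fin.ofNat (γ.last + 1) k)
  -- The parameter inverts `ht`. The index is read modulo `last + 1`, and only `k ≤ last` matters.
  ((c.piece, c.fwd), sgn c.fwd * γ.height (Fin.ofNat (γ.last + 1) k) * (T c.piece).len)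

theorem ht_trackState (γ : Track n) (k : ℕ) : ht T (trackState T γ k) = γ.height (Fin.ofNat (γ.last + 1) k) := by
  simp only [ht, trackState]
  rw [← mul_assoc, ← mul_assoc, sgn_mul_self, one_mul, mul_div_cancel_right₀]
  exact (T _).len_pos.ne'

theorem segOf_trackState (γ : Track n) (k : ℕ) : segOf T (trackState T γ k) = γ.seg T (Fin.ofNat (γ.last + 1) k) := by
  rw [segOf, ht_trackState]
  rfl

theorem exitPt_trackState (γ : Track n) (k : ℕ) : exitPt T (trackState T γ k) = γ.exit T (Fin.ofNat (γ.last + 1) k) := by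
  rw [exitPt_eq, ht_trackState]
  rfl

theorem entryPt_trackState (γ : Track n) (k : ℕ) :
    entryPt T (trackState T γ k) = γ.entry T (Fin.ofNat (γ.last + 1) k) := by
  rw [entryPt_eq, ht_trackState]
  rfl

variable {γ : Track n} (hγ : γ.IsPPath T)
include hγ

theorem valid_trackState (k : ℕ) : (flow hT).Valid (trackState T γ k) := by
  rw [valid_iff, ht_trackState]
  exact hγ.height_mem _

omit hγ in
theorem val_ofNat_track {k : ℕ} (hk : k ≤ γ.last) : (Fin.ofNat (γ.last + 1) k : ℕ) = k := by
  rw [Fin.val_ofNat, Nat.mod_eq_of_lt (by omega)]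

/-- By simplicity two segments share at most one point, whereas a segment has two different
endpoints. -/
theorem segOf_trackState_ne {i j : ℕ} (hij : i < j) (hj : j ≤ γ.last) :
    segOf T (trackState T γ i) ≠ segOf T (trackState T γ j) := by
  intro h
  have hlt : Fin.ofNat (γ.last + 1) i < Fin.ofNat (γ.last + 1) j := by
    rw [Fin.lt_def, val_ofNat_track (by omega), val_ofNat_track hj]
    exact hij
  have key : ∀ z ∈ segOf T (trackState T γ i), z = exitPt T (trackState T γ i) := by
    intro z hz
    rw [exitPt_trackState]
    exact (hγ.simple _ _ hlt z (segOf_trackState γ i ▸ hz) (segOf_trackState γ j ▸ h ▸ hz)).2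
  have h0 : ht T (trackState T γ i) ∈ Ioo (0 : ℝ) 1 := by
    rw [ht_trackState]
    exact hγ.height_mem _
  have h1 := key _ (entryPt_mem_segOf _)
  rw [entryPt_eq, exitPt_eq] at h1
  have := sgn_injective (pos_eq_of_pt_eq _ h0 h1)
  simp at this

theorem isPath_trackState : (flow hT).IsPath (trackState T γ) γ.last := by
  refine ⟨valid_trackState hT hγ 0, fun k hk => (step_iff hT).2
    ⟨valid_trackState hT hγ k, valid_trackState hT hγ (k + 1), fun hp => ?_, ?_⟩⟩
  -- Consecutive crossings of one piece would be joined at the same height and repeat the segment.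
  · have hj : exitPt T (trackState T γ k) = entryPt T (trackState T γ (k + 1)) := by
      rw [exitPt_trackState, entryPt_trackState]
      exact hγ.joined _ _ (by rw [val_ofNat_track hk.le, val_ofNat_track hk])
    rw [exitPt_eq, entryPt_eq, hp] at hj
    refine segOf_trackState_ne hγ (Nat.lt_succ_self k) hk ?_
    rw [segOf, segOf, hp, height_eq_of_pt_eq _ hj]
  · rw [exitPt_trackState, entryPt_trackState]
    exact hγ.joined _ _ (by rw [val_ofNat_track hk.le, val_ofNat_track hk])

omit hγ in
/-- A track with many segments has three crossings of one piece in the same direction. -/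
theorem exists_three_eq (h : 5 * n + 1 < γ.numSegs) : ∃ k₁ k₂ k₃, k₁ < k₂ ∧ k₂ < k₃ ∧ k₃ ≤ γ.last ∧
    (trackState T γ k₁).1 = (trackState T γ k₂).1 ∧ (trackState T γ k₂).1 = (trackState T γ k₃).1 := by
  classical
  -- With `2n` letters, more than `4n` segments already suffice for a fibre of three.
  obtain ⟨a, ha⟩ := Fintype.exists_lt_card_fiber_of_mul_lt_card
    (fun k : Fin (γ.last + 1) => (trackState T γ k).1) (n := 2) (by
      simp only [Fintype.card_prod, Fintype.card_fin, Fintype.card_bool]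
      simp only [Track.numSegs] at h
      omega)
  have hmem := fun j => Finset.orderEmbOfCardLe_mem _ ha j
  set e := Finset.orderEmbOfCardLe _ ha
  have hlt : ∀ i j : Fin 3, i < j → ((e i : Fin _) : ℕ) < e j := fun i j hij => e.strictMono hij
  have heq : ∀ j : Fin 3, (trackState T γ (e j)).1 = a := fun j => by simpa using hmem j
  exact ⟨e 0, e 1, e 2, hlt 0 1 (by decide), hlt 1 2 (by decide), Nat.lt_succ_iff.1 (e 2).2,
    (heq 0).trans (heq 1).symm, (heq 1).trans (heq 2).symm⟩

end Paths

open Piece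

/-! ### Counting gates by chains -/

section Chains

variable {n : ℕ} {T : Fin n → Piece}

theorem SharesQSide.symm {i j : Fin n} (h : SharesQSide T i j) : SharesQSide T j i := by
  obtain ⟨hne, b, c, h⟩ := h
  exact ⟨hne.symm, c, b, h.symm⟩

theorem IsPreChain.reverse {L : List (Fin n)} (h : IsPreChain T L) : IsPreChain T L.reverse := by
  refine ⟨by simpa using h.1, List.nodup_reverse.2 h.2.1, List.isChain_reverse.2 ?_⟩
  exact h.2.2.imp fun _ _ h => h.symm

theorem isPreChain_singleton (j : Fin n) : IsPreChain T [j] := ⟨by simp, by simp, by simp⟩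

variable (hT : ∀ i j, i ≠ j → Disjoint (T i).openSet (T j).openSet)
include hT

/-- A piece with an unshared `Q`-side has at most one neighbour. -/
theorem neighbour_unique {b : Fin n × Bool} (hb : b ∈ (flow hT).gate) {i i' : Fin n}
    (hi : SharesQSide T b.1 i) (hi' : SharesQSide T b.1 i') : i = i' := by
  rw [mem_gate_iff] at hb
  have key : ∀ k, SharesQSide T b.1 k → ∃ c, (T b.1).qSide b.2 = (T k).qSide c := by
    rintro k ⟨hne, d, c, h⟩
    have hd : d = b.2 := by
      by_contra hd
      have hd' : d = !b.2 := by cases d <;> cases h2 : b.2 <;> simp_all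
      exact hb (k, c) hne.symm (hd' ▸ h)
    exact ⟨c, hd ▸ h⟩
  obtain ⟨c, h⟩ := key i hi
  obtain ⟨c', h'⟩ := key i' hi'
  have hm := (meets_of_qSide_eq hT (a := b) (c := (i, c)) hi.1 h).1
  exact congrArg Prod.fst (eq_of_meets_of_qSide_eq hT (c := (i', c')) hm hi'.1 h')

/-- In the interior of the list the piece would have two different neighbours. -/
theorem eq_cons_or_eq_concat {b : Fin n × Bool} (hb : b ∈ (flow hT).gate) {L : List (Fin n)}
    (hL : IsPreChain T L) (hmem : b.1 ∈ L) : (∃ l, L = b.1 :: l) ∨ ∃ l, L = l ++ [b.1] := by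
  obtain ⟨l₁, l₂, rfl⟩ := List.append_of_mem hmem
  rcases List.eq_nil_or_concat l₁ with rfl | ⟨l₁, x, rfl⟩
  · exact Or.inl ⟨l₂, by simp⟩
  rcases l₂ with _ | ⟨y, l₂⟩
  · exact Or.inr ⟨_, rfl⟩
  exfalso
  obtain ⟨-, hnd, hch⟩ := hL
  have h1 : SharesQSide T x b.1 := (List.isChain_append.1 hch).2.2 x (by simp) b.1 (by simp)
  have h2 : SharesQSide T b.1 y := (List.isChain_cons_cons.1 (List.isChain_append.1 hch).2.1).1
  have h3 := neighbour_unique hT hb h1.symm h2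
  subst h3
  have := (List.nodup_append.1 hnd).2.2 x (by simp) x (by simp)
  exact this rfl

/-- A longest list starting with the piece is a chain: a larger collection has the piece at one of
its ends and, possibly reversed, is a competing list. -/
theorem exists_isChainList {b : Fin n × Bool} (hb : b ∈ (flow hT).gate) : ∃ L, IsChainList T (b.1 :: L) := by
  classical
  have hbound : ∀ m, (∃ L, IsPreChain T (b.1 :: L) ∧ (b.1 :: L).length = m) → m ≤ n := by
    rintro m ⟨L, hL, rfl⟩
    simpa using hL.2.1.length_le_card
  have hex : ∃ m, ∃ L, IsPreChain T (b.1 :: L) ∧ (b.1 :: L).length = m :=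
    ⟨1, [], isPreChain_singleton _, rfl⟩
  obtain ⟨m₀, hm₀⟩ := hex
  obtain ⟨L, hL, hLm⟩ := Nat.findGreatest_spec
    (P := fun m => ∃ L, IsPreChain T (b.1 :: L) ∧ (b.1 :: L).length = m) (hbound m₀ hm₀) hm₀
  have hmax : ∀ L', IsPreChain T (b.1 :: L') → (b.1 :: L').length ≤ (b.1 :: L).length := by
    intro L' hL'
    rw [hLm]
    exact Nat.le_findGreatest (hbound _ ⟨L', hL', rfl⟩) ⟨L', hL', rfl⟩
  have key : ∀ L', IsPreChain T (b.1 :: L') → b.1 :: L ⊆ b.1 :: L' → b.1 :: L' ⊆ b.1 :: L := by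
    intro L' hL' hsub
    exact ((List.subperm_of_subset hL.2.1 hsub).perm_of_length_le (hmax L' hL')).symm.subset
  refine ⟨L, hL, fun L' hL' hsub => ?_⟩
  rcases eq_cons_or_eq_concat hT hb hL' (hsub (by simp)) with ⟨l, rfl⟩ | ⟨l, rfl⟩
  · exact key l hL' hsub
  · have h1 := hL'.reverse
    rw [List.reverse_append] at h1
    have h2 := key l.reverse h1 fun x hx => by simpa [or_comm] using hsub hx
    intro x hx
    exact h2 (by simpa [or_comm] using hx)

theorem isQEnd_of_mem_gate {b : Fin n × Bool} (hb : b ∈ (flow hT).gate) : IsQEnd T b.1 (!b.2) := by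
  obtain ⟨L, hL⟩ := exists_isChainList hT hb
  refine ⟨L, hL, fun i hi c => (mem_gate_iff hT b).1 hb (i, c) ?_⟩
  rintro rfl
  exact (List.nodup_cons.1 hL.1.2.1).1 (List.mem_of_mem_head? hi)

theorem exists_sharesQSide {L : List (Fin n)} (hL : IsPreChain T L) (h2 : 2 ≤ L.length) {b : Fin n × Bool}
    (hb : b ∈ (flow hT).gate) (hmem : b.1 ∈ L) : ∃ i, SharesQSide T b.1 i := by
  have key : ∀ l, IsPreChain T (b.1 :: l) → 2 ≤ (b.1 :: l).length → ∃ i, SharesQSide T b.1 i := by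
    rintro (_ | ⟨i, l⟩) hl h
    · simp at h
    · exact ⟨i, (List.isChain_cons_cons.1 hl.2.2).1⟩
  rcases eq_cons_or_eq_concat hT hb hL hmem with ⟨l, rfl⟩ | ⟨l, rfl⟩
  · exact key l hL h2
  · refine key l.reverse ?_ (by simpa using h2)
    have := hL.reverse
    rwa [List.reverse_append] at this

/-- A chain has at most two unshared `Q`-sides. -/
theorem card_gate_le : (flow hT).gate.card ≤ 2 * numChains T := by
  classical
  have hex : ∀ b : Fin n × Bool, ∃ C : Finset (Fin n), b ∈ (flow hT).gate →
      ∃ L, IsChainList T (b.1 :: L) ∧ (b.1 :: L).toFinset = C := by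
    intro b
    by_cases hb : b ∈ (flow hT).gate
    · obtain ⟨L, hL⟩ := exists_isChainList hT hb
      exact ⟨_, fun _ => ⟨L, hL, rfl⟩⟩
    · exact ⟨∅, fun h => absurd h hb⟩
  choose f hf using hex
  rw [numChains, ncard_eq_toFinset_card _ (toFinite _)]
  refine Finset.card_le_mul_card_image_of_maps_to (f := f) ?_ 2 ?_
  · intro b hb
    obtain ⟨L, hL, hC⟩ := hf b hb
    exact (Finite.mem_toFinset _).2 ⟨_, hL, hC⟩
  · intro C hC
    obtain ⟨L, hL, rfl⟩ := (Finite.mem_toFinset _).1 hC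
    have hmem : ∀ b ∈ (flow hT).gate.filter fun b => f b = L.toFinset, b ∈ (flow hT).gate ∧ b.1 ∈ L := by
      intro b hb
      obtain ⟨h1, h2⟩ := Finset.mem_filter.1 hb
      obtain ⟨l, -, h3⟩ := hf b h1
      refine ⟨h1, ?_⟩
      rw [← List.mem_toFinset, ← h2, ← h3]
      simp
    obtain ⟨x, l, rfl⟩ := List.exists_cons_of_ne_nil hL.1.1
    have hcard : ∀ g : Fin n × Bool → Bool,
        InjOn g ((flow hT).gate.filter fun b => f b = (x :: l).toFinset) →
        ((flow hT).gate.filter fun b => f b = (x :: l).toFinset).card ≤ 2 := fun g hg => by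
      simpa using Finset.card_le_card_of_injOn (t := Finset.univ) g (fun _ _ => Finset.mem_univ _) hg
    -- A single piece has two sides. In a longer chain a gate belongs to the first or the last
    -- piece, which shares one of its sides with a neighbour and so carries only one gate.
    rcases Nat.lt_or_ge (x :: l).length 2 with h2 | h2
    · obtain rfl : l = [] := by
        apply List.length_eq_zero_iff.1
        simp only [List.length_cons] at h2
        omega
      refine hcard Prod.snd fun b hb b' hb' h => ?_
      have h3 := (hmem b hb).2
      have h4 := (hmem b' hb').2
      rw [List.mem_singleton] at h3 h4
      exact Prod.ext (h3.trans h4.symm) h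
    · refine hcard (fun b => decide (b.1 = x)) fun b hb b' hb' h => ?_
      obtain ⟨hg, hm⟩ := hmem b hb
      obtain ⟨hg', hm'⟩ := hmem b' hb'
      have h1 : b.1 = b'.1 := by
        by_cases hx : b.1 = x
        · have : b'.1 = x := by simpa [hx] using h
          rw [hx, this]
        · have hx' : b'.1 ≠ x := by
            intro hc
            exact hx (by simpa [hc] using h)
          rcases eq_cons_or_eq_concat hT hg hL.1 hm with ⟨k, hk⟩ | ⟨k, hk⟩
          · exact absurd (List.cons.inj hk).1.symm hx
          rcases eq_cons_or_eq_concat hT hg' hL.1 hm' with ⟨k', hk'⟩ | ⟨k', hk'⟩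
          · exact absurd (List.cons.inj hk').1.symm hx'
          have := List.append_inj' (hk.symm.trans hk') rfl
          simpa using this.2
      obtain ⟨i, hi⟩ := exists_sharesQSide hT hL.1 h2 hg hm
      obtain ⟨hne, d, c, hdc⟩ := hi
      by_contra hbb
      have h2 : b.2 ≠ b'.2 := fun h2 => hbb (Prod.ext h1 h2)
      have h3 : d = !b.2 ∨ d = !b'.2 := by
        cases d <;> cases h5 : b.2 <;> cases h6 : b'.2 <;> simp_all
      rcases h3 with h3 | h3
      · exact (mem_gate_iff hT b).1 hg (i, c) hne.symm (h3 ▸ hdc)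
      · exact (mem_gate_iff hT b').1 hg' (i, c) (h1 ▸ hne.symm) (h3 ▸ h1 ▸ hdc)

end Chains

end Iso

/-! ### Conclusion -/

theorem mainTheorem10 :
    ∃ K : ℕ, ∀ (n : ℕ) (Ω : Set ℂ) (T : Fin n → Iso.Piece), Iso.IsDissection Ω T →
      ∃ (N : ℕ) (R : Fin N → Iso.Tube T),
        N ≤ K * Iso.numChains T ∧
        (∀ k, (R k).IsStandard) ∧
        (∀ k l, k ≠ l → Disjoint (interior (R k).carrier) (interior (R l).carrier)) ∧
        ∀ γ : Iso.Track n, γ.IsPPath T → 5 * n + 1 < γ.numSegs →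
          ∃ k, (γ.carrier T ∩ (R k).carrier).Nonempty := by
  -- At most `91` strips per gate and two gates per chain.
  refine ⟨182, fun n Ω T hΩ => ?_⟩
  have hT := hΩ.disj
  obtain ⟨X, hl, hs, hd, hX⟩ := Iso.IntervalFlow.exists_strips_of_path (Iso.flow hT)
  have hflow : ∀ k : Fin X.length, Iso.IsFlowStrip (X.get k) := fun k => hs _ (X.get_mem k)
  refine ⟨X.length, fun k => Iso.tubeOf (X.get k) (hflow k), ?_, ?_, ?_, ?_⟩
  · have := Iso.card_gate_le hT
    omega
  · exact fun k => Iso.isStandard_tubeOf (hflow k) fun b hb => Iso.isQEnd_of_mem_gate hT hb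
  · intro k l hkl
    rcases lt_or_gt_of_ne hkl with h | h
    · exact Iso.disjoint_interior_tubeOf _ _ (List.pairwise_iff_get.1 hd k l h)
    · exact (Iso.disjoint_interior_tubeOf _ _ (List.pairwise_iff_get.1 hd l k h)).symm
  · intro γ hγ hlong
    obtain ⟨s, hsX, y, hy, k, hk, k', -, h⟩ := hX _ _ (Iso.isPath_trackState hT hγ)
      (fun i j hij hj h => Iso.segOf_trackState_ne hγ hij hj (by rw [h])) (Iso.exists_three_eq hlong)
    obtain ⟨m, rfl⟩ := List.get_of_mem hsX
    refine ⟨m, (Iso.inter_carrier_nonempty (hflow m) hy hk).mono (inter_subset_inter_left _ ?_)⟩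
    have hseg : Iso.segOf T (Iso.lineState (X.get m).idx.1 y k) = Iso.segOf T (Iso.trackState T γ k') := by
      change Iso.segOf T (Iso.IntervalFlow.state Subtype.val (X.get m).idx y k) = _
      rcases h with h | h <;> rw [h]
      exact Iso.segOf_rev hT _
    rw [hseg, Iso.segOf_trackState]
    exact subset_iUnion (γ.seg T) _
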